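/- **Setting.** An orthogonal category is a category with a symmetric relation $\perp$ on pairs of morphisms with common target that is stable under pre- and postcomposition. A 2AQFT over a commutative ring $K$ on it is a pseudo-morphism from the prefactorization operad (operations: tuples of mutually orthogonal morphisms with common target) to the $\mathbf{Cat}$-enriched operad of locally presentable $K$-linear categories and functors that are $K$-linear and cocontinuous in each variable; its value on the nullary operation at $c$ is an object $\mathrm{pt}_c$, the pointing. With pseudo-transformations and modifications 2AQFTs form a 2-category. An AQFT is a functor $\mathfrak A$ to $K$-algebras that sends orthogonal pairs of morphisms to commuting ones. The truncation $\pi(\mathfrak B)$ of a 2AQFT $\mathfrak B$ is the AQFT $c\mapsto \mathrm{End}(\mathrm{pt}_c)$, and the inclusion $\iota(\mathfrak A)$ of an AQFT is the 2AQFT $c\mapsto \mathrm{Mod}_{\mathfrak A(c)}$ (right modules), with factorization products $(V_i)_i\mapsto \big(\bigotimes_i V_i\big)\otimes_{\bigotimes_i\mathfrak A(c_i)}\mathfrak A(t)$. A 2AQFT $\mathfrak B$ is *truncated* if the component $\iota\pi(\mathfrak B)\to\mathfrak B$ of the counit of the biadjunction $\iota\dashv\pi$ is an equivalence in the 2-category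 of 2AQFTs, and *non-truncated* otherwise. For an AQFT $\mathfrak A$ with an action of a finite group $G$ by automorphisms, the categorified orbifold theory $\mathfrak A^G$ is the 2AQFT which assigns to $c$ the category of $G$-equivariant right $\mathfrak A(c)$-modules, with the same factorization products, where $G$ acts on tensor products diagonally. **The chiral free boson.** On the category of nonempty open intervals $I\subsetneq\mathbb S^1$ and inclusions, with $\perp$ given by disjointness, let $K$ be a commutative $\mathbb C$-algebra, $\hbar\in K$, and $$\mathfrak A_{K,\hbar}(I)=T_K\big(C_c^\infty(I,\mathbb R)\otimes_{\mathbb R}K\big)\Big/\Big\langle \varphi_1\otimes\varphi_2-\varphi_2\otimes\varphi_1-i\hbar\int_I\varphi_1\,\mathrm d\varphi_2\cdot 1\Big\rangle ,$$ where inclusions of intervals act by extension by zero. The group $\mathbb Z_2$ acts by $\varphi\mapsto\pm\varphi$ on generators. Let $B=B(I)$ be the even (that is, $\mathbb Z_2$-invariant) subalgebra and $V=V(I)$ the odd part of $\mathfrak A_{K,\hbar}(I)$, and let $\mu_I:V\otimes_BV\to B$ be the map induced by the multiplication. **Claim.** 1. Let $K=\mathbb C$ and let $\hbar\neq0$ be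 real. Then $\mu_I$ is bijective for every interval $I$, and $\mathfrak A_{\mathbb C,\hbar}^{\mathbb Z_2}$ is truncated. 2. Let $K=\mathbb C$ and $\hbar=0$. Then $\mu_I$ is not surjective for any interval $I$, and $\mathfrak A_{\mathbb C,0}^{\mathbb Z_2}$ is non-truncated. 3. If $\hbar$ is a formal parameter, then the theory is non-truncated: both for $K=\mathbb C[[\hbar]]$ and for $K=\mathbb C[\hbar]$, with $\hbar$ the variable, $\mathfrak A_{K,\hbar}^{\mathbb Z_2}$ is a non-truncated 2AQFT over $K$. -/

import Mathlib

noncomputable section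

open CategoryTheory CategoryTheory.Limits TensorProduct

universe u v w

namespace OrbifoldAQFT


/-! ### Orthogonal categories and their prefactorization operads -/

/-- An orthogonality relation on a category: a symmetric relation on pairs of morphisms with a
common target that is stable under pre- and postcomposition. -/
class Orthogonality (C : Type w) [Category.{v} C] where
  Orth : ∀ {c₁ c₂ t : C}, (c₁ ⟶ t) → (c₂ ⟶ t) → Prop
  orth_symm : ∀ {c₁ c₂ t : C} {f₁ : c₁ ⟶ t} {f₂ : c₂ ⟶ t}, Orth f₁ f₂ → Orth f₂ f₁
  orth_comp : ∀ {b₁ b₂ c₁ c₂ t t' : C} {f₁ : c₁ ⟶ t} {f₂ : c₂ ⟶ t}, Orth f₁ f₂ →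
    ∀ (h₁ : b₁ ⟶ c₁) (h₂ : b₂ ⟶ c₂) (g : t ⟶ t'), Orth (h₁ ≫ f₁ ≫ g) (h₂ ≫ f₂ ≫ g)

open Orthogonality

section Operad

variable {C : Type w} [Category.{v} C] [Orthogonality C]

/-- An operation of the prefactorization operad: a tuple of mutually orthogonal morphisms with
common target. Tuples are indexed by arbitrary finite types, so that concatenation of tuples is
indexed by a sigma type. -/
@[ext]
structure Op {ι : Type} (c : ι → C) (t : C) where
  hom : ∀ i, c i ⟶ t
  orth : ∀ i j, i ≠ j → Orth (hom i) (hom j)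

/-- The identity operation. -/
def Op.id (t : C) : Op (fun _ : Unit => t) t where
  hom _ := 𝟙 t
  orth _ _ h := (h rfl).elim

/-- The unique operation of arity zero. -/
def Op.nil (t : C) : Op (fun e : Empty => (e.elim : C)) t where
  hom e := e.elim
  orth e := e.elim

/-- A single morphism, as an operation of arity one. -/
def Op.single {c t : C} (f : c ⟶ t) : Op (fun _ : Unit => c) t where
  hom _ := f
  orth _ _ h := (h rfl).elim

/-- Operadic composition. -/
def Op.comp {ι : Type} {κ : ι → Type} {a : ι → C} {b : ∀ i, κ i → C} {t : C}
    (f : Op a t) (g : ∀ i, Op (b i) (a i)) : Op (fun s : Σ i, κ i => b s.1 s.2) t where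
  hom s := (g s.1).hom s.2 ≫ f.hom s.1
  orth := by
    rintro ⟨i, j⟩ ⟨i', j'⟩ h
    by_cases hi : i = i'
    · subst hi
      have hj : j ≠ j' := fun e => h (by rw [e])
      simpa using orth_comp ((g i).orth j j' hj) (𝟙 _) (𝟙 _) (f.hom i)
    · simpa using orth_comp (f.orth i i' hi) ((g i).hom j) ((g i').hom j') (𝟙 _)

end Operad

theorem bij_snd (ι : Type) : (fun s : (Σ _ : Unit, ι) => s.2).Bijective :=
  ⟨fun ⟨_, _⟩ ⟨_, _⟩ h => by cases h; rfl, fun i => ⟨⟨(), i⟩, rfl⟩⟩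

theorem bij_fst (ι : Type) : (fun s : (Σ _ : ι, Unit) => s.1).Bijective :=
  ⟨fun ⟨_, _⟩ ⟨_, _⟩ h => by cases h; rfl, fun i => ⟨⟨i, ()⟩, rfl⟩⟩

theorem bij_assoc {ι : Type} (κ : ι → Type) (μ : ∀ i, κ i → Type) :
    (fun s : (Σ r : (Σ i, κ i), μ r.1 r.2) =>
      (⟨s.1.1, s.1.2, s.2⟩ : Σ i, Σ j, μ i j)).Bijective :=
  ⟨fun ⟨⟨_, _⟩, _⟩ ⟨⟨_, _⟩, _⟩ h => by cases h; rfl, fun ⟨i, j, l⟩ => ⟨⟨⟨i, j⟩, l⟩, rfl⟩⟩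

theorem bij_outer {ι ι' : Type} (κ : ι → Type) {p : ι' → ι} (hp : p.Bijective) :
    (fun s : (Σ i', κ (p i')) => (⟨p s.1, s.2⟩ : Σ i, κ i)).Bijective := by
  constructor
  · rintro ⟨i, j⟩ ⟨i', j'⟩ h
    obtain rfl : i = i' := hp.1 (congrArg Sigma.fst h)
    cases h
    rfl
  · rintro ⟨i, j⟩
    obtain ⟨i', rfl⟩ := hp.2 i
    exact ⟨⟨i', j⟩, rfl⟩

theorem bij_inner {ι : Type} {κ κ' : ι → Type} {p : ∀ i, κ' i → κ i}
    (hp : ∀ i, (p i).Bijective) :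
    (fun s : (Σ i, κ' i) => (⟨s.1, p s.1 s.2⟩ : Σ i, κ i)).Bijective := by
  constructor
  · rintro ⟨i, j⟩ ⟨i', j'⟩ h
    obtain rfl : i = i' := congrArg Sigma.fst h
    obtain rfl : j = j' := (hp i).1 (by simpa using h)
    rfl
  · rintro ⟨i, j⟩
    obtain ⟨j', rfl⟩ := (hp i).2 j
    exact ⟨⟨i, j'⟩, rfl⟩

/-! ### Locally presentable linear categories -/

/-- A locally presentable (in particular cocomplete) `K`-linear category. -/
structure LPCat (K : Type u) [CommRing K] where
  carrier : Type (u + 1)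
  [category : Category.{u} carrier]
  [preadditive : Preadditive carrier]
  [linear : Linear K carrier]
  [presentable : IsLocallyPresentable.{u} carrier]

namespace LPCat

variable {K : Type u} [CommRing K]

instance : CoeSort (LPCat K) (Type (u + 1)) := ⟨LPCat.carrier⟩
instance (D : LPCat K) : Category.{u} D := D.category
instance (D : LPCat K) : Preadditive D := D.preadditive
instance (D : LPCat K) : Linear K D := D.linear
instance (D : LPCat K) : IsLocallyPresentable.{u} D := D.presentable

end LPCat

section Multi

variable {ι : Type}

open Classical in
/-- The components of `insertAt`: the identity for `k = i` and constant at `x k` for `k ≠ i`. -/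
def insertSlot {D : ι → Type w} [∀ k, Category.{v} (D k)] (i : ι) (x : ∀ k, D k) (k : ι) :
    D i ⥤ D k :=
  if h : k = i then (by subst h; exact 𝟭 _) else (Functor.const _).obj (x k)

/-- The functor inserting an object into the `i`-th slot of a tuple of objects, all other
entries being those of the fixed tuple `x`. -/
def insertAt {D : ι → Type w} [∀ k, Category.{v} (D k)] (i : ι) (x : ∀ k, D k) :
    D i ⥤ ∀ k, D k :=
  Functor.pi' (insertSlot i x)

theorem insertSlot_self {D : ι → Type w} [∀ k, Category.{v} (D k)] (i : ι) (x : ∀ k, D k) :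
    insertSlot i x i = 𝟭 _ := dif_pos rfl

theorem insertSlot_ne {D : ι → Type w} [∀ k, Category.{v} (D k)] {i k : ι} (h : k ≠ i)
    (x : ∀ k, D k) : insertSlot i x k = (Functor.const _).obj (x k) := dif_neg h

variable {K : Type u} [CommRing K]

/-- Linear and cocontinuous functors between locally presentable linear categories. -/
structure IsLinCocont {D E : LPCat K} (F : D ⥤ E) : Prop where
  additive : F.Additive
  linear : F.Linear K
  cocont : PreservesColimitsOfSize.{u, u} F

/-- Functors of several variables that are linear and cocontinuous in each variable. -/
def IsMultLinCocont {D : ι → LPCat K} {E : LPCat K} (F : (∀ i, D i) ⥤ E) : Prop :=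
  ∀ (i : ι) (x : ∀ k, D k), IsLinCocont (insertAt i x ⋙ F)

end Multi

/-! ### 2AQFTs: pseudo-morphisms from the prefactorization operad to the operad of locally
presentable linear categories -/

/-- A 2-categorical algebraic quantum field theory. The coherence natural isomorphisms are given
by their components `comp`, `unit`, `perm` together with the naturality conditions. -/
structure TwoAQFT (K : Type u) [CommRing K] (C : Type w) [Category.{v} C] [Orthogonality C] where
  cat : C → LPCat K
  /-- the factorization products -/
  prod : ∀ {ι : Type} [Finite ι] {c : ι → C} {t : C}, Op c t → ((∀ i, cat (c i)) ⥤ cat t)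
  prod_lin : ∀ {ι : Type} [Finite ι] {c : ι → C} {t : C} (f : Op c t), IsMultLinCocont (prod f)
  /-- coherence for compositions -/
  comp : ∀ {ι : Type} [Finite ι] {κ : ι → Type} [∀ i, Finite (κ i)] {a : ι → C}
    {b : ∀ i, κ i → C} {t : C} (f : Op a t) (g : ∀ i, Op (b i) (a i)) (x : ∀ i j, cat (b i j)),
    (prod f).obj (fun i => (prod (g i)).obj (x i)) ≅ (prod (f.comp g)).obj (fun s => x s.1 s.2)
  comp_nat : ∀ {ι : Type} [Finite ι] {κ : ι → Type} [∀ i, Finite (κ i)] {a : ι → C}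
    {b : ∀ i, κ i → C} {t : C} (f : Op a t) (g : ∀ i, Op (b i) (a i)) {x y : ∀ i j, cat (b i j)}
    (φ : ∀ i j, x i j ⟶ y i j),
    (prod f).map (fun i => (prod (g i)).map (φ i)) ≫ (comp f g y).hom =
      (comp f g x).hom ≫ (prod (f.comp g)).map (fun s => φ s.1 s.2)
  /-- coherence for identities -/
  unit : ∀ (t : C) (x : cat t), x ≅ (prod (Op.id t)).obj (fun _ => x)
  unit_nat : ∀ (t : C) {x y : cat t} (φ : x ⟶ y),
    φ ≫ (unit t y).hom = (unit t x).hom ≫ (prod (Op.id t)).map (fun _ => φ)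
  /-- coherence for permutations -/
  perm : ∀ {ι ι' : Type} [Finite ι] [Finite ι'] {c : ι → C} {t : C} (p : ι' → ι)
    (_ : p.Bijective) (f : Op c t) (f' : Op (fun i' => c (p i')) t)
    (_ : ∀ i', f'.hom i' = f.hom (p i')) (x : ∀ i, cat (c i)),
    (prod f).obj x ≅ (prod f').obj (fun i' => x (p i'))
  perm_nat : ∀ {ι ι' : Type} [Finite ι] [Finite ι'] {c : ι → C} {t : C} (p : ι' → ι)
    (hp : p.Bijective) (f : Op c t) (f' : Op (fun i' => c (p i')) t)
    (h : ∀ i', f'.hom i' = f.hom (p i')) {x y : ∀ i, cat (c i)} (φ : ∀ i, x i ⟶ y i),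
    (prod f).map φ ≫ (perm p hp f f' h y).hom =
      (perm p hp f f' h x).hom ≫ (prod f').map (fun i' => φ (p i'))
  assoc : ∀ {ι : Type} [Finite ι] {κ : ι → Type} [∀ i, Finite (κ i)]
    {μ : ∀ i, κ i → Type} [∀ i j, Finite (μ i j)] {a : ι → C} {b : ∀ i, κ i → C}
    {d : ∀ i j, μ i j → C} {t : C} (f : Op a t) (g : ∀ i, Op (b i) (a i))
    (h : ∀ i j, Op (d i j) (b i j)) (x : ∀ i j l, cat (d i j l)),
    (prod f).map (fun i => (comp (g i) (h i) (x i)).hom) ≫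
      (comp f (fun i => (g i).comp (h i)) (fun i s => x i s.1 s.2)).hom ≫
      (perm _ (bij_assoc κ μ) (f.comp fun i => (g i).comp (h i))
        ((f.comp g).comp fun s => h s.1 s.2) (fun _ => (Category.assoc _ _ _).symm)
          (fun s => x s.1 s.2.1 s.2.2)).hom =
    (comp f g (fun i j => (prod (h i j)).obj (x i j))).hom ≫
      (comp (f.comp g) (fun s => h s.1 s.2) (fun s l => x s.1 s.2 l)).hom
  unit_left : ∀ {ι : Type} [Finite ι] {c : ι → C} {t : C} (f : Op c t) (x : ∀ i, cat (c i)),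
    (unit t ((prod f).obj x)).hom ≫ (comp (Op.id t) (fun _ => f) (fun _ => x)).hom =
      (perm _ (bij_snd ι) f ((Op.id t).comp fun _ => f) (fun _ => Category.comp_id _) x).hom
  unit_right : ∀ {ι : Type} [Finite ι] {c : ι → C} {t : C} (f : Op c t) (x : ∀ i, cat (c i)),
    (prod f).map (fun i => (unit (c i) (x i)).hom) ≫
        (comp f (fun i => Op.id (c i)) (fun i _ => x i)).hom =
      (perm _ (bij_fst ι) f (f.comp fun i => Op.id (c i)) (fun _ => Category.id_comp _) x).hom
  perm_comp : ∀ {ι ι' ι'' : Type} [Finite ι] [Finite ι'] [Finite ι''] {c : ι → C} {t : C}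
    (p : ι' → ι) (hp : p.Bijective) (q : ι'' → ι') (hq : q.Bijective) (f : Op c t)
    (f' : Op (fun i' => c (p i')) t) (f'' : Op (fun i'' => c (p (q i''))) t)
    (h : ∀ i', f'.hom i' = f.hom (p i')) (h' : ∀ i'', f''.hom i'' = f'.hom (q i''))
    (x : ∀ i, cat (c i)),
    (perm p hp f f' h x).hom ≫ (perm q hq f' f'' h' (fun i' => x (p i'))).hom =
      (perm (fun i'' => p (q i'')) (hp.comp hq) f f'' (fun i'' => (h' i'').trans (h _)) x).hom
  perm_id : ∀ {ι : Type} [Finite ι] {c : ι → C} {t : C} (f : Op c t) (x : ∀ i, cat (c i)),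
    (perm (fun i => i) Function.bijective_id f f (fun _ => rfl) x).hom = 𝟙 _
  equivariance_outer : ∀ {ι ι' : Type} [Finite ι] [Finite ι'] {κ : ι → Type}
    [∀ i, Finite (κ i)] {a : ι → C} {b : ∀ i, κ i → C} {t : C} (f : Op a t)
    (g : ∀ i, Op (b i) (a i)) (p : ι' → ι) (hp : p.Bijective) (f' : Op (fun i' => a (p i')) t)
    (h : ∀ i', f'.hom i' = f.hom (p i')) (x : ∀ i j, cat (b i j)),
    (comp f g x).hom ≫ (perm _ (bij_outer κ hp) (f.comp g) (f'.comp fun i' => g (p i'))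
        (fun s => congrArg ((g (p s.1)).hom s.2 ≫ ·) (h s.1)) (fun s => x s.1 s.2)).hom =
      (perm p hp f f' h (fun i => (prod (g i)).obj (x i))).hom ≫
        (comp f' (fun i' => g (p i')) (fun i' => x (p i'))).hom
  equivariance_inner : ∀ {ι : Type} [Finite ι] {κ κ' : ι → Type} [∀ i, Finite (κ i)]
    [∀ i, Finite (κ' i)] {a : ι → C} {b : ∀ i, κ i → C} {t : C} (f : Op a t)
    (g : ∀ i, Op (b i) (a i)) (p : ∀ i, κ' i → κ i) (hp : ∀ i, (p i).Bijective)
    (g' : ∀ i, Op (fun j' => b i (p i j')) (a i))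
    (h : ∀ i j', (g' i).hom j' = (g i).hom (p i j')) (x : ∀ i j, cat (b i j)),
    (comp f g x).hom ≫ (perm _ (bij_inner hp) (f.comp g) (f.comp g')
        (fun s => congrArg (· ≫ f.hom s.1) (h s.1 s.2)) (fun s => x s.1 s.2)).hom =
      (prod f).map (fun i => (perm (p i) (hp i) (g i) (g' i) (h i) (x i)).hom) ≫
        (comp f g' (fun i j' => x i (p i j'))).hom

namespace TwoAQFT

variable {K : Type u} [CommRing K] {C : Type w} [Category.{v} C] [Orthogonality C]

section

variable (S : TwoAQFT.{u, v, w} K C) {ι : Type} [Finite ι] {c : ι → C} {t : C} (f : Op c t)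

theorem map_comp' {x y z : ∀ i, S.cat (c i)} (φ : ∀ i, x i ⟶ y i) (ψ : ∀ i, y i ⟶ z i) :
    (S.prod f).map (fun i => φ i ≫ ψ i) =
      (S.prod f).map (X := x) (Y := y) φ ≫ (S.prod f).map (Y := z) ψ :=
  (S.prod f).map_comp (X := x) (Y := y) (Z := z) φ ψ

theorem map_id' (x : ∀ i, S.cat (c i)) : (S.prod f).map (fun i => 𝟙 (x i)) = 𝟙 _ :=
  (S.prod f).map_id x

end

/-- A 1-morphism of 2AQFTs (pseudo-transformation). -/
structure OneHom (S T : TwoAQFT.{u, v, w} K C) where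
  app : ∀ c, S.cat c ⥤ T.cat c
  app_lin : ∀ c, IsLinCocont (app c)
  /-- compatibility with the factorization products, up to coherent natural isomorphism -/
  sq : ∀ {ι : Type} [Finite ι] {c : ι → C} {t : C} (f : Op c t) (x : ∀ i, S.cat (c i)),
    (T.prod f).obj (fun i => (app (c i)).obj (x i)) ≅ (app t).obj ((S.prod f).obj x)
  sq_nat : ∀ {ι : Type} [Finite ι] {c : ι → C} {t : C} (f : Op c t) {x y : ∀ i, S.cat (c i)}
    (φ : ∀ i, x i ⟶ y i),
    (T.prod f).map (fun i => (app (c i)).map (φ i)) ≫ (sq f y).hom =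
      (sq f x).hom ≫ (app t).map ((S.prod f).map φ)
  sq_comp : ∀ {ι : Type} [Finite ι] {κ : ι → Type} [∀ i, Finite (κ i)] {a : ι → C}
    {b : ∀ i, κ i → C} {t : C} (f : Op a t) (g : ∀ i, Op (b i) (a i))
    (x : ∀ i j, S.cat (b i j)),
    (T.prod f).map (fun i => (sq (g i) (x i)).hom) ≫
        (sq f (fun i => (S.prod (g i)).obj (x i))).hom ≫ (app t).map (S.comp f g x).hom =
      (T.comp f g (fun i j => (app (b i j)).obj (x i j))).hom ≫
        (sq (f.comp g) (fun s => x s.1 s.2)).hom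
  sq_unit : ∀ (t : C) (x : S.cat t),
    (T.unit t ((app t).obj x)).hom ≫ (sq (Op.id t) (fun _ => x)).hom =
      (app t).map (S.unit t x).hom
  sq_perm : ∀ {ι ι' : Type} [Finite ι] [Finite ι'] {c : ι → C} {t : C} (p : ι' → ι)
    (hp : p.Bijective) (f : Op c t) (f' : Op (fun i' => c (p i')) t)
    (h : ∀ i', f'.hom i' = f.hom (p i')) (x : ∀ i, S.cat (c i)),
    (sq f x).hom ≫ (app t).map (S.perm p hp f f' h x).hom =
      (T.perm p hp f f' h (fun i => (app (c i)).obj (x i))).hom ≫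
        (sq f' (fun i' => x (p i'))).hom

/-- The identity 1-morphism. -/
def OneHom.id (S : TwoAQFT.{u, v, w} K C) : OneHom S S where
  app c := 𝟭 _
  app_lin c := ⟨inferInstance, inferInstance, inferInstance⟩
  sq f x := Iso.refl _
  sq_nat f x y φ := (Category.comp_id _).trans (Category.id_comp _).symm
  sq_comp f g x := by
    refine Eq.trans ?_ (Category.comp_id _).symm
    refine Eq.trans (congrArg₂ (· ≫ ·) ((S.prod f).map_id _) (Category.id_comp _)) ?_
    exact Category.id_comp _
  sq_unit t x := Category.comp_id _
  sq_perm p hp f f' h x := (Category.id_comp _).trans (Category.comp_id _).symm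

/-- Composition of 1-morphisms. -/
def OneHom.comp {S T U : TwoAQFT.{u, v, w} K C} (η : OneHom S T) (θ : OneHom T U) :
    OneHom S U where
  app c := η.app c ⋙ θ.app c
  app_lin c := by
    obtain ⟨_, _, _⟩ := η.app_lin c
    obtain ⟨_, _, _⟩ := θ.app_lin c
    exact ⟨inferInstance, inferInstance, inferInstance⟩
  sq {ι _ c t} f x := θ.sq f (fun i => (η.app (c i)).obj (x i)) ≪≫ (θ.app t).mapIso (η.sq f x)
  sq_nat {ι _ c t} f x y φ := by
    have h1 := θ.sq_nat f (fun i => (η.app (c i)).map (φ i))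
    have h2 := congrArg (θ.app t).map (η.sq_nat f φ)
    simp only [Functor.map_comp] at h2
    dsimp only [Functor.comp_obj, Functor.comp_map, Iso.trans_hom, Functor.mapIso_hom]
    rw [reassoc_of% h1, h2, Category.assoc]
  sq_comp {ι _ κ _ a b t} f g x := by
    have h1 := θ.sq_comp f g (fun i j => (η.app (b i j)).obj (x i j))
    have h2 := congrArg (θ.app t).map (η.sq_comp f g x)
    have h3 := θ.sq_nat f (fun i => (η.sq (g i) (x i)).hom)
    simp only [Functor.map_comp] at h2
    dsimp only [Functor.comp_obj, Functor.comp_map, Iso.trans_hom, Functor.mapIso_hom]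
    rw [map_comp']
    simp only [Category.assoc]
    rw [reassoc_of% h3, h2, reassoc_of% h1]
  sq_unit t x := by
    have h1 := θ.sq_unit t ((η.app t).obj x)
    have h2 := congrArg (θ.app t).map (η.sq_unit t x)
    simp only [Functor.map_comp] at h2
    dsimp only [Functor.comp_obj, Functor.comp_map, Iso.trans_hom, Functor.mapIso_hom]
    rw [reassoc_of% h1, h2]
  sq_perm {ι ι' _ _ c t} p hp f f' h x := by
    have h1 := θ.sq_perm p hp f f' h (fun i => (η.app (c i)).obj (x i))
    have h2 := congrArg (θ.app t).map (η.sq_perm p hp f f' h x)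
    simp only [Functor.map_comp] at h2
    dsimp only [Functor.comp_obj, Functor.comp_map, Iso.trans_hom, Functor.mapIso_hom]
    rw [Category.assoc, h2, reassoc_of% h1]

/-- A 2-morphism of 2AQFTs (modification). -/
structure TwoHom {S T : TwoAQFT.{u, v, w} K C} (η θ : OneHom S T) where
  app : ∀ c, η.app c ⟶ θ.app c
  sq : ∀ {ι : Type} [Finite ι] {c : ι → C} {t : C} (f : Op c t) (x : ∀ i, S.cat (c i)),
    (T.prod f).map (fun i => (app (c i)).app (x i)) ≫ (θ.sq f x).hom =
      (η.sq f x).hom ≫ (app t).app ((S.prod f).obj x)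

/-- Existence of an invertible 2-morphism between two 1-morphisms. -/
def OneHom.Isomorphic {S T : TwoAQFT.{u, v, w} K C} (η θ : OneHom S T) : Prop :=
  ∃ (Γ : TwoHom η θ) (Δ : TwoHom θ η), ∀ c, Γ.app c ≫ Δ.app c = 𝟙 _ ∧ Δ.app c ≫ Γ.app c = 𝟙 _

/-- A 1-morphism is an equivalence in the 2-category of 2AQFTs if it has a quasi-inverse. -/
def OneHom.IsEquiv {S T : TwoAQFT.{u, v, w} K C} (η : OneHom S T) : Prop :=
  ∃ θ : OneHom T S, (η.comp θ).Isomorphic (OneHom.id S) ∧ (θ.comp η).Isomorphic (OneHom.id T)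

end TwoAQFT

/-! ### AQFTs and the truncation of a 2AQFT -/

/-- An algebraic quantum field theory: a functor to algebras sending orthogonal pairs of morphisms
to commuting ones. -/
structure AQFT (K : Type u) [CommRing K] (C : Type w) [Category.{v} C] [Orthogonality C] where
  F : C ⥤ AlgCat.{u} K
  commute : ∀ {c₁ c₂ t : C} (f₁ : c₁ ⟶ t) (f₂ : c₂ ⟶ t), Orth f₁ f₂ →
    ∀ (a₁ : F.obj c₁) (a₂ : F.obj c₂), Commute (F.map f₁ a₁) (F.map f₂ a₂)

theorem bij_empty (ι : Type) : (fun s : (Σ _ : ι, Empty) => s.2).Bijective :=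
  ⟨fun s => s.2.elim, fun e => e.elim⟩

theorem ptIso_comp_aux {D : Type*} [Category D] {X₀ X₁ X₂ X₃ X₄ X₅ X₆ Z : D} {A : X₀ ⟶ X₁}
    {p : X₁ ⟶ X₂} {p' : X₂ ⟶ X₁} (h6 : p ≫ p' = 𝟙 _) {c : X₂ ⟶ X₃} {q : Z ≅ X₃} {r : X₃ ⟶ X₄}
    {c' : X₁ ⟶ X₄} (h2 : c ≫ r = p' ≫ c') {q' : Z ⟶ X₄} (h3 : q.hom ≫ r = q') {s : X₄ ⟶ X₅}
    {q'' : Z ≅ X₅} (h4 : q' ≫ s = q''.hom) {d : X₀ ⟶ X₆} {d' : X₆ ⟶ X₅}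
    (h1 : A ≫ c' ≫ s = d ≫ d') : (A ≫ p) ≫ c ≫ q.inv = d ≫ d' ≫ q''.inv := by
  rw [← Category.assoc d, ← h1, ← cancel_mono q''.hom]
  simp only [← h4, ← h3, Category.assoc, Iso.inv_hom_id_assoc]
  have h5 : q.hom ≫ r ≫ s = q''.hom := by rw [← h4, ← h3, Category.assoc]
  rw [h5, Iso.inv_hom_id, Category.comp_id, reassoc_of% h2, reassoc_of% h6]

theorem endMap_comp_aux {D : Type*} [Category D] {X Y Z W : D} {m' : X ≅ Y} {p : Y ≅ Z}
    {c : X ≅ W} {p' : W ≅ Z} {u : X ⟶ X} {v : W ⟶ W} (h1 : u ≫ c.hom = c.hom ≫ v)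
    (h2 : m'.hom ≫ p.hom = c.hom ≫ p'.hom) :
    p'.inv ≫ v ≫ p'.hom = p.inv ≫ (m'.inv ≫ u ≫ m'.hom) ≫ p.hom := by
  have h3 : p' = c.symm ≪≫ m' ≪≫ p := by
    ext
    simp [h2]
  subst h3
  simp [← reassoc_of% h1]

theorem endMap_id_aux {D : Type*} [Category D] {X Y : D} {c : X ≅ Y} {p : Y ≅ X} {u : X ⟶ X}
    {v : Y ⟶ Y} (h1 : u ≫ c.hom = c.hom ≫ v) (h2 : c.hom ≫ p.hom = 𝟙 _) :
    p.inv ≫ v ≫ p.hom = u := by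
  obtain rfl : p = c.symm := by
    ext
    rw [← cancel_epi c.hom, h2]
    simp
  simp [← reassoc_of% h1]

theorem conj_zero {D : Type*} [Category D] [Preadditive D] {X Y : D} (p : X ≅ Y) :
    p.inv ≫ (0 : X ⟶ X) ≫ p.hom = 0 := by simp

theorem conj_add {D : Type*} [Category D] [Preadditive D] {X Y : D} (p : X ≅ Y) (x y : X ⟶ X) :
    p.inv ≫ (x + y) ≫ p.hom = p.inv ≫ x ≫ p.hom + p.inv ≫ y ≫ p.hom := by simp

theorem conj_smul {D : Type*} [Category D] [Preadditive D] {K : Type*} [CommRing K] [Linear K D]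
    {X Y : D} (p : X ≅ Y) (r : K) (x : X ⟶ X) :
    p.inv ≫ (r • x) ≫ p.hom = r • (p.inv ≫ x ≫ p.hom) := by simp

namespace TwoAQFT

variable {K : Type u} [CommRing K] {C : Type w} [Category.{v} C] [Orthogonality C]
  (S : TwoAQFT.{u, v, w} K C)

/-- The pointing of a 2AQFT. -/
abbrev pt (t : C) : S.cat t := (S.prod (Op.nil t)).obj (fun e => e.elim)

section

variable {ι : Type} [Finite ι] {κ : ι → Type} [∀ i, Finite (κ i)] {a : ι → C}
    {b : ∀ i, κ i → C} {t : C}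

/-- Factorization products preserve the pointings. -/
def ptIso (f : Op a t) : (S.prod f).obj (fun i => S.pt (a i)) ≅ S.pt t :=
  S.comp f (fun i => Op.nil (a i)) (fun _ e => e.elim) ≪≫
    (S.perm (fun s : (Σ _ : ι, Empty) => s.2) (bij_empty ι) (Op.nil t)
      (f.comp fun i => Op.nil (a i)) (fun s => s.2.elim) (fun e => e.elim)).symm

theorem ptIso_comp (f : Op a t) (g : ∀ i, Op (b i) (a i)) :
    (S.prod f).map (fun i => (S.ptIso (g i)).hom) ≫ (S.ptIso f).hom =
      (S.comp f g (fun i j => S.pt (b i j))).hom ≫ (S.ptIso (f.comp g)).hom := by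
  have h1 := S.assoc f g (fun i j => Op.nil (b i j)) (fun _ _ e => e.elim)
  have h2 := S.equivariance_inner f (fun i => Op.nil (a i))
    (fun i => fun s : (Σ _ : κ i, Empty) => s.2) (fun i => bij_empty (κ i))
    (fun i => (g i).comp fun j => Op.nil (b i j)) (fun i s => s.2.elim) (fun _ e => e.elim)
  have h3 := S.perm_comp (fun s : (Σ _ : ι, Empty) => s.2) (bij_empty ι) _
    (bij_inner fun i => bij_empty (κ i)) (Op.nil t) (f.comp fun i => Op.nil (a i))
    (f.comp fun i => (g i).comp fun j => Op.nil (b i j)) (fun s => s.2.elim)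
    (fun s => s.2.2.elim) (fun e => e.elim)
  have h4 := S.perm_comp _ ((bij_empty ι).comp (bij_inner fun i => bij_empty (κ i))) _
    (bij_assoc κ fun _ _ => Empty) (Op.nil t)
    (f.comp fun i => (g i).comp fun j => Op.nil (b i j))
    ((f.comp g).comp fun s => Op.nil (b s.1 s.2)) (fun s => s.2.2.elim)
    (fun s => s.2.elim) (fun e => e.elim)
  have h5 := S.map_comp' f (fun i => (S.comp (g i) (fun j => Op.nil (b i j)) fun _ e => e.elim).hom)
    (fun i => (S.perm (fun s : (Σ _ : κ i, Empty) => s.2) (bij_empty (κ i)) (Op.nil (a i))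
      ((g i).comp fun j => Op.nil (b i j)) (fun s => s.2.elim) (fun e => e.elim)).inv)
  have h6 := S.map_comp' f
    (fun i => (S.perm (fun s : (Σ _ : κ i, Empty) => s.2) (bij_empty (κ i)) (Op.nil (a i))
      ((g i).comp fun j => Op.nil (b i j)) (fun s => s.2.elim) (fun e => e.elim)).inv)
    (fun i => (S.perm (fun s : (Σ _ : κ i, Empty) => s.2) (bij_empty (κ i)) (Op.nil (a i))
      ((g i).comp fun j => Op.nil (b i j)) (fun s => s.2.elim) (fun e => e.elim)).hom)
  simp only [Iso.inv_hom_id] at h6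
  rw [map_id'] at h6
  simp only [ptIso, Iso.trans_hom, Iso.symm_hom]
  exact (congrArg (· ≫ _) h5).trans (ptIso_comp_aux (h6 := h6.symm) (h1 := h1) (h2 := h2)
    (h3 := h3) (h4 := h4))

/-- The map on endomorphism algebras of the pointings induced by a factorization product. -/
def endMap (f : Op a t) (h : ∀ i, End (S.pt (a i))) : End (S.pt t) :=
  (S.ptIso f).inv ≫ (S.prod f).map h ≫ (S.ptIso f).hom

theorem ptIso_perm {ι' : Type} [Finite ι'] (p : ι' → ι) (hp : p.Bijective) (f : Op a t)
    (f' : Op (fun i' => a (p i')) t) (h : ∀ i', f'.hom i' = f.hom (p i')) :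
    (S.perm p hp f f' h fun i => S.pt (a i)).hom ≫ (S.ptIso f').hom = (S.ptIso f).hom := by
  have h1 := S.equivariance_outer f (fun i => Op.nil (a i)) p hp f' h (fun _ e => e.elim)
  have h2 := S.perm_comp (fun s : (Σ _ : ι, Empty) => s.2) (bij_empty ι) _
    (bij_outer (fun _ => Empty) hp) (Op.nil t) (f.comp fun i => Op.nil (a i))
    (f'.comp fun i' => Op.nil (a (p i'))) (fun s => s.2.elim)
    (fun s => s.2.elim) (fun e => e.elim)
  simp only [ptIso, Iso.trans_hom, Iso.symm_hom]
  rw [← Category.assoc, Iso.comp_inv_eq]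
  refine h1.symm.trans ?_
  rw [Category.assoc]
  congr 1
  rw [Iso.eq_inv_comp]
  exact h2

theorem unit_ptIso (t : C) : (S.unit t (S.pt t)).hom ≫ (S.ptIso (Op.id t)).hom = 𝟙 _ := by
  have h1 := S.unit_left (Op.nil t) (fun e => e.elim)
  simp only [ptIso, Iso.trans_hom, Iso.symm_hom]
  rw [← Category.assoc, Iso.comp_inv_eq, Category.id_comp]
  exact h1

theorem endMap_comp (f : Op a t) (g : ∀ i, Op (b i) (a i)) (h : ∀ i j, End (S.pt (b i j))) :
    S.endMap (f.comp g) (fun s => h s.1 s.2) = S.endMap f (fun i => S.endMap (g i) (h i)) := by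
  have h1 := S.comp_nat f g (x := fun i j => S.pt (b i j)) (y := fun i j => S.pt (b i j)) h
  have h2 := S.ptIso_comp f g
  have h3 := S.map_comp' f (fun i => (S.ptIso (g i)).inv)
    (fun i => (S.prod (g i)).map (X := fun j => S.pt (b i j)) (Y := fun j => S.pt (b i j)) (h i) ≫
      (S.ptIso (g i)).hom)
  have h4 := S.map_comp' f
    (fun i => (S.prod (g i)).map (X := fun j => S.pt (b i j)) (Y := fun j => S.pt (b i j)) (h i))
    (fun i => (S.ptIso (g i)).hom)
  have h6 := S.map_comp' f (fun i => (S.ptIso (g i)).hom) (fun i => (S.ptIso (g i)).inv)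
  simp only [Iso.hom_inv_id] at h6
  rw [map_id'] at h6
  have h7 := h3.trans (congrArg (_ ≫ ·) h4)
  simp only [endMap]
  refine Eq.trans ?_ (congrArg (fun z => _ ≫ z ≫ _) h7.symm)
  exact endMap_comp_aux (m' := (S.prod f).mapIso (Pi.isoMk fun i => S.ptIso (g i))) h1 h2

theorem endMap_perm {ι' : Type} [Finite ι'] (p : ι' → ι) (hp : p.Bijective) (f : Op a t)
    (f' : Op (fun i' => a (p i')) t) (e : ∀ i', f'.hom i' = f.hom (p i'))
    (h : ∀ i, End (S.pt (a i))) : S.endMap f' (fun i' => h (p i')) = S.endMap f h := by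
  have h1 := S.perm_nat p hp f f' e (x := fun i => S.pt (a i)) (y := fun i => S.pt (a i)) h
  have h2 := S.ptIso_perm p hp f f' e
  simp only [endMap]
  rw [Iso.inv_comp_eq, ← cancel_epi (S.perm p hp f f' e fun i => S.pt (a i)).hom, ← Category.assoc]
  refine (congrArg (· ≫ _) h1.symm).trans ?_
  rw [Category.assoc, h2, reassoc_of% h2, Iso.hom_inv_id_assoc]

theorem endMap_id (t : C) (h : End (S.pt t)) : S.endMap (Op.id t) (fun _ => h) = h := by
  have h1 := S.unit_nat t h
  have h2 := S.unit_ptIso t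
  exact endMap_id_aux (c := S.unit t (S.pt t)) (p := S.ptIso (Op.id t)) h1 h2

theorem endMap_mul (f : Op a t) (h h' : ∀ i, End (S.pt (a i))) :
    S.endMap f (fun i => h i * h' i) = S.endMap f h * S.endMap f h' := by
  have h1 := S.map_comp' f (x := fun i => S.pt (a i)) (y := fun i => S.pt (a i))
    (z := fun i => S.pt (a i)) h' h
  simp only [endMap, End.mul_def] at h1 ⊢
  rw [h1]
  simp

theorem endMap_one (f : Op a t) : S.endMap f (fun _ => 1) = 1 := by
  have h1 := S.map_id' f (fun i => S.pt (a i))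
  simp only [endMap, End.one_def] at h1 ⊢
  rw [h1, Category.id_comp, Iso.inv_hom_id]

theorem endMap_mulSingle [DecidableEq ι] (f : Op a t) (i : ι) (h : End (S.pt (a i))) :
    S.endMap f (Pi.mulSingle i h) = S.endMap (Op.single (f.hom i)) (fun _ => h) := by
  let g : ∀ k, Op (fun _ : PLift (k = i) => a k) (a k) := fun k =>
    ⟨fun _ => 𝟙 _, fun j j' hj => (hj (Subsingleton.elim _ _)).elim⟩
  let h' : ∀ k, PLift (k = i) → End (S.pt (a k)) := fun k _ =>
    (Pi.mulSingle i h : ∀ k, End (S.pt (a k))) k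
  have h1 : (fun k => S.endMap (g k) (h' k)) = Pi.mulSingle i h := by
    funext k
    by_cases hk : k = i
    · subst hk
      refine (S.endMap_perm (fun _ : Unit => (⟨rfl⟩ : PLift (k = k)))
        ⟨fun _ _ _ => rfl, fun _ => ⟨(), rfl⟩⟩ (g k) (Op.id (a k)) (fun _ => rfl) (h' k)).symm.trans ?_
      exact S.endMap_id _ _
    · have h2 : h' k = fun _ => 1 := funext fun e => (hk e.down).elim
      rw [h2, endMap_one, Pi.mulSingle_eq_of_ne hk]
  rw [← h1, ← endMap_comp]
  refine (S.endMap_perm (fun _ : Unit => (⟨i, ⟨rfl⟩⟩ : Σ k, PLift (k = i)))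
    ⟨fun _ _ _ => rfl, ?_⟩ (f.comp g) (Op.single (f.hom i)) (fun _ => (Category.id_comp _).symm)
      (fun s => h' s.1 s.2)).symm.trans ?_
  · rintro ⟨k, ⟨rfl⟩⟩
    exact ⟨(), rfl⟩
  · simp only [h', Pi.mulSingle_eq_same]

theorem endMap_commute (f : Op a t) {i j : ι} (hij : i ≠ j) (h : End (S.pt (a i)))
    (h' : End (S.pt (a j))) : Commute (S.endMap (Op.single (f.hom i)) (fun _ => h))
      (S.endMap (Op.single (f.hom j)) (fun _ => h')) := by
  classical
  rw [← endMap_mulSingle, ← endMap_mulSingle, commute_iff_eq, ← endMap_mul, ← endMap_mul]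
  exact congrArg (S.endMap f) (Pi.mulSingle_commute (f := fun k => End (S.pt (a k))) hij h h').eq

end

theorem insertAt_unit {D : Unit → Type w} [∀ k, Category.{v} (D k)] (x : ∀ k, D k) :
    insertAt () x = Functor.pi' (fun _ => 𝟭 (D ())) := by
  unfold insertAt
  congr 1
  funext k
  exact insertSlot_self _ _

theorem prod_single_lin {c t : C} (f : c ⟶ t) :
    IsLinCocont (Functor.pi' (fun _ : Unit => 𝟭 (S.cat c)) ⋙ S.prod (Op.single f)) := by
  have := S.prod_lin (Op.single f) () (fun _ => S.pt c)
  rwa [insertAt_unit] at this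

/-- The algebra map induced by a morphism on the endomorphism algebras of the pointings. -/
def endHom {c t : C} (f : c ⟶ t) : End (S.pt c) →ₐ[K] End (S.pt t) where
  toFun h := S.endMap (Op.single f) (fun _ => h)
  map_one' := S.endMap_one _
  map_mul' x y := S.endMap_mul (Op.single f) (fun _ => x) (fun _ => y)
  map_zero' := by
    obtain ⟨_, _, _⟩ := S.prod_single_lin f
    have h := (Functor.pi' (fun _ : Unit => 𝟭 (S.cat c)) ⋙ S.prod (Op.single f)).map_zero
      (S.pt c) (S.pt c)
    simp only [endMap]
    exact (congrArg (fun z => _ ≫ z ≫ _) h).trans (conj_zero _)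
  map_add' x y := by
    obtain ⟨_, _, _⟩ := S.prod_single_lin f
    have h := (Functor.pi' (fun _ : Unit => 𝟭 (S.cat c)) ⋙ S.prod (Op.single f)).map_add
      (f := x) (g := y)
    simp only [endMap]
    exact (congrArg (fun z => _ ≫ z ≫ _) h).trans (conj_add _ _ _)
  commutes' r := by
    obtain ⟨_, _, _⟩ := S.prod_single_lin f
    have h := (Functor.pi' (fun _ : Unit => 𝟭 (S.cat c)) ⋙ S.prod (Op.single f)).map_smul
      (R := K) r (𝟙 (S.pt c))
    have h2 := S.endMap_one (Op.single f)
    rw [Algebra.algebraMap_eq_smul_one, Algebra.algebraMap_eq_smul_one, ← h2]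
    simp only [endMap]
    exact (congrArg (fun z => _ ≫ z ≫ _) h).trans (conj_smul _ _ _)

/-- The truncation of a 2AQFT: the AQFT of endomorphism algebras of the pointings. -/
def truncation : AQFT K C where
  F := {
    obj c := AlgCat.of K (End (S.pt c))
    map f := AlgCat.ofHom (S.endHom f)
    map_id c := by
      ext h
      exact S.endMap_id c h
    map_comp {a b c} f g := by
      ext h
      refine Eq.trans ?_ (S.endMap_comp (Op.single g) (fun _ => Op.single f) (fun _ _ => h))
      exact S.endMap_perm _ (bij_fst Unit) (Op.single (f ≫ g)) _ (fun _ => rfl) (fun _ => h) |>.symm }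
  commute {c₁ c₂ t} f₁ f₂ h a₁ a₂ := by
    let f : Op (fun b : Bool => bif b then c₁ else c₂) t :=
      ⟨fun b => match b with | true => f₁ | false => f₂, fun i j hij => by
        cases i <;> cases j <;> first | exact (hij rfl).elim | exact h | exact orth_symm h⟩
    exact S.endMap_commute f (i := true) (j := false) (by simp) a₁ a₂

end TwoAQFT

/-! ### Equivariant modules -/

section Presentable

variable (R : Type u) [Ring R]

/-- The ring represents the forgetful functor on its modules. -/
def coyonedaRing : coyoneda.obj (Opposite.op (ModuleCat.of R R)) ≅ forget (ModuleCat.{u} R) :=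
  NatIso.ofComponents (fun M => Equiv.toIso
    (ModuleCat.homEquiv.trans (LinearMap.ringLmapEquivSelf R ℕ M).toEquiv)) (fun _ => rfl)

instance moduleCat_isLocallyPresentable : IsLocallyPresentable.{u} (ModuleCat.{u} R) := by
  have := Cardinal.fact_isRegular_aleph0.{u}
  refine ⟨Cardinal.aleph0, this, ?_⟩
  rw [IsCardinalLocallyPresentable.iff_exists_isStrongGenerator]
  refine ⟨.singleton (ModuleCat.of R R), inferInstance, ?_, ?_⟩
  · rw [ObjectProperty.isStrongGenerator_iff]
    have hs : (ObjectProperty.singleton (ModuleCat.of R R)).IsSeparating := by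
      rintro M N f g h
      ext m
      have h1 := h _ (by simp) (ModuleCat.ofHom (LinearMap.toSpanSingleton R M m))
      simpa using congrArg (fun z => z.hom 1) h1
    refine ⟨hs, fun M N i _ hi => ?_⟩
    rw [ConcreteCategory.isIso_iff_bijective]
    refine ⟨(ModuleCat.mono_iff_injective i).1 inferInstance, fun n => ?_⟩
    obtain ⟨f, hf⟩ := hi _ (by simp) (ModuleCat.ofHom (LinearMap.toSpanSingleton R N n))
    exact ⟨f.hom 1, by simpa using congrArg (fun z => z.hom 1) hf⟩
  · simp only [ObjectProperty.singleton_le_iff, isCardinalPresentable_iff]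
    refine ⟨fun J _ _ => ?_⟩
    have : IsFiltered J := isFiltered_of_isCardinalFiltered J Cardinal.aleph0
    exact preservesColimitsOfShape_of_natIso (coyonedaRing R).symm

end Presentable

section GMod

variable {K A G : Type u} [CommRing K] [Ring A] [Algebra K A] [Group G]

/-- A `G`-equivariant right module over an algebra `A` with `G`-action `α`: a representation of
`G` together with a right `A`-action which is equivariant. -/
structure GMod (α : G →* (A →ₐ[K] A)) where
  carrier : Type u
  [addCommGroup : AddCommGroup carrier]
  [module : Module K carrier]
  /-- the right action `v · a` -/
  act : carrier →ₗ[K] A →ₗ[K] carrier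
  act_one : ∀ v, act v 1 = v
  act_mul : ∀ v a b, act v (a * b) = act (act v a) b
  ρ : G →* Module.End K carrier
  ρ_act : ∀ g v a, ρ g (act v a) = act (ρ g v) (α g a)

namespace GMod

variable {α : G →* (A →ₐ[K] A)}

instance : CoeSort (GMod α) (Type u) := ⟨carrier⟩
instance (V : GMod α) : AddCommGroup V := V.addCommGroup
instance (V : GMod α) : Module K V := V.module

/-- Equivariant `A`-linear maps. -/
def homSubmodule (V W : GMod α) : Submodule K (V →ₗ[K] W) where
  carrier := {φ | (∀ v a, φ (V.act v a) = W.act (φ v) a) ∧ ∀ g v, φ (V.ρ g v) = W.ρ g (φ v)}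
  add_mem' {φ ψ} hφ hψ := ⟨fun v a => by simp [hφ.1, hψ.1], fun g v => by simp [hφ.2, hψ.2]⟩
  zero_mem' := ⟨fun v a => by simp, fun g v => by simp⟩
  smul_mem' r φ hφ := ⟨fun v a => by simp [hφ.1], fun g v => by simp [hφ.2]⟩

instance : Category.{u} (GMod α) where
  Hom V W := homSubmodule V W
  id V := ⟨LinearMap.id, fun _ _ => rfl, fun _ _ => rfl⟩
  comp φ ψ := ⟨ψ.1 ∘ₗ φ.1, fun v a => by simp [φ.2.1, ψ.2.1], fun g v => by simp [φ.2.2, ψ.2.2]⟩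

/-- The linear map underlying a morphism. -/
def lin {V W : GMod α} (φ : V ⟶ W) : V →ₗ[K] W := φ.1

/-- Constructor for morphisms. -/
def mk' {V W : GMod α} (φ : V →ₗ[K] W) (h : ∀ v a, φ (V.act v a) = W.act (φ v) a)
    (h' : ∀ g v, φ (V.ρ g v) = W.ρ g (φ v)) : V ⟶ W := ⟨φ, h, h'⟩

section

variable {V W X : GMod α}

theorem lin_act (φ : V ⟶ W) (v : V) (a : A) : lin φ (V.act v a) = W.act (lin φ v) a := φ.2.1 v a

theorem lin_ρ (φ : V ⟶ W) (g : G) (v : V) : lin φ (V.ρ g v) = W.ρ g (lin φ v) := φ.2.2 g v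

@[simp] theorem lin_mk' (φ : V →ₗ[K] W) (h h') : lin (mk' φ h h' : V ⟶ W) = φ := rfl

@[simp] theorem lin_id : lin (𝟙 V) = LinearMap.id := rfl

@[simp] theorem lin_comp (φ : V ⟶ W) (ψ : W ⟶ X) : lin (φ ≫ ψ) = lin ψ ∘ₗ lin φ := rfl

theorem hom_ext {φ ψ : V ⟶ W} (h : ∀ v, lin φ v = lin ψ v) : φ = ψ :=
  Subtype.ext (LinearMap.ext h)

instance : Preadditive (GMod α) where
  homGroup V W := inferInstanceAs (AddCommGroup (homSubmodule V W))
  add_comp _ _ _ _ _ _ := Subtype.ext (LinearMap.comp_add _ _ _)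
  comp_add _ _ _ _ _ _ := Subtype.ext (LinearMap.add_comp _ _ _)

instance : Linear K (GMod α) where
  homModule V W := inferInstanceAs (Module K (homSubmodule V W))
  smul_comp _ _ _ _ _ _ := Subtype.ext (LinearMap.comp_smul _ _ _)
  comp_smul _ _ _ _ _ _ := Subtype.ext (LinearMap.smul_comp _ _ _)

@[simp] theorem lin_add (φ ψ : V ⟶ W) : lin (φ + ψ) = lin φ + lin ψ := rfl

@[simp] theorem lin_smul (r : K) (φ : V ⟶ W) : lin (r • φ) = r • lin φ := rfl

/-- A bijective morphism is an isomorphism. -/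
def isoOfBijective (φ : V ⟶ W) (h : Function.Bijective (lin φ)) : V ≅ W where
  hom := φ
  inv := mk' (LinearEquiv.ofBijective (lin φ) h).symm.toLinearMap
    (fun v a => h.1 (by
      have he := (LinearEquiv.ofBijective (lin φ) h).apply_symm_apply
      rw [lin_act]
      exact (he _).trans (congrArg (fun z => W.act z a) (he v).symm)))
    (fun g v => h.1 (by
      have he := (LinearEquiv.ofBijective (lin φ) h).apply_symm_apply
      rw [lin_ρ]
      exact (he _).trans (congrArg (W.ρ g) (he v).symm)))
  hom_inv_id := hom_ext fun v => (LinearEquiv.ofBijective (lin φ) h).symm_apply_apply v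
  inv_hom_id := hom_ext fun v => (LinearEquiv.ofBijective (lin φ) h).apply_symm_apply v

end

/-! The category of equivariant modules is equivalent to the modules over an algebra, hence it is
locally presentable. -/

variable (α) in
/-- The action on an equivariant module of words in elements of `A` and `G`. -/
def word (M : GMod α) : FreeAlgebra K (A ⊕ G) →ₐ[K] Module.End K M :=
  FreeAlgebra.lift K (Sum.elim (fun a => M.act.flip a) (fun g => M.ρ g))

variable (α) in
/-- The algebra of words in elements of `A` and `G`, up to having the same action on all
equivariant modules. -/
abbrev WordAlg : Type u :=
  RingQuot (fun x y : FreeAlgebra K (A ⊕ G) => ∀ M : GMod α, word α M x = word α M y)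

/-- The action of the word algebra. -/
def wordAct (M : GMod α) : WordAlg α →ₐ[K] Module.End K M :=
  RingQuot.liftAlgHom K ⟨word α M, fun _ _ h => h M⟩

variable (α) in
/-- The class of a letter in the word algebra. -/
def letter (x : A ⊕ G) : WordAlg α := RingQuot.mkAlgHom K _ (FreeAlgebra.ι K x)

theorem wordAct_letter (M : GMod α) (x : A ⊕ G) :
    wordAct M (letter α x) = Sum.elim (fun a => M.act.flip a) (fun g => M.ρ g) x := by
  exact (RingQuot.liftAlgHom_mkAlgHom_apply K _ _ _).trans (by simp [word])

theorem wordAlg_induction {P : WordAlg α → Prop} (h1 : ∀ r, P (algebraMap K _ r))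
    (h2 : ∀ x, P (letter α x)) (h3 : ∀ x y, P x → P y → P (x + y))
    (h4 : ∀ x y, P x → P y → P (x * y)) (x : WordAlg α) : P x := by
  obtain ⟨x, rfl⟩ := RingQuot.mkAlgHom_surjective K _ x
  induction x using FreeAlgebra.induction with
  | grade0 r => simpa using h1 r
  | grade1 x => exact h2 x
  | mul a b ha hb => simpa using h4 _ _ ha hb
  | add a b ha hb => simpa using h3 _ _ ha hb

theorem word_eq {x y : FreeAlgebra K (A ⊕ G)} (h : ∀ M : GMod α, word α M x = word α M y) :
    (RingQuot.mkAlgHom K (fun x y => ∀ M : GMod α, word α M x = word α M y) x : WordAlg α) =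
      RingQuot.mkAlgHom K _ y := RingQuot.mkAlgHom_rel K h

instance wordModule (M : GMod α) : Module (WordAlg α) M := Module.compHom M (wordAct M).toRingHom

theorem word_smul (M : GMod α) (x : WordAlg α) (m : M) : x • m = wordAct M x m := rfl

variable (α) in
/-- The comparison functor to modules over the word algebra. -/
def toMod : GMod α ⥤ ModuleCat.{u} (WordAlg α) where
  obj M := ModuleCat.of (WordAlg α) M
  map {M N} φ := ModuleCat.ofHom
    { toFun := lin φ
      map_add' := (lin φ).map_add
      map_smul' := fun x => by
        induction x using wordAlg_induction with
        | h1 r => intro m; simp [word_smul, Module.algebraMap_end_apply]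
        | h2 x => intro m; cases x <;> simp [word_smul, wordAct_letter, lin_act, lin_ρ]
        | h3 x y hx hy => intro m; simp_all [add_smul]
        | h4 x y hx hy => intro m; simp_all [mul_smul] }

instance : (toMod α).Faithful where
  map_injective h := hom_ext fun v => congrArg (fun z => z.hom v) h

instance : (toMod α).Full where
  map_surjective {M N} ψ := by
    have h : ∀ (x : WordAlg α) (m : M), ψ.hom (wordAct M x m) = wordAct N x (ψ.hom m) :=
      fun x m => ψ.hom.map_smul x m
    refine ⟨mk' ⟨⟨ψ.hom, ψ.hom.map_add⟩, fun r m => ?_⟩ (fun v a => ?_) (fun g v => ?_), ?_⟩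
    · have h1 := h (algebraMap K _ r) m
      rw [AlgHom.commutes, AlgHom.commutes] at h1
      exact h1
    · have h1 := h (letter α (Sum.inl a)) v
      rw [wordAct_letter, wordAct_letter] at h1
      exact h1
    · have h1 := h (letter α (Sum.inr g)) v
      rw [wordAct_letter, wordAct_letter] at h1
      exact h1
    · rfl

variable (α) in
/-- The letters from `A`, as a linear map. -/
def letterLin : A →ₗ[K] WordAlg α where
  toFun a := letter α (Sum.inl a)
  map_add' a b := by
    simp only [letter, ← map_add]
    exact word_eq fun M => by simp [word]
  map_smul' r a := by
    simp only [letter, ← map_smul]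
    exact word_eq fun M => by simp [word]

theorem letter_mul (a b : A) :
    letter α (Sum.inl (a * b)) = letter α (Sum.inl b) * letter α (Sum.inl a) := by
  simp only [letter, ← map_mul]
  exact word_eq fun M => by ext m; simp [word, act_mul]

theorem letter_one : letter α (Sum.inl 1) = 1 := by
  simp only [letter]
  rw [← map_one (RingQuot.mkAlgHom K _)]
  exact word_eq fun M => by ext m; simp [word, act_one]

theorem letter_ρ_one : letter α (Sum.inr 1) = 1 := by
  simp only [letter]
  rw [← map_one (RingQuot.mkAlgHom K _)]
  exact word_eq fun M => by ext m; simp [word]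

theorem letter_ρ_mul (g h : G) :
    letter α (Sum.inr (g * h)) = letter α (Sum.inr g) * letter α (Sum.inr h) := by
  simp only [letter, ← map_mul]
  exact word_eq fun M => by ext m; simp [word]

theorem letter_ρ_act (g : G) (a : A) : letter α (Sum.inr g) * letter α (Sum.inl a) =
    letter α (Sum.inl (α g a)) * letter α (Sum.inr g) := by
  simp only [letter, ← map_mul]
  exact word_eq fun M => by ext m; simp [word, ρ_act]

/-- The equivariant module underlying a module over the word algebra. -/
def ofMod (N : ModuleCat.{u} (WordAlg α)) : GMod α :=
  let _ : Module K N := Module.compHom N (algebraMap K (WordAlg α))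
  have : IsScalarTower K (WordAlg α) N := ⟨fun r x n => by
    rw [Algebra.smul_def, mul_smul]; rfl⟩
  { carrier := N
    act := ((Algebra.lsmul K K N).toLinearMap ∘ₗ letterLin α).flip
    act_one := fun v => by
      change letter α (Sum.inl 1) • v = v
      rw [letter_one, one_smul]
    act_mul := fun v a b => by
      change letter α (Sum.inl (a * b)) • v = letter α (Sum.inl b) • letter α (Sum.inl a) • v
      rw [letter_mul, mul_smul]
    ρ :=
    { toFun := fun g => Algebra.lsmul K K N (letter α (Sum.inr g))
      map_one' := by rw [letter_ρ_one, map_one]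
      map_mul' := fun g h => by rw [letter_ρ_mul, map_mul] }
    ρ_act := fun g v a => by
      change letter α (Sum.inr g) • letter α (Sum.inl a) • v =
        letter α (Sum.inl (α g a)) • letter α (Sum.inr g) • v
      rw [← mul_smul, letter_ρ_act, mul_smul] }

theorem wordAct_ofMod (N : ModuleCat.{u} (WordAlg α)) (x : WordAlg α) (n : N) :
    (wordAct (ofMod N) x : N → N) n = x • n := by
  induction x using wordAlg_induction generalizing n with
  | h1 r => rw [AlgHom.commutes]; rfl
  | h2 x => rw [wordAct_letter]; cases x <;> rfl
  | h3 x y hx hy => rw [map_add, add_smul, ← hx, ← hy]; rfl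
  | h4 x y hx hy => rw [map_mul, mul_smul, ← hy]; exact hx _

instance : (toMod α).EssSurj where
  mem_essImage N := ⟨ofMod N, ⟨LinearEquiv.toModuleIso (X₁ := (ofMod N : Type u)) (X₂ := N)
      { toFun := fun n => n
        invFun := fun n => n
        map_add' := fun _ _ => rfl
        map_smul' := wordAct_ofMod N
        left_inv := fun _ => rfl
        right_inv := fun _ => rfl }⟩⟩

instance : (toMod α).IsEquivalence where

instance : IsLocallyPresentable.{u} (GMod α) :=
  (toMod α).asEquivalence.symm.isLocallyPresentable

end GMod

end GMod

/-! ### Equivariant AQFTs and factorization products of equivariant modules -/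

/-- A `G`-equivariant AQFT. -/
structure GAQFT (K : Type u) [CommRing K] (C : Type w) [Category.{v} C] [Orthogonality C]
    (G : Type u) [Group G] extends AQFT.{u, v, w} K C where
  rep : G →* Aut F

namespace GAQFT

variable {K : Type u} [CommRing K] {C : Type w} [Category.{v} C] [Orthogonality C]
  {G : Type u} [Group G] (𝔄 : GAQFT.{u, v, w} K C G)

/-- The algebra assigned to an object. -/
abbrev alg (c : C) : Type u := 𝔄.F.obj c

/-- The algebra map assigned to a morphism. -/
def map {c t : C} (f : c ⟶ t) : 𝔄.alg c →ₐ[K] 𝔄.alg t := (𝔄.F.map f).hom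

theorem map_id (c : C) : 𝔄.map (𝟙 c) = AlgHom.id K _ := by simp [map]

theorem map_comp {a b c : C} (f : a ⟶ b) (g : b ⟶ c) (x : 𝔄.alg a) :
    𝔄.map (f ≫ g) x = 𝔄.map g (𝔄.map f x) := by simp [map]

/-- The action of the group on the algebra assigned to an object. -/
def autAct (c : C) : G →* (𝔄.alg c →ₐ[K] 𝔄.alg c) where
  toFun g := ((𝔄.rep g).hom.app c).hom
  map_one' := by rw [map_one]; rfl
  map_mul' g h := by
    rw [map_mul]
    rfl

theorem map_autAct {c t : C} (f : c ⟶ t) (g : G) (x : 𝔄.alg c) :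
    𝔄.map f (𝔄.autAct c g x) = 𝔄.autAct t g (𝔄.map f x) :=
  (congrArg (fun z => z.hom x) ((𝔄.rep g).hom.naturality f)).symm

section

open scoped Classical

variable {ι : Type} {c : ι → C} {t : C} (f : Op c t) (V : ∀ i, GMod (𝔄.autAct (c i)))

/-- The submodule of relations defining the relative tensor product of `⨂ᵢ Vᵢ` and the algebra of
the target over the algebras of the sources. -/
def relations : Submodule K ((⨂[K] i, (V i : Type u)) ⊗[K] 𝔄.alg t) :=
  Submodule.span K {x | ∃ (v : ∀ i, V i) (j : ι) (a : 𝔄.alg (c j)) (b : 𝔄.alg t),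
    x = PiTensorProduct.tprod K (Function.update v j ((V j).act (v j) a)) ⊗ₜ[K] b -
      PiTensorProduct.tprod K v ⊗ₜ[K] (𝔄.map (f.hom j) a * b)}

/-- The relative tensor product of `⨂ᵢ Vᵢ` and the algebra of the target over the algebras of the
sources. -/
abbrev RelTensor : Type u := ((⨂[K] i, (V i : Type u)) ⊗[K] 𝔄.alg t) ⧸ 𝔄.relations f V

/-- The universal multilinear map to the relative tensor product. -/
def relMk : MultilinearMap K (fun i => (V i : Type u)) (𝔄.alg t →ₗ[K] 𝔄.RelTensor f V) :=
  (TensorProduct.curry (𝔄.relations f V).mkQ).compMultilinearMap (PiTensorProduct.tprod K)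

theorem relMk_act (v : ∀ i, V i) (j : ι) (a : 𝔄.alg (c j)) (b : 𝔄.alg t) :
    𝔄.relMk f V (Function.update v j ((V j).act (v j) a)) b =
      𝔄.relMk f V v (𝔄.map (f.hom j) a * b) :=
  (Submodule.Quotient.eq _).2 (Submodule.subset_span ⟨v, j, a, b, rfl⟩)

section

variable {Q : Type u} [AddCommGroup Q] [Module K Q]

/-- The universal property of the relative tensor product. -/
def relLift (φ : MultilinearMap K (fun i => (V i : Type u)) (𝔄.alg t →ₗ[K] Q))
    (h : ∀ v (j : ι) a b, φ (Function.update v j ((V j).act (v j) a)) b =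
      φ v (𝔄.map (f.hom j) a * b)) : 𝔄.RelTensor f V →ₗ[K] Q :=
  (𝔄.relations f V).liftQ (TensorProduct.lift (PiTensorProduct.lift φ)) (by
    refine Submodule.span_le.2 ?_
    rintro _ ⟨v, j, a, b, rfl⟩
    simp [h])

variable {𝔄 f V}

@[simp] theorem relLift_relMk (φ : MultilinearMap K (fun i => (V i : Type u)) (𝔄.alg t →ₗ[K] Q))
    (h) (v : ∀ i, V i) (b : 𝔄.alg t) : 𝔄.relLift f V φ h (𝔄.relMk f V v b) = φ v b := by
  refine (Submodule.liftQ_apply _ _ _).trans ?_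
  simp

theorem relTensor_ext {φ ψ : 𝔄.RelTensor f V →ₗ[K] Q}
    (h : ∀ v b, φ (𝔄.relMk f V v b) = ψ (𝔄.relMk f V v b)) : φ = ψ := by
  refine Submodule.linearMap_qext _ (TensorProduct.ext (PiTensorProduct.ext ?_))
  ext v b
  exact h v b

end

/-- The right action on the relative tensor product. -/
def relAct : 𝔄.RelTensor f V →ₗ[K] 𝔄.alg t →ₗ[K] 𝔄.RelTensor f V :=
  𝔄.relLift f V
    ((LinearMap.lcomp K _ (LinearMap.mul K (𝔄.alg t)) ∘ₗ
      LinearMap.llcomp K (𝔄.alg t) (𝔄.alg t) (𝔄.RelTensor f V)).compMultilinearMap (𝔄.relMk f V))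
    (fun v j a b => by
      ext x
      simp [relMk_act, mul_assoc])

@[simp] theorem relAct_relMk (v : ∀ i, V i) (b x : 𝔄.alg t) :
    𝔄.relAct f V (𝔄.relMk f V v b) x = 𝔄.relMk f V v (b * x) := by
  simp [relAct]

/-- The group action on the relative tensor product. -/
def relρ (g : G) : 𝔄.RelTensor f V →ₗ[K] 𝔄.RelTensor f V :=
  𝔄.relLift f V
    ((LinearMap.lcomp K _ (𝔄.autAct t g).toLinearMap).compMultilinearMap
      ((𝔄.relMk f V).compLinearMap fun i => (V i).ρ g))
    (fun v j a b => by
      have h : (fun i => (V i).ρ g (Function.update v j ((V j).act (v j) a) i)) =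
          Function.update (fun i => (V i).ρ g (v i)) j
            ((V j).act ((V j).ρ g (v j)) (𝔄.autAct (c j) g a)) := by
        funext i
        by_cases hi : i = j
        · subst hi; simp [GMod.ρ_act]
        · simp [hi]
      simp only [LinearMap.compMultilinearMap_apply, MultilinearMap.compLinearMap_apply,
        LinearMap.lcomp_apply, h]
      refine (𝔄.relMk_act f V (fun i => (V i).ρ g (v i)) j _ _).trans ?_
      simp [map_autAct])

@[simp] theorem relρ_relMk (g : G) (v : ∀ i, V i) (b : 𝔄.alg t) :
    𝔄.relρ f V g (𝔄.relMk f V v b) =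
      𝔄.relMk f V (fun i => (V i).ρ g (v i)) (𝔄.autAct t g b) := by
  simp [relρ]

/-- The factorization product of equivariant modules. -/
def relProd : GMod (𝔄.autAct t) where
  carrier := 𝔄.RelTensor f V
  act := 𝔄.relAct f V
  act_one := LinearMap.congr_fun (f := (𝔄.relAct f V).flip 1) (g := LinearMap.id)
    (relTensor_ext fun v b => by simp)
  act_mul x a b := LinearMap.congr_fun (f := (𝔄.relAct f V).flip (a * b))
    (g := (𝔄.relAct f V).flip b ∘ₗ (𝔄.relAct f V).flip a)
    (relTensor_ext fun v b => by simp [mul_assoc]) x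
  ρ :=
  { toFun := 𝔄.relρ f V
    map_one' := relTensor_ext fun v b => by simp
    map_mul' := fun g h => relTensor_ext fun v b => by simp }
  ρ_act g x a := LinearMap.congr_fun (f := 𝔄.relρ f V g ∘ₗ (𝔄.relAct f V).flip a)
    (g := (𝔄.relAct f V).flip (𝔄.autAct t g a) ∘ₗ 𝔄.relρ f V g)
    (relTensor_ext fun v b => by simp) x

/-- The universal multilinear map to the factorization product. -/
def relTmul : MultilinearMap K (fun i => (V i : Type u)) (𝔄.relProd f V) :=
  (LinearMap.applyₗ (1 : 𝔄.alg t)).compMultilinearMap (𝔄.relMk f V)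

theorem relMk_eq (v : ∀ i, V i) (b : 𝔄.alg t) :
    𝔄.relMk f V v b = (𝔄.relProd f V).act (𝔄.relTmul f V v) b :=
  ((𝔄.relAct_relMk f V v 1 b).trans (by rw [one_mul])).symm

theorem relTmul_act (v : ∀ i, V i) (j : ι) (a : 𝔄.alg (c j)) :
    𝔄.relTmul f V (Function.update v j ((V j).act (v j) a)) =
      (𝔄.relProd f V).act (𝔄.relTmul f V v) (𝔄.map (f.hom j) a) :=
  (𝔄.relMk_act f V v j a 1).trans (by rw [relMk_eq, mul_one])

theorem relTmul_ρ (g : G) (v : ∀ i, V i) :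
    (𝔄.relProd f V).ρ g (𝔄.relTmul f V v) = 𝔄.relTmul f V (fun i => (V i).ρ g (v i)) :=
  (𝔄.relρ_relMk f V g v 1).trans (by rw [map_one]; rfl)

variable {𝔄 f V}

theorem relProd_span {M : Submodule K (𝔄.relProd f V)}
    (h : ∀ v b, (𝔄.relProd f V).act (𝔄.relTmul f V v) b ∈ M) : M = ⊤ := by
  have h1 : M.mkQ = 0 := relTensor_ext fun v b => by
    rw [relMk_eq]
    exact (Submodule.Quotient.mk_eq_zero M).2 (h v b)
  rw [← M.ker_mkQ, h1, LinearMap.ker_zero]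

theorem relProd_lin_ext {Q : Type u} [AddCommGroup Q] [Module K Q]
    {φ ψ : 𝔄.relProd f V →ₗ[K] Q} (h : ∀ v b, φ ((𝔄.relProd f V).act (𝔄.relTmul f V v) b) =
      ψ ((𝔄.relProd f V).act (𝔄.relTmul f V v) b)) : φ = ψ :=
  relTensor_ext fun v b => by rw [relMk_eq]; exact h v b

/-- Morphisms out of a factorization product are determined by their values on pure tensors. -/
theorem relProd_ext {Q : GMod (𝔄.autAct t)} {φ ψ : 𝔄.relProd f V ⟶ Q}
    (h : ∀ v, GMod.lin φ (𝔄.relTmul f V v) = GMod.lin ψ (𝔄.relTmul f V v)) : φ = ψ :=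
  Subtype.ext (relProd_lin_ext fun v b => by
    refine (GMod.lin_act φ _ _).trans (Eq.trans ?_ (GMod.lin_act ψ _ _).symm)
    rw [h])

/-- The universal property of the factorization product. -/
def relDesc {Q : GMod (𝔄.autAct t)} (φ : MultilinearMap K (fun i => (V i : Type u)) Q)
    (h : ∀ v (j : ι) a, φ (Function.update v j ((V j).act (v j) a)) =
      Q.act (φ v) (𝔄.map (f.hom j) a))
    (h' : ∀ g v, Q.ρ g (φ v) = φ (fun i => (V i).ρ g (v i))) : 𝔄.relProd f V ⟶ Q :=
  let L : 𝔄.RelTensor f V →ₗ[K] Q := 𝔄.relLift f V (Q.act.compMultilinearMap φ)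
    (fun v j a b => by simp [h, GMod.act_mul])
  have hL : ∀ v b, L (𝔄.relMk f V v b) = Q.act (φ v) b := fun v b => by simp [L]
  GMod.mk' L
    (fun x a => LinearMap.congr_fun (f := L ∘ₗ (𝔄.relAct f V).flip a) (g := Q.act.flip a ∘ₗ L)
      (relTensor_ext fun v b => by simp [hL, GMod.act_mul]) x)
    (fun g x => LinearMap.congr_fun (f := L ∘ₗ 𝔄.relρ f V g) (g := Q.ρ g ∘ₗ L)
      (relTensor_ext fun v b => by simp [hL, GMod.ρ_act, h']) x)

@[simp] theorem relDesc_relTmul {Q : GMod (𝔄.autAct t)}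
    (φ : MultilinearMap K (fun i => (V i : Type u)) Q) (h h') (v : ∀ i, V i) :
    GMod.lin (relDesc (𝔄 := 𝔄) (f := f) φ h h') (𝔄.relTmul f V v) = φ v :=
  (relLift_relMk _ (fun v j a b => by simp [h, GMod.act_mul]) _ _).trans
    (Q.act_one _)

/-- The functoriality of the factorization product. -/
def relMap {V W : ∀ i, GMod (𝔄.autAct (c i))} (φ : ∀ i, V i ⟶ W i) :
    𝔄.relProd f V ⟶ 𝔄.relProd f W :=
  relDesc ((𝔄.relTmul f W).compLinearMap fun i => GMod.lin (φ i))
    (fun v j a => by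
      refine Eq.trans (congrArg (𝔄.relTmul f W) ?_)
        (𝔄.relTmul_act f W (fun i => GMod.lin (φ i) (v i)) j a)
      funext i
      by_cases hi : i = j
      · subst hi; simp [GMod.lin_act]
      · simp [hi])
    (fun g v => by
      refine (𝔄.relTmul_ρ f W g _).trans (congrArg (𝔄.relTmul f W) ?_)
      funext i
      exact (GMod.lin_ρ (φ i) g (v i)).symm)

@[simp] theorem relMap_relTmul {V W : ∀ i, GMod (𝔄.autAct (c i))} (φ : ∀ i, V i ⟶ W i)
    (v : ∀ i, V i) : GMod.lin (relMap (f := f) φ) (𝔄.relTmul f V v) =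
      𝔄.relTmul f W (fun i => GMod.lin (φ i) (v i)) := by
  unfold relMap
  exact relDesc_relTmul _ _ _ _

variable (𝔄 f)

/-- The factorization product, as a functor. -/
def relFunctor : (∀ i, GMod (𝔄.autAct (c i))) ⥤ GMod (𝔄.autAct t) where
  obj V := 𝔄.relProd f V
  map φ := relMap φ
  map_id V := relProd_ext fun v => by
    simp
  map_comp φ ψ := relProd_ext fun v => by
    simp

end

end GAQFT

/-! ### Linearity and cocontinuity of the factorization products -/

namespace GMod

variable {K A G : Type u} [CommRing K] [Ring A] [Algebra K A] [Group G] {α : G →* (A →ₐ[K] A)}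

variable (α) in
/-- The functor forgetting the actions. -/
def forgetK : GMod α ⥤ ModuleCat.{u} K where
  obj M := ModuleCat.of K M
  map φ := ModuleCat.ofHom (lin φ)

theorem wordAct_algebraMap (M : GMod α) (r : K) (n : M) :
    wordAct M (algebraMap K _ r) n = r • n := by
  rw [AlgHom.commutes]
  rfl

/-- The forgetful functor factors through modules over the word algebra. -/
def forgetKIso :
    toMod α ⋙ ModuleCat.restrictScalars.{u} (algebraMap K (WordAlg α)) ≅ forgetK α :=
  NatIso.ofComponents (fun M =>
    let N : ModuleCat.{u} K :=
      (ModuleCat.restrictScalars.{u} (algebraMap K (WordAlg α))).obj ((toMod α).obj M)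
    let e : N ≃ₗ[K] M :=
      { toFun := fun n => n
        invFun := fun n => n
        map_add' := fun _ _ => rfl
        map_smul' := fun r n => by
          exact wordAct_algebraMap M r n
        left_inv := fun _ => rfl
        right_inv := fun _ => rfl }
    e.toModuleIso) (fun _ => rfl)

instance : PreservesColimitsOfSize.{u, u} (forgetK α) := by
  have : PreservesColimitsOfSize.{u, u} (ModuleCat.restrictScalars.{u} (algebraMap K (WordAlg α))) :=
    (ModuleCat.restrictCoextendScalarsAdj _).leftAdjoint_preservesColimits
  exact preservesColimits_of_natIso forgetKIso

section

variable {J : Type u} [Category.{u} J] {D : J ⥤ GMod α} {s : Cocone D}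
  {Q : Type u} [AddCommGroup Q] [Module K Q]

theorem colim_ext (hs : IsColimit s) {φ ψ : s.pt →ₗ[K] Q}
    (h : ∀ j m, φ (lin (s.ι.app j) m) = ψ (lin (s.ι.app j) m)) : φ = ψ := by
  have h1 := (isColimitOfPreserves (forgetK α) hs).hom_ext
    (f := ModuleCat.ofHom φ) (f' := ModuleCat.ofHom ψ) (fun j => by ext m; exact h j m)
  exact congrArg ModuleCat.Hom.hom h1

theorem colim_desc (hs : IsColimit s) (l : ∀ j, D.obj j →ₗ[K] Q)
    (h : ∀ {j j' : J} (a : j ⟶ j') m, l j' (lin (D.map a) m) = l j m) :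
    ∃ φ : s.pt →ₗ[K] Q, ∀ j m, φ (lin (s.ι.app j) m) = l j m := by
  let t : Cocone (D ⋙ forgetK α) := ⟨ModuleCat.of K Q,
    { app := fun j => ModuleCat.ofHom (l j)
      naturality := fun j j' a => by
        ext m
        exact h a m }⟩
  refine ⟨((isColimitOfPreserves (forgetK α) hs).desc t).hom, fun j m => ?_⟩
  exact congrArg (fun z => z.hom m) ((isColimitOfPreserves (forgetK α) hs).fac t j)

end

end GMod

namespace GAQFT

open GMod

variable {K : Type u} [CommRing K] {C : Type w} [Category.{v} C] [Orthogonality C]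
  {G : Type u} [Group G] {𝔄 : GAQFT.{u, v, w} K C G}

section

open scoped Classical

variable {ι : Type} {c : ι → C} {t : C} {f : Op c t} {i : ι}

theorem update_lin {V W : ∀ k, GMod (𝔄.autAct (c k))} {φ ψ : ∀ k, V k ⟶ W k}
    (h : ∀ k, k ≠ i → φ k = ψ k) (v : ∀ k, V k) : (fun k => lin (ψ k) (v k)) =
      Function.update (fun k => lin (φ k) (v k)) i (lin (ψ i) (v i)) := by
  funext k
  by_cases hk : k = i
  · subst hk; simp
  · simp [hk, h k hk]

theorem relMap_add {V W : ∀ k, GMod (𝔄.autAct (c k))} {φ φ' ψ : ∀ k, V k ⟶ W k}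
    (h : ∀ k, k ≠ i → φ k = φ' k) (h' : ∀ k, k ≠ i → φ k = ψ k) (hi : ψ i = φ i + φ' i) :
    relMap (f := f) ψ = relMap φ + relMap φ' := relProd_ext fun v => by
  rw [lin_add, LinearMap.add_apply, relMap_relTmul, relMap_relTmul, relMap_relTmul,
    update_lin h', update_lin h, hi, lin_add, LinearMap.add_apply, MultilinearMap.map_update_add,
    Function.update_eq_self]

theorem relMap_smul {V W : ∀ k, GMod (𝔄.autAct (c k))} {φ ψ : ∀ k, V k ⟶ W k} {r : K}
    (h : ∀ k, k ≠ i → φ k = ψ k) (hi : ψ i = r • φ i) :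
    relMap (f := f) ψ = r • relMap φ := relProd_ext fun v => by
  rw [lin_smul, LinearMap.smul_apply, relMap_relTmul, relMap_relTmul,
    update_lin h, hi, lin_smul, LinearMap.smul_apply, MultilinearMap.map_update_smul,
    Function.update_eq_self]

variable {H : ∀ k, GMod (𝔄.autAct (c i)) ⥤ GMod (𝔄.autAct (c k))}

/-- For an index `k ≠ i`, transport along the isomorphism `H k a`. -/
def backLin (H : ∀ k, GMod (𝔄.autAct (c i)) ⥤ GMod (𝔄.autAct (c k)))
    {M N : GMod (𝔄.autAct (c i))} (a : M ⟶ N) (k : ι) : (H k).obj N →ₗ[K] (H k).obj M :=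
  if _ : IsIso ((H k).map a) then lin (inv ((H k).map a)) else 0

theorem backLin_act {M N : GMod (𝔄.autAct (c i))} (a : M ⟶ N) (k : ι) (v : (H k).obj N)
    (b : 𝔄.alg (c k)) : backLin H a k (((H k).obj N).act v b) =
      ((H k).obj M).act (backLin H a k v) b := by
  unfold backLin
  split_ifs
  · exact lin_act _ _ _
  · simp

theorem backLin_ρ {M N : GMod (𝔄.autAct (c i))} (a : M ⟶ N) (k : ι) (v : (H k).obj N) (g : G) :
    backLin H a k (((H k).obj N).ρ g v) = ((H k).obj M).ρ g (backLin H a k v) := by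
  unfold backLin
  split_ifs
  · exact lin_ρ _ _ _
  · simp

theorem backLin_map {M N : GMod (𝔄.autAct (c i))} (a : M ⟶ N) (k : ι) (h : IsIso ((H k).map a))
    (v : (H k).obj M) : backLin H a k (lin ((H k).map a) v) = v := by
  unfold backLin
  rw [dif_pos h]
  exact congrArg (fun z => lin z v) (IsIso.hom_inv_id ((H k).map a))

theorem map_backLin {M N : GMod (𝔄.autAct (c i))} (a : M ⟶ N) (k : ι) (h : IsIso ((H k).map a))
    (v : (H k).obj N) : lin ((H k).map a) (backLin H a k v) = v := by
  unfold backLin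
  rw [dif_pos h]
  exact congrArg (fun z => lin z v) (IsIso.inv_hom_id ((H k).map a))

/-- Substitution of an element in the slot `i`. -/
def slot {M N : GMod (𝔄.autAct (c i))} (a : M ⟶ N) (v : ∀ k, (H k).obj N) (m : (H i).obj M) :
    ∀ k, (H k).obj M := Function.update (fun k => backLin H a k (v k)) i m

theorem slot_update {M N : GMod (𝔄.autAct (c i))} (a : M ⟶ N) (v : ∀ k, (H k).obj N)
    (m : (H i).obj M) (n : (H i).obj N) : slot a (Function.update v i n) m = slot a v m := by
  funext k
  by_cases hk : k = i
  · subst hk; simp [slot]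
  · simp [slot, hk]

theorem slot_update_ne {M N : GMod (𝔄.autAct (c i))} (a : M ⟶ N) (v : ∀ k, (H k).obj N)
    (m : (H i).obj M) {k : ι} (hk : k ≠ i) (n : (H k).obj N) :
    slot a (Function.update v k n) m = Function.update (slot a v m) k (backLin H a k n) := by
  funext l
  by_cases hl : l = i
  · subst hl; simp [slot, hk.symm]
  · by_cases hlk : l = k
    · subst hlk; simp [slot, hl]
    · simp [slot, hl, hlk]

theorem slot_same {M N : GMod (𝔄.autAct (c i))} (a : M ⟶ N) (v : ∀ k, (H k).obj N)
    (m : (H i).obj M) : slot a v m i = m := by simp [slot]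

theorem slot_ne {M N : GMod (𝔄.autAct (c i))} (a : M ⟶ N) (v : ∀ k, (H k).obj N)
    (m : (H i).obj M) {k : ι} (hk : k ≠ i) : slot a v m k = backLin H a k (v k) := by
  simp [slot, hk]

section

theorem slot_map
    (hc : ∀ k, k ≠ i → ∀ {M N} (a : M ⟶ N), IsIso ((H k).map a))
    {M N : GMod (𝔄.autAct (c i))} (a : M ⟶ N) (v : ∀ k, (H k).obj M) :
    slot a (fun k => lin ((H k).map a) (v k)) (v i) = v := by
  funext k
  by_cases hk : k = i
  · subst hk; rw [slot_same]
  · rw [slot_ne _ _ _ hk, backLin_map _ _ (hc k hk a)]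

theorem map_slot
    (hc : ∀ k, k ≠ i → ∀ {M N} (a : M ⟶ N), IsIso ((H k).map a))
    {M N : GMod (𝔄.autAct (c i))} (a : M ⟶ N) (v : ∀ k, (H k).obj N)
    (m : (H i).obj M) : (fun k => lin ((H k).map a) (slot a v m k)) =
      Function.update v i (lin ((H i).map a) m) := by
  funext k
  by_cases hk : k = i
  · subst hk; rw [slot_same]; simp
  · rw [slot_ne _ _ _ hk, map_backLin _ _ (hc k hk a)]; simp [hk]

theorem map_slot_comp
    (hc : ∀ k, k ≠ i → ∀ {M N} (a : M ⟶ N), IsIso ((H k).map a))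
    {M N L : GMod (𝔄.autAct (c i))} (a : M ⟶ N) (b : N ⟶ L)
    (v : ∀ k, (H k).obj L) (m : (H i).obj M) :
    (fun k => lin ((H k).map a) (slot (a ≫ b) v m k)) = slot b v (lin ((H i).map a) m) := by
  rw [← slot_map hc b (fun k => lin ((H k).map a) (slot (a ≫ b) v m k)), slot_same]
  have h := map_slot hc (a ≫ b) v m
  simp only [Functor.map_comp, lin_comp, LinearMap.comp_apply] at h
  rw [h, slot_update]

theorem rel_existsUnique_desc
    (hc : ∀ k, k ≠ i → ∀ {M N} (a : M ⟶ N), IsIso ((H k).map a))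
    {J : Type u} [Category.{u} J] {D : J ⥤ GMod (𝔄.autAct (c i))}
    (s : Cocone D) (hs : IsColimit ((H i).mapCocone s)) (Q : GMod (𝔄.autAct t))
    (q : ∀ j, 𝔄.relProd f (fun k => (H k).obj (D.obj j)) ⟶ Q)
    (hq : ∀ {j j' : J} (a : j ⟶ j'), relMap (fun k => (H k).map (D.map a)) ≫ q j' = q j) :
    ∃! d : 𝔄.relProd f (fun k => (H k).obj s.pt) ⟶ Q,
      ∀ j, relMap (fun k => (H k).map (s.ι.app j)) ≫ d = q j := by
  have ext : ∀ {φ ψ : (H i).obj s.pt →ₗ[K] Q}, (∀ j m, φ (lin ((H i).map (s.ι.app j)) m) =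
    ψ (lin ((H i).map (s.ι.app j)) m)) → φ = ψ := fun h => colim_ext hs h
  have desc : ∀ l : (∀ j, (H i).obj (D.obj j) →ₗ[K] Q), (∀ {j j' : J} (a : j ⟶ j') m,
      l j' (lin ((H i).map (D.map a)) m) = l j m) →
      ∃ φ : (H i).obj s.pt →ₗ[K] Q, ∀ j m, φ (lin ((H i).map (s.ι.app j)) m) = l j m :=
    fun l h => colim_desc hs l h
  let l : ∀ (_ : ∀ k, (H k).obj s.pt) (j : J), (H i).obj (D.obj j) →ₗ[K] Q := fun v j =>
    lin (q j) ∘ₗ (𝔄.relTmul f fun k => (H k).obj (D.obj j)).toLinearMap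
      (fun k => backLin H (s.ι.app j) k (v k)) i
  have hl : ∀ v j m, l v j m = lin (q j) (𝔄.relTmul f _ (slot (s.ι.app j) v m)) :=
    fun v j m => rfl
  have hl' : ∀ v {j j' : J} (a : j ⟶ j') m, l v j' (lin ((H i).map (D.map a)) m) = l v j m := by
    intro v j j' a m
    rw [hl, hl, ← map_slot_comp hc, ← relMap_relTmul, s.w, ← hq a]
    rfl
  choose Λ hΛ using fun v => desc (l v) (hl' v)
  have hΛ' : ∀ v n, Λ (Function.update v i n) = Λ v := fun v n => ext fun j m => by
    rw [hΛ, hΛ, hl, hl, slot_update]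
  have hΛ2 : ∀ v k, k ≠ i → ∀ (n : (H k).obj s.pt) j m,
      Λ (Function.update v k n) (lin ((H i).map (s.ι.app j)) m) = lin (q j) (𝔄.relTmul f _
        (Function.update (slot (s.ι.app j) v m) k (backLin H (s.ι.app j) k n))) :=
    fun v k hk n j m => by rw [hΛ, hl, slot_update_ne _ _ _ hk]
  let φ : MultilinearMap K (fun k => ((H k).obj s.pt : Type u)) Q := MultilinearMap.mk'
    (fun v => Λ v (v i))
    (fun v k x y => by
      by_cases hk : k = i
      · subst hk
        simp [hΛ']
      · have h : Λ (Function.update v k (x + y)) =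
            Λ (Function.update v k x) + Λ (Function.update v k y) := ext fun j m => by
          rw [LinearMap.add_apply, hΛ2 v k hk, hΛ2 v k hk, hΛ2 v k hk, map_add,
            MultilinearMap.map_update_add, map_add]
        simp [h, Ne.symm hk])
    (fun v k r x => by
      by_cases hk : k = i
      · subst hk
        simp [hΛ']
      · have h : Λ (Function.update v k (r • x)) =
            r • Λ (Function.update v k x) := ext fun j m => by
          rw [LinearMap.smul_apply, hΛ2 v k hk, hΛ2 v k hk, map_smul,
            MultilinearMap.map_update_smul, map_smul]
        simp [h, Ne.symm hk])
  have hφ : ∀ v, φ v = Λ v (v i) := fun v => rfl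
  have hφ1 : ∀ v k a, φ (Function.update v k (((H k).obj s.pt).act (v k) a)) =
      Q.act (φ v) (𝔄.map (f.hom k) a) := by
    intro v k a
    rw [hφ, hφ]
    by_cases hk : k = i
    · subst hk
      rw [hΛ', Function.update_self]
      refine LinearMap.congr_fun (f := Λ v ∘ₗ ((H k).obj s.pt).act.flip a)
        (g := Q.act.flip (𝔄.map (f.hom k) a) ∘ₗ Λ v) (ext fun j m => ?_) (v k)
      simp only [LinearMap.comp_apply, LinearMap.flip_apply]
      rw [← lin_act, hΛ, hΛ, hl, hl, ← lin_act, ← relTmul_act, slot_same]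
      simp [slot]
    · rw [Function.update_of_ne (Ne.symm hk)]
      refine LinearMap.congr_fun (f := Λ _)
        (g := Q.act.flip (𝔄.map (f.hom k) a) ∘ₗ Λ v) (ext fun j m => ?_) (v i)
      simp only [LinearMap.comp_apply, LinearMap.flip_apply]
      rw [hΛ2 v k hk, hΛ, hl, ← lin_act, ← relTmul_act, slot_ne _ _ _ hk]
      exact congrArg (fun z => lin (q j) (𝔄.relTmul f _
        (Function.update (slot (s.ι.app j) v m) k z))) (backLin_act _ _ _ _)
  have hφ2 : ∀ g v, Q.ρ g (φ v) = φ (fun k => ((H k).obj s.pt).ρ g (v k)) := by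
    intro g v
    refine LinearMap.congr_fun (f := Q.ρ g ∘ₗ Λ v)
        (g := Λ (fun k => ((H k).obj s.pt).ρ g (v k)) ∘ₗ ((H i).obj s.pt).ρ g)
        (ext fun j m => ?_) (v i)
    simp only [LinearMap.comp_apply]
    rw [← lin_ρ, hΛ, hΛ, hl, hl, ← lin_ρ, relTmul_ρ]
    congr 2
    funext k
    by_cases hk : k = i
    · subst hk; simp [slot_same]
    · simp [slot_ne _ _ _ hk, backLin_ρ]
  refine ⟨relDesc φ hφ1 hφ2, fun j => relProd_ext fun v => ?_, fun ψ hψ => relProd_ext fun v => ?_⟩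
  · rw [lin_comp, LinearMap.comp_apply, relMap_relTmul]
    refine (relDesc_relTmul φ hφ1 hφ2 _).trans ?_
    rw [hφ, hΛ, hl, slot_map hc]
  · refine Eq.trans ?_ (relDesc_relTmul φ hφ1 hφ2 v).symm
    rw [hφ]
    refine Eq.trans (congrArg (fun z => lin ψ (𝔄.relTmul f _ z)) (Function.update_eq_self i v).symm) ?_
    refine LinearMap.congr_fun (f := lin ψ ∘ₗ (𝔄.relTmul f _).toLinearMap v i) (g := Λ v)
      (ext fun j m => ?_) (v i)
    rw [hΛ, hl, ← hψ]
    simp only [LinearMap.comp_apply, MultilinearMap.toLinearMap_apply, lin_comp]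
    rw [relMap_relTmul, map_slot hc]
    rfl

theorem relFunctor_cocont
    (hc : ∀ k, k ≠ i → ∀ {M N} (a : M ⟶ N), IsIso ((H k).map a))
    [PreservesColimitsOfSize.{u, u} (H i)] :
    PreservesColimitsOfSize.{u, u} (Functor.pi' H ⋙ 𝔄.relFunctor f) :=
  ⟨⟨⟨fun {s} hs => ⟨IsColimit.ofExistsUnique fun q =>
    rel_existsUnique_desc hc s (isColimitOfPreserves (H i) hs) q.pt (fun j => q.ι.app j)
      (fun a => q.w a)⟩⟩⟩⟩

end

theorem relFunctor_additive
    (hc : ∀ k, k ≠ i → ∀ {M N} (a b : M ⟶ N), (H k).map a = (H k).map b) [(H i).Additive] :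
    (Functor.pi' H ⋙ 𝔄.relFunctor f).Additive :=
  ⟨relMap_add (i := i) (fun k hk => hc k hk _ _) (fun k hk => hc k hk _ _) (H i).map_add⟩

theorem relFunctor_linear
    (hc : ∀ k, k ≠ i → ∀ {M N} (a b : M ⟶ N), (H k).map a = (H k).map b)
    [(H i).Additive] [(H i).Linear K] : (Functor.pi' H ⋙ 𝔄.relFunctor f).Linear K :=
  ⟨fun a r => relMap_smul (i := i) (fun k hk => hc k hk _ _) ((H i).map_smul r a)⟩

variable (𝔄) in
/-- The category of equivariant modules over the algebra assigned to an object. -/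
def gmodCat (c : C) : LPCat K := ⟨GMod (𝔄.autAct c)⟩

theorem relFunctor_lin (f : Op c t) :
    IsMultLinCocont (D := fun i => 𝔄.gmodCat (c i)) (E := 𝔄.gmodCat t) (𝔄.relFunctor f) := by
  intro i (x : ∀ k, GMod (𝔄.autAct (c k)))
  have h1 : ∀ k, k ≠ i → ∀ {M N : GMod (𝔄.autAct (c i))} (a b : M ⟶ N),
      (insertSlot i x k).map a = (insertSlot i x k).map b := by
    intro k hk M N a b
    rw [insertSlot_ne hk]
    rfl
  have h2 : ∀ k, k ≠ i → ∀ {M N : GMod (𝔄.autAct (c i))} (a : M ⟶ N),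
      IsIso ((insertSlot i x k).map a) := by
    intro k hk M N a
    rw [insertSlot_ne hk]
    exact inferInstanceAs (IsIso (𝟙 (x k)))
  have h3 : (insertSlot i x i).Additive := by
    rw [insertSlot_self]
    infer_instance
  have h4 : (insertSlot i x i).Linear K := by
    have h5 := insertSlot_self i x
    revert h3
    rw [h5]
    intro
    infer_instance
  have h5 : PreservesColimitsOfSize.{u, u} (insertSlot i x i) := by
    rw [insertSlot_self]
    infer_instance
  let H : ∀ k, GMod (𝔄.autAct (c i)) ⥤ GMod (𝔄.autAct (c k)) := insertSlot i x
  have h6 : (H i).Additive := h3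
  have h7 : (H i).Linear K := h4
  have h8 : PreservesColimitsOfSize.{u, u} (H i) := h5
  exact ⟨relFunctor_additive (H := H) h1, relFunctor_linear (H := H) h1,
    relFunctor_cocont (H := H) h2⟩

end

end GAQFT

/-! ### Extension of multilinear maps from generators -/

section MultilinearExtension

open scoped Classical

variable {K : Type u} [CommRing K] {ι : Type} [Finite ι] {S Y : ι → Type u} {W : Type u}
  [∀ i, AddCommGroup (Y i)] [∀ i, Module K (Y i)] [AddCommGroup W] [Module K W]

/-- The multilinear map on free modules with prescribed values on basis elements. -/
theorem exists_multilinear_free (val : (∀ i, S i) → W) :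
    ∃ Φ : MultilinearMap K (fun i => (S i →₀ K)) W,
      ∀ s, Φ (fun i => Finsupp.single (s i) 1) = val s := by
  have := Fintype.ofFinite ι
  refine ⟨(Finsupp.linearCombination K val ∘ₗ
    (PiTensorProduct.ofFinsuppEquiv' (R := K) (κ := S)).toLinearMap).compMultilinearMap
      (PiTensorProduct.tprod K), fun s => ?_⟩
  simp

theorem multilinear_congr {X : ι → Type u} [∀ i, AddCommGroup (X i)] [∀ i, Module K (X i)]
    (Φ : MultilinearMap K X W) (r : ∀ i, X i →ₗ[K] Y i)
    (h : ∀ i x z, r i z = 0 → Φ (Function.update x i z) = 0) {x x' : ∀ i, X i}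
    (hx : ∀ i, r i (x i) = r i (x' i)) : Φ x = Φ x' := by
  have := Fintype.ofFinite ι
  have key : ∀ T : Finset ι, Φ (T.piecewise x x') = Φ x' := by
    intro T
    induction T using Finset.induction_on with
    | empty => simp
    | insert j T hj ih =>
      rw [Finset.piecewise_insert, ← sub_add_cancel (x j) (x' j), MultilinearMap.map_update_add,
        h j _ _ (by rw [map_sub, hx, sub_self]), zero_add, ← ih]
      congr 1
      rw [Function.update_eq_self_iff, Finset.piecewise_eq_of_notMem _ _ _ hj]
  simpa using key Finset.univ

/-- A function on tuples of generators which extends linearly in each variable separately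
extends to a multilinear map. -/
theorem exists_multilinear_extension (σ : ∀ i, S i → Y i)
    (hσ : ∀ i, Submodule.span K (Set.range (σ i)) = ⊤) (val : (∀ i, S i) → W)
    (h : ∀ (i : ι) (s : ∀ i, S i),
      ∃ l : Y i →ₗ[K] W, ∀ x, l (σ i x) = val (Function.update s i x)) :
    ∃ Ψ : MultilinearMap K Y W, ∀ s, Ψ (fun i => σ i (s i)) = val s := by
  have := Fintype.ofFinite ι
  obtain ⟨Φ, hΦ⟩ := exists_multilinear_free (K := K) val
  have h1 : ∀ i z, Finsupp.linearCombination K (σ i) z = 0 → ∀ (T : Finset ι)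
      (x : ∀ i, S i →₀ K), (∀ k, k ≠ i → k ∉ T → ∃ s, x k = Finsupp.single s 1) →
      Φ (Function.update x i z) = 0 := by
    intro i z hz T
    induction T using Finset.induction_on with
    | empty =>
      intro x hx
      rcases isEmpty_or_nonempty (S i) with he | ⟨⟨s₀⟩⟩
      · rw [Subsingleton.elim z 0, MultilinearMap.map_update_zero]
      have hx' : ∀ k, ∃ s, k ≠ i → x k = Finsupp.single s 1 := fun k => by
        by_cases hk : k = i
        · subst hk; exact ⟨s₀, fun h => (h rfl).elim⟩
        · obtain ⟨s, hs⟩ := hx k hk (by simp)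
          exact ⟨s, fun _ => hs⟩
      choose s hs using hx'
      obtain ⟨l, hl⟩ := h i s
      have h2 : Φ.toLinearMap x i = l ∘ₗ Finsupp.linearCombination K (σ i) := by
        refine Finsupp.lhom_ext' fun y => LinearMap.ext_ring ?_
        simp only [LinearMap.comp_apply, Finsupp.lsingle_apply, MultilinearMap.toLinearMap_apply,
          Finsupp.linearCombination_single, one_smul, hl, ← hΦ]
        congr 1
        funext k
        by_cases hk : k = i
        · subst hk; simp
        · simp [hk, hs k hk]
      exact (LinearMap.congr_fun h2 z).trans (by simp [hz])
    | insert j T hj ih =>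
      intro x hx
      by_cases hji : j = i
      · subst hji
        exact ih x fun k hk hkT => hx k hk (by simp [hk, hkT])
      rw [← Function.update_eq_self j x]
      generalize x j = y
      induction y using Finsupp.induction_linear with
      | zero => rw [Function.update_comm hji, MultilinearMap.map_update_zero]
      | add y y' hy hy' =>
        rw [Function.update_comm hji] at hy hy' ⊢
        rw [MultilinearMap.map_update_add, hy, hy', add_zero]
      | single s r =>
        have h3 := ih (Function.update x j (Finsupp.single s 1)) fun k hk hkT => by
          by_cases hkj : k = j
          · subst hkj; exact ⟨s, by simp⟩
          · simpa [hkj] using hx k hk (by simp [hkj, hkT])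
        rw [Function.update_comm hji] at h3 ⊢
        rw [← mul_one r, ← smul_eq_mul, ← Finsupp.smul_single, MultilinearMap.map_update_smul, h3,
          smul_zero]
  have h2 : ∀ i x z, Finsupp.linearCombination K (σ i) z = 0 → Φ (Function.update x i z) = 0 :=
    fun i x z hz => h1 i z hz Finset.univ x (fun k _ hk => (hk (Finset.mem_univ k)).elim)
  have hsurj : ∀ i, Function.Surjective (Finsupp.linearCombination K (σ i)) := fun i => by
    rw [← LinearMap.range_eq_top, Finsupp.range_linearCombination, hσ]
  choose r hr using hsurj
  refine ⟨MultilinearMap.mk' (fun y => Φ fun i => r i (y i)) (fun y i a b => ?_)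
    (fun y i c a => ?_), fun s => ?_⟩
  · have h4 : ∀ a, (fun k => r k (Function.update y i a k)) =
        Function.update (fun k => r k (y k)) i (r i a) := fun a => by
      funext k
      by_cases hk : k = i
      · subst hk; simp
      · simp [hk]
    rw [h4 a, h4 b, ← MultilinearMap.map_update_add]
    refine multilinear_congr Φ (fun i => Finsupp.linearCombination K (σ i)) h2 fun k => ?_
    by_cases hk : k = i
    · subst hk; simp [hr]
    · simp [hk]
  · have h4 : ∀ a, (fun k => r k (Function.update y i a k)) =
        Function.update (fun k => r k (y k)) i (r i a) := fun a => by
      funext k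
      by_cases hk : k = i
      · subst hk; simp
      · simp [hk]
    rw [h4 a, ← MultilinearMap.map_update_smul]
    refine multilinear_congr Φ (fun i => Finsupp.linearCombination K (σ i)) h2 fun k => ?_
    by_cases hk : k = i
    · subst hk; simp [hr]
    · simp [hk]
  · rw [← hΦ]
    refine multilinear_congr Φ (fun i => Finsupp.linearCombination K (σ i)) h2 fun k => ?_
    simp [hr]

end MultilinearExtension

/-! ### Coherence of the factorization products -/

namespace GAQFT

open GMod

variable {K : Type u} [CommRing K] {C : Type w} [Category.{v} C] [Orthogonality C]
  {G : Type u} [Group G] (𝔄 : GAQFT.{u, v, w} K C G)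

section

open scoped Classical

variable {ι : Type} {a : ι → C} {t : C} (f : Op a t)

theorem map_commute : _root_.Pairwise fun i j => ∀ (x : 𝔄.alg (a i)) (y : 𝔄.alg (a j)),
    Commute ((𝔄.map (f.hom i) : 𝔄.alg (a i) →* 𝔄.alg t) x)
      ((𝔄.map (f.hom j) : 𝔄.alg (a j) →* 𝔄.alg t) y) :=
  fun i j h x y => 𝔄.commute _ _ (f.orth i j h) x y

theorem uncurry_update {κ : ι → Type} {x : ∀ i, κ i → Type u} (v : ∀ i j, x i j) (i : ι)
    (v' : ∀ j, x i j) (j : κ i) (p : x i j) :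
    (fun s : (Σ i, κ i) => Function.update v i (Function.update v' j p) s.1 s.2) =
      Function.update (fun s : (Σ i, κ i) => Function.update v i v' s.1 s.2) ⟨i, j⟩ p := by
  funext ⟨i', j'⟩
  by_cases hi : i' = i
  · subst hi
    by_cases hj : j' = j
    · subst hj; simp
    · simp [hj]
  · have : (⟨i', j'⟩ : Σ i, κ i) ≠ ⟨i, j⟩ := fun h => hi (congrArg Sigma.fst h)
    simp [hi, this]

variable [Finite ι]

/-- The multiplication `(aᵢ)ᵢ ↦ ∏ᵢ fᵢ(aᵢ)` of elements along mutually orthogonal morphisms. -/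
def mulAlong : (∀ i, 𝔄.alg (a i)) →* 𝔄.alg t :=
  let _ := Fintype.ofFinite ι
  MonoidHom.noncommPiCoprod (fun i => ((𝔄.map (f.hom i) : 𝔄.alg (a i) →* 𝔄.alg t)))
    (𝔄.map_commute f)

theorem mulAlong_mulSingle (i : ι) (x : 𝔄.alg (a i)) :
    𝔄.mulAlong f (Pi.mulSingle i x) = 𝔄.map (f.hom i) x :=
  let _ := Fintype.ofFinite ι
  MonoidHom.noncommPiCoprod_mulSingle (hcomm := 𝔄.map_commute f) (ι := ι) (i := i) (y := x)

theorem mulAlong_update (b : ∀ i, 𝔄.alg (a i)) (i : ι) (x : 𝔄.alg (a i)) :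
    𝔄.mulAlong f (Function.update b i x) =
      𝔄.map (f.hom i) x * 𝔄.mulAlong f (Function.update b i 1) := by
  rw [← mulAlong_mulSingle, ← map_mul]
  congr 1
  funext k
  by_cases hk : k = i
  · subst hk; simp
  · simp [hk]

theorem mulAlong_update_mul (b : ∀ i, 𝔄.alg (a i)) (i : ι) (x : 𝔄.alg (a i)) :
    𝔄.mulAlong f (Function.update b i (b i * x)) = 𝔄.mulAlong f b * 𝔄.map (f.hom i) x := by
  rw [← mulAlong_mulSingle, ← map_mul]
  congr 1
  funext k
  by_cases hk : k = i
  · subst hk; simp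
  · simp [hk]

theorem mulAlong_autAct (g : G) (b : ∀ i, 𝔄.alg (a i)) :
    𝔄.mulAlong f (fun i => 𝔄.autAct (a i) g (b i)) = 𝔄.autAct t g (𝔄.mulAlong f b) := by
  let _ := Fintype.ofFinite ι
  unfold mulAlong
  rw [MonoidHom.noncommPiCoprod_apply, MonoidHom.noncommPiCoprod_apply, Finset.map_noncommProd]
  exact Finset.noncommProd_congr rfl (fun i _ => 𝔄.map_autAct _ _ _) _

variable {𝔄 f}

theorem relTmul_act_all (V : ∀ i, GMod (𝔄.autAct (a i))) (v : ∀ i, V i) (b : ∀ i, 𝔄.alg (a i)) :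
    𝔄.relTmul f V (fun i => (V i).act (v i) (b i)) =
      (𝔄.relProd f V).act (𝔄.relTmul f V v) (𝔄.mulAlong f b) := by
  have := Fintype.ofFinite ι
  have key : ∀ T : Finset ι, 𝔄.relTmul f V (T.piecewise (fun i => (V i).act (v i) (b i)) v) =
      (𝔄.relProd f V).act (𝔄.relTmul f V v) (𝔄.mulAlong f (T.piecewise b 1)) := by
    intro T
    induction T using Finset.induction_on with
    | empty => simp [act_one]
    | insert j T hj ih =>
      have h1 : (insert j T).piecewise (fun i => (V i).act (v i) (b i)) v =
          Function.update (T.piecewise (fun i => (V i).act (v i) (b i)) v) j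
            ((V j).act (T.piecewise (fun i => (V i).act (v i) (b i)) v j) (b j)) := by
        rw [Finset.piecewise_insert, Finset.piecewise_eq_of_notMem _ _ _ hj]
      have h2 : (insert j T).piecewise b 1 =
          T.piecewise b 1 * (Pi.mulSingle j (b j) : ∀ i, 𝔄.alg (a i)) := by
        funext k
        by_cases hk : k = j
        · subst hk; simp [hj]
        · simp [hk, Finset.piecewise]
      rw [h1, relTmul_act, ih, h2, map_mul, act_mul, mulAlong_mulSingle]
  simpa using key Finset.univ

variable {κ : ι → Type} {b : ∀ i, κ i → C} {g : ∀ i, Op (b i) (a i)}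
  {x : ∀ i j, GMod (𝔄.autAct (b i j))}

theorem relComp_exists {Q : GMod (𝔄.autAct t)}
    (φ : MultilinearMap K (fun s : (Σ i, κ i) => (x s.1 s.2 : Type u)) Q)
    (h1 : ∀ (_ : DecidableEq (Σ i, κ i)) v (s : Σ i, κ i) c,
      φ (Function.update v s ((x s.1 s.2).act (v s) c)) =
        Q.act (φ v) (𝔄.map ((f.comp g).hom s) c))
    (h2 : ∀ γ v, Q.ρ γ (φ v) = φ (fun s => (x s.1 s.2).ρ γ (v s))) :
    ∃ ψ : 𝔄.relProd f (fun i => 𝔄.relProd (g i) (x i)) ⟶ Q, ∀ v : ∀ i j, x i j,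
      lin ψ (𝔄.relTmul f _ (fun i => 𝔄.relTmul (g i) (x i) (v i))) = φ (fun s => v s.1 s.2) := by
  let σ : ∀ i, ((∀ j, x i j) × 𝔄.alg (a i)) → 𝔄.relProd (g i) (x i) := fun i s =>
    (𝔄.relProd (g i) (x i)).act (𝔄.relTmul (g i) (x i) s.1) s.2
  have hσ : ∀ i, Submodule.span K (Set.range (σ i)) = ⊤ := fun i =>
    relProd_span fun v b => Submodule.subset_span ⟨(v, b), rfl⟩
  obtain ⟨Ψ, hΨ⟩ := exists_multilinear_extension (K := K) σ hσ
    (fun s => Q.act (φ fun r : (Σ i, κ i) => (s r.1).1 r.2) (𝔄.mulAlong f fun i => (s i).2)) (by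
      intro i s
      let row : MultilinearMap K (fun j => (x i j : Type u)) Q := MultilinearMap.mk'
        (fun v' => φ fun r : (Σ i, κ i) => Function.update (fun k => (s k).1) i v' r.1 r.2)
        (fun v' j p q => by simp only [uncurry_update, MultilinearMap.map_update_add])
        (fun v' j r p => by simp only [uncurry_update, MultilinearMap.map_update_smul])
      let m := 𝔄.mulAlong f (Function.update (fun k => (s k).2) i 1)
      have hrow : ∀ v' j c, row (Function.update v' j ((x i j).act (v' j) c)) =
          Q.act (row v') (𝔄.map (f.hom i) (𝔄.map ((g i).hom j) c)) := by
        intro v' j c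
        have h3 := h1 inferInstance (fun r : (Σ i, κ i) => Function.update (fun k => (s k).1) i v' r.1 r.2)
          ⟨i, j⟩ c
        simp only [Function.update_self] at h3
        rw [← uncurry_update] at h3
        refine h3.trans ?_
        exact congrArg (Q.act (row v')) (𝔄.map_comp _ _ _)
      let N := (LinearMap.lcomp K Q (LinearMap.mulRight K m ∘ₗ
        (𝔄.map (f.hom i)).toLinearMap) ∘ₗ Q.act).compMultilinearMap row
      have hN : ∀ v' c, N v' c = Q.act (row v') (𝔄.map (f.hom i) c * m) := fun v' c => rfl
      have hN' : ∀ v' j c c', N (Function.update v' j ((x i j).act (v' j) c)) c' =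
          N v' (𝔄.map ((g i).hom j) c * c') := by
        intro v' j c c'
        rw [hN, hN, hrow, ← act_mul, ← mul_assoc, ← _root_.map_mul]
      refine ⟨𝔄.relLift (g i) (x i) N hN', fun p => ?_⟩
      · have h4 : (fun k => (Function.update s i p k).1) =
            Function.update (fun k => (s k).1) i p.1 := by
          funext k
          by_cases hk : k = i
          · subst hk; simp
          · simp [hk]
        have h5 : (fun k => (Function.update s i p k).2) =
            Function.update (fun k => (s k).2) i p.2 := by
          funext k
          by_cases hk : k = i
          · subst hk; simp
          · simp [hk]
        rw [h5, mulAlong_update]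
        refine (congrArg _ (𝔄.relMk_eq (g i) (x i) p.1 p.2).symm).trans ?_
        refine (relLift_relMk N hN' p.1 p.2).trans ?_
        have h6 : (fun r : (Σ i, κ i) => (Function.update s i p r.1).1 r.2) =
            fun r : (Σ i, κ i) => Function.update (fun k => (s k).1) i p.1 r.1 r.2 :=
          funext fun r => congrFun (congrFun h4 r.1) r.2
        rw [h6]
        rfl)
  have hΨ1 : ∀ i c y, Ψ (Function.update y i ((𝔄.relProd (g i) (x i)).act (y i) c)) =
      Q.act (Ψ y) (𝔄.map (f.hom i) c) := by
    intro i c y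
    let M : MultilinearMap K (fun i => (𝔄.relProd (g i) (x i) : Type u)) Q :=
      Ψ.compLinearMap (Function.update (fun k => LinearMap.id) i
        ((𝔄.relProd (g i) (x i)).act.flip c))
    have hM : ∀ y, M y = Ψ (Function.update y i ((𝔄.relProd (g i) (x i)).act (y i) c)) := by
      intro y
      refine congrArg Ψ (funext fun k => ?_)
      by_cases hk : k = i
      · subst hk; simp
      · simp [hk]
    have h3 : M = (Q.act.flip (𝔄.map (f.hom i) c)).compMultilinearMap Ψ :=
      MultilinearMap.ext_of_span_eq_top (g := σ) hσ fun s => by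
        rw [hM, LinearMap.compMultilinearMap_apply, hΨ]
        have h4 : Function.update (fun i => σ i (s i)) i ((𝔄.relProd (g i) (x i)).act
            (σ i (s i)) c) = fun k => σ k (Function.update s i ((s i).1, (s i).2 * c) k) := by
          funext k
          by_cases hk : k = i
          · subst hk; simp [σ, act_mul]
          · simp [hk]
        have h5 : (fun k => (Function.update s i ((s i).1, (s i).2 * c) k).1) =
            fun k => (s k).1 := by
          funext k
          by_cases hk : k = i
          · subst hk; simp
          · simp [hk]
        have h6 : (fun k => (Function.update s i ((s i).1, (s i).2 * c) k).2) =
            Function.update (fun k => (s k).2) i ((s i).2 * c) := by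
          funext k
          by_cases hk : k = i
          · subst hk; simp
          · simp [hk]
        have h7 : (fun r : (Σ i, κ i) => (Function.update s i ((s i).1, (s i).2 * c) r.1).1 r.2) =
            fun r : (Σ i, κ i) => (s r.1).1 r.2 := funext fun r => congrFun (congrFun h5 r.1) r.2
        rw [h4, hΨ, h6, h7, LinearMap.flip_apply, ← act_mul, ← mulAlong_update_mul]
    rw [← hM, h3]
    rfl
  have hΨ2 : ∀ γ y, Q.ρ γ (Ψ y) = Ψ (fun i => (𝔄.relProd (g i) (x i)).ρ γ (y i)) := by
    intro γ y
    have h3 : (Q.ρ γ).compMultilinearMap Ψ =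
        Ψ.compLinearMap (fun i => (𝔄.relProd (g i) (x i)).ρ γ) :=
      MultilinearMap.ext_of_span_eq_top (g := σ) hσ fun s => by
        have h4 : (fun i => (𝔄.relProd (g i) (x i)).ρ γ (σ i (s i))) = fun i => σ i
            ((fun j => (x i j).ρ γ ((s i).1 j)), 𝔄.autAct (a i) γ (s i).2) := by
          funext i
          simp only [σ, ρ_act, relTmul_ρ]
        rw [LinearMap.compMultilinearMap_apply, MultilinearMap.compLinearMap_apply, h4, hΨ, hΨ,
          ρ_act, h2, mulAlong_autAct]
    exact congrArg (fun z => z y) h3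
  refine ⟨relDesc Ψ (fun y i c => hΨ1 i c y) hΨ2, fun v => ?_⟩
  refine (relDesc_relTmul Ψ (fun y i c => hΨ1 i c y) hΨ2 _).trans ?_
  have h3 := hΨ (fun i => (v i, 1))
  simp only [σ, act_one] at h3
  rw [h3]
  refine (congrArg _ (map_one (𝔄.mulAlong f))).trans (Q.act_one _)

end

end GAQFT

namespace GAQFT

open GMod

variable {K : Type u} [CommRing K] {C : Type w} [Category.{v} C] [Orthogonality C]
  {G : Type u} [Group G] {𝔄 : GAQFT.{u, v, w} K C G}

section

open scoped Classical

section

variable {ι : Type} [Finite ι] {a : ι → C} {t : C} (f : Op a t) {κ : ι → Type}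
  {b : ∀ i, κ i → C} (g : ∀ i, Op (b i) (a i)) (x : ∀ i j, GMod (𝔄.autAct (b i j)))

variable {f g x} in
/-- Morphisms out of an iterated factorization product are determined by their values on iterated
pure tensors. -/
theorem relProd_ext₂ {Q : GMod (𝔄.autAct t)}
    {φ ψ : 𝔄.relProd f (fun i => 𝔄.relProd (g i) (x i)) ⟶ Q}
    (h : ∀ v : ∀ i j, x i j, lin φ (𝔄.relTmul f _ fun i => 𝔄.relTmul (g i) (x i) (v i)) =
      lin ψ (𝔄.relTmul f _ fun i => 𝔄.relTmul (g i) (x i) (v i))) : φ = ψ := by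
  have h1 : (lin φ).compMultilinearMap (𝔄.relTmul f _) =
      (lin ψ).compMultilinearMap (𝔄.relTmul f _) :=
    MultilinearMap.ext_of_span_eq_top
      (g := fun i (s : (∀ j, x i j) × 𝔄.alg (a i)) =>
        (𝔄.relProd (g i) (x i)).act (𝔄.relTmul (g i) (x i) s.1) s.2)
      (fun i => relProd_span fun v b => Submodule.subset_span ⟨(v, b), rfl⟩) fun s => by
        rw [LinearMap.compMultilinearMap_apply, LinearMap.compMultilinearMap_apply,
          relTmul_act_all _ (fun i => 𝔄.relTmul (g i) (x i) (s i).1), lin_act, lin_act, h]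
  exact relProd_ext fun y => congrArg (fun z => z y) h1

/-- The comparison map from the product along a composite to the iterated product. -/
def compInv : 𝔄.relProd (f.comp g) (fun s => x s.1 s.2) ⟶
    𝔄.relProd f (fun i => 𝔄.relProd (g i) (x i)) :=
  relDesc ((𝔄.relTmul f _).compMultilinearMap fun i => 𝔄.relTmul (g i) (x i))
    (fun v s c => by
      obtain ⟨i, j⟩ := s
      refine Eq.trans (congrArg (𝔄.relTmul f _) (funext fun k => ?_)) ((𝔄.relTmul_act f _ (fun k =>
        𝔄.relTmul (g k) (x k) fun l => v ⟨k, l⟩) i (𝔄.map ((g i).hom j) c)).trans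
        (congrArg _ (𝔄.map_comp _ _ _).symm))
      by_cases hk : k = i
      · subst hk
        rw [Function.update_self, ← relTmul_act]
        refine congrArg (𝔄.relTmul (g k) (x k)) (funext fun l => ?_)
        by_cases hl : l = j
        · subst hl; simp [Sigma.curry]
        · simp [hl, Sigma.curry]
      · have h2 : ∀ l, (⟨k, l⟩ : Σ i, κ i) ≠ ⟨i, j⟩ := fun l h => hk (congrArg Sigma.fst h)
        rw [Function.update_of_ne hk]
        refine congrArg (𝔄.relTmul (g k) (x k)) (funext fun l => ?_)
        simp [h2, Sigma.curry])
    (fun γ v => (𝔄.relTmul_ρ f _ γ _).trans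
      (congrArg (𝔄.relTmul f _) (funext fun i => 𝔄.relTmul_ρ (g i) (x i) γ _)))

theorem compInv_apply (v : ∀ s : (Σ i, κ i), x s.1 s.2) :
    lin (compInv f g x) (𝔄.relTmul (f.comp g) (fun s => x s.1 s.2) v) =
      𝔄.relTmul f _ fun i => 𝔄.relTmul (g i) (x i) fun j => v ⟨i, j⟩ := by
  unfold compInv
  exact relDesc_relTmul _ _ _ _

theorem compHom_exists : ∃ ψ : 𝔄.relProd f (fun i => 𝔄.relProd (g i) (x i)) ⟶
    𝔄.relProd (f.comp g) (fun s => x s.1 s.2), ∀ v : ∀ i j, x i j,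
      lin ψ (𝔄.relTmul f _ (fun i => 𝔄.relTmul (g i) (x i) (v i))) =
        𝔄.relTmul (f.comp g) (fun s => x s.1 s.2) (fun s => v s.1 s.2) :=
  relComp_exists (𝔄.relTmul (f.comp g) (fun s => x s.1 s.2))
    (fun inst v s c => by
      obtain rfl : inst = fun _ _ => Classical.propDecidable _ := Subsingleton.elim _ _
      exact 𝔄.relTmul_act _ _ _ _ _)
    (𝔄.relTmul_ρ _ _)

/-- The coherence isomorphism for compositions. -/
def compIso : 𝔄.relProd f (fun i => 𝔄.relProd (g i) (x i)) ≅
    𝔄.relProd (f.comp g) (fun s => x s.1 s.2) where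
  hom := (compHom_exists f g x).choose
  inv := compInv f g x
  hom_inv_id := relProd_ext₂ fun v => by
    rw [lin_comp, LinearMap.comp_apply, (compHom_exists f g x).choose_spec, compInv_apply]
    rfl
  inv_hom_id := relProd_ext fun v => by
    rw [lin_comp, LinearMap.comp_apply, compInv_apply,
      (compHom_exists f g x).choose_spec (fun i j => v ⟨i, j⟩)]
    rfl

theorem compIso_hom (v : ∀ i j, x i j) :
    lin (compIso f g x).hom (𝔄.relTmul f _ (fun i => 𝔄.relTmul (g i) (x i) (v i))) =
      𝔄.relTmul (f.comp g) (fun s => x s.1 s.2) (fun s => v s.1 s.2) :=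
  (compHom_exists f g x).choose_spec v

end

section

variable (t : C) (x : GMod (𝔄.autAct t))

/-- The unit map. -/
def unitLin : x →ₗ[K] 𝔄.relProd (Op.id t) (fun _ => x) :=
  (𝔄.relTmul (Op.id t) (fun _ => x)).toLinearMap 0 ()

theorem unitLin_apply (v : x) :
    unitLin t x v = 𝔄.relTmul (Op.id t) (fun _ => x) (fun _ => v) :=
  congrArg (𝔄.relTmul (Op.id t) (fun _ => x)) (by funext; simp)

/-- The comparison map for identities. -/
def unitHom : x ⟶ 𝔄.relProd (Op.id t) (fun _ => x) :=
  mk' (unitLin t x)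
    (fun v c => by
      rw [unitLin_apply, unitLin_apply]
      refine Eq.trans (congrArg (𝔄.relTmul (Op.id t) (fun _ => x)) ?_)
        ((𝔄.relTmul_act (Op.id t) (fun _ => x) (fun _ => v) () c).trans (congrArg _ ?_))
      · funext; simp
      · exact congrArg (fun z => z c) (𝔄.map_id t))
    (fun γ v => by
      rw [unitLin_apply, unitLin_apply]
      exact (𝔄.relTmul_ρ (Op.id t) (fun _ => x) γ _).symm)

/-- The inverse of the comparison map. -/
def unitInv : 𝔄.relProd (Op.id t) (fun _ => x) ⟶ x :=
  relDesc (MultilinearMap.mk' (fun v => v ()) (fun v i a b => by simp)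
      (fun v i r a => by simp))
    (fun v i c => by
      have h := congrArg (fun z => z c) (𝔄.map_id t)
      refine Eq.trans ?_ (congrArg (x.act (v ())) h.symm)
      change Function.update v () _ () = _
      simp)
    (fun γ v => rfl)

theorem unitInv_apply (v : Unit → x) :
    lin (unitInv t x) (𝔄.relTmul (Op.id t) (fun _ => x) v) = v () := by
  unfold unitInv
  exact relDesc_relTmul _ _ _ _

/-- The coherence isomorphism for identities. -/
def unitIso : x ≅ 𝔄.relProd (Op.id t) (fun _ => x) where
  hom := unitHom t x
  inv := unitInv t x
  hom_inv_id := hom_ext fun v =>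
    (congrArg (lin (unitInv t x)) (unitLin_apply t x v)).trans (unitInv_apply t x _)
  inv_hom_id := relProd_ext fun v =>
    (congrArg (unitLin t x) (unitInv_apply t x v)).trans (unitLin_apply t x _)

theorem unitIso_hom (v : x) :
    lin (unitIso t x).hom v = 𝔄.relTmul (Op.id t) (fun _ => x) (fun _ => v) :=
  unitLin_apply t x v

end

section

variable {ι ι' : Type} {c : ι → C} {t : C}
    (p : ι' → ι) (hp : p.Bijective) (f : Op c t) (f' : Op (fun i' => c (p i')) t)
    (h : ∀ i', f'.hom i' = f.hom (p i')) (x : ∀ i, GMod (𝔄.autAct (c i)))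

theorem update_reindex {X : ι → Type u} (v : ∀ i, X i) (i' : ι') (z : X (p i')) (hp : p.Bijective) :
    (fun k => Function.update v (p i') z (p k)) = Function.update (fun k => v (p k)) i' z :=
  Function.update_comp_eq_of_injective' v hp.1 i' z

/-- The inverse of reindexing along a bijection. -/
def unreindex {X : ι → Type u} (hp : p.Bijective) (v : ∀ i', X (p i')) (i : ι) : X i :=
  (hp.2 i).choose_spec ▸ v (hp.2 i).choose

theorem unreindex_apply {X : ι → Type u} (hp : p.Bijective) (v : ∀ i', X (p i')) (k : ι') :
    unreindex p hp v (p k) = v k := by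
  have h1 : ∀ j (e : p j = p k), (e ▸ v j : X (p k)) = v k := by
    intro j e
    obtain rfl := hp.1 e
    rfl
  exact h1 _ _

theorem unreindex_update {X : ι → Type u} (hp : p.Bijective) (v : ∀ i', X (p i')) (i' : ι')
    (z : X (p i')) : unreindex p hp (Function.update v i' z) =
      Function.update (unreindex p hp v) (p i') z := by
  funext i
  obtain ⟨k, rfl⟩ := hp.2 i
  rw [unreindex_apply]
  by_cases hk : k = i'
  · subst hk; simp
  · rw [Function.update_of_ne hk, Function.update_of_ne (fun e => hk (hp.1 e)), unreindex_apply]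

/-- The comparison map of products for a permutation of the inputs. -/
def permHom : 𝔄.relProd f x ⟶ 𝔄.relProd f' (fun i' => x (p i')) :=
  relDesc (MultilinearMap.mk' (fun v => 𝔄.relTmul f' (fun i' => x (p i')) fun i' => v (p i'))
      (fun v i y z => by
        obtain ⟨i', rfl⟩ := hp.2 i
        simp only [update_reindex p _ _ _ hp, MultilinearMap.map_update_add])
      (fun v i r z => by
        obtain ⟨i', rfl⟩ := hp.2 i
        simp only [update_reindex p _ _ _ hp, MultilinearMap.map_update_smul]))
    (fun v i c => by
      obtain ⟨i', rfl⟩ := hp.2 i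
      refine (congrArg (𝔄.relTmul f' _) (update_reindex p v i' _ hp)).trans ?_
      refine (𝔄.relTmul_act f' (fun i' => x (p i')) (fun i' => v (p i')) i' c).trans ?_
      rw [h]
      rfl)
    (fun γ v => 𝔄.relTmul_ρ f' _ γ _)

theorem permHom_apply (v : ∀ i, x i) : lin (permHom p hp f f' h x) (𝔄.relTmul f x v) =
    𝔄.relTmul f' (fun i' => x (p i')) fun i' => v (p i') := by
  unfold permHom
  exact relDesc_relTmul _ _ _ _

/-- The inverse of the comparison map. -/
def permInv : 𝔄.relProd f' (fun i' => x (p i')) ⟶ 𝔄.relProd f x :=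
  relDesc (MultilinearMap.mk'
      (fun v => 𝔄.relTmul f x (unreindex (X := fun i => (x i : Type u)) p hp v))
      (fun v i y z => by
        simp only [unreindex_update (X := fun i => (x i : Type u)), MultilinearMap.map_update_add])
      (fun v i r z => by
        simp only [unreindex_update (X := fun i => (x i : Type u)), MultilinearMap.map_update_smul]))
    (fun v i' c => by
      have h2 := 𝔄.relTmul_act f x (unreindex (X := fun i => (x i : Type u)) p hp v) (p i') c
      rw [unreindex_apply (X := fun i => (x i : Type u)), ← h i'] at h2
      exact (congrArg (𝔄.relTmul f x)
        (unreindex_update (X := fun i => (x i : Type u)) p hp v i' _)).trans h2)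
    (fun γ v => by
      refine (𝔄.relTmul_ρ f x γ _).trans (congrArg (𝔄.relTmul f x) ?_)
      funext i
      obtain ⟨k, rfl⟩ := hp.2 i
      rw [unreindex_apply (X := fun i => (x i : Type u)),
        unreindex_apply (X := fun i => (x i : Type u))])

theorem permInv_apply (v : ∀ i', x (p i')) :
    lin (permInv p hp f f' h x) (𝔄.relTmul f' (fun i' => x (p i')) v) = 𝔄.relTmul f x
      (unreindex (X := fun i => (x i : Type u)) p hp v) := by
  unfold permInv
  exact relDesc_relTmul _ _ _ _

/-- The coherence isomorphism for permutations. -/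
def permIso : 𝔄.relProd f x ≅ 𝔄.relProd f' (fun i' => x (p i')) where
  hom := permHom p hp f f' h x
  inv := permInv p hp f f' h x
  hom_inv_id := relProd_ext fun v => by
    rw [lin_comp, LinearMap.comp_apply, permHom_apply, permInv_apply, lin_id, LinearMap.id_apply]
    refine congrArg (𝔄.relTmul f x) (funext fun i => ?_)
    obtain ⟨k, rfl⟩ := hp.2 i
    exact unreindex_apply (X := fun i => (x i : Type u)) p hp _ k
  inv_hom_id := relProd_ext fun v => by
    rw [lin_comp, LinearMap.comp_apply, permInv_apply, permHom_apply, lin_id, LinearMap.id_apply]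
    exact congrArg (𝔄.relTmul f' fun i' => x (p i'))
      (funext fun k => unreindex_apply (X := fun i => (x i : Type u)) p hp v k)

theorem permIso_hom (v : ∀ i, x i) : lin (permIso p hp f f' h x).hom (𝔄.relTmul f x v) =
    𝔄.relTmul f' (fun i' => x (p i')) fun i' => v (p i') := permHom_apply p hp f f' h x v

end

end

end GAQFT

namespace GAQFT

open GMod

variable {K : Type u} [CommRing K] {C : Type w} [Category.{v} C] [Orthogonality C]
  {G : Type u} [Group G] {𝔄 : GAQFT.{u, v, w} K C G}

theorem chain_aux {A : Type u} [Ring A] [Algebra K A] {α : G →* (A →ₐ[K] A)}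
    {X₀ X₁ X₂ X₃ X₄ : GMod α} {s : X₀ ⟶ X₁} {p : X₁ ⟶ X₂} {q : X₂ ⟶ X₃} {r : X₃ ⟶ X₄}
    {t : X₀ ⟶ X₄} {e₀ : X₀} {e₁ : X₁} {e₂ : X₂} {e₃ : X₃} {e₄ : X₄} (h₁ : lin s e₀ = e₁)
    (h₂ : lin p e₁ = e₂) (h₃ : lin q e₂ = e₃) (h₄ : lin r e₃ = e₄) (h₅ : lin t e₀ = e₄) :
    lin (s ≫ p ≫ q ≫ r) e₀ = lin t e₀ := by
  simp only [lin_comp, LinearMap.comp_apply, h₁, h₂, h₃, h₄, h₅]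

theorem comp_assoc {ι : Type} [Finite ι] {κ : ι → Type} [∀ i, Finite (κ i)]
    {μ : ∀ i, κ i → Type} {a : ι → C} {b : ∀ i, κ i → C}
    {d : ∀ i j, μ i j → C} {t : C} (f : Op a t) (g : ∀ i, Op (b i) (a i))
    (h : ∀ i j, Op (d i j) (b i j)) (x : ∀ i j l, GMod (𝔄.autAct (d i j l))) :
    relMap (fun i => (compIso (g i) (h i) (x i)).hom) ≫
      (compIso f (fun i => (g i).comp (h i)) (fun i s => x i s.1 s.2)).hom ≫
      (permIso _ (bij_assoc κ μ) (f.comp fun i => (g i).comp (h i))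
        ((f.comp g).comp fun s => h s.1 s.2) (fun _ => (Category.assoc _ _ _).symm)
          (fun s => x s.1 s.2.1 s.2.2)).hom =
    (compIso f g (fun i j => 𝔄.relProd (h i j) (x i j))).hom ≫
      (compIso (f.comp g) (fun s => h s.1 s.2) (fun s l => x s.1 s.2 l)).hom := by
  rw [← Iso.inv_comp_eq]
  refine relProd_ext₂ fun v => ?_
  refine chain_aux
    (compInv_apply f g (fun i j => 𝔄.relProd (h i j) (x i j)) fun s =>
      𝔄.relTmul (h s.1 s.2) (x s.1 s.2) (v s))
    ((relMap_relTmul (fun i => (compIso (g i) (h i) (x i)).hom) _).trans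
      (congrArg (𝔄.relTmul f fun i => 𝔄.relProd ((g i).comp (h i)) fun s => x i s.1 s.2)
        (funext fun i => compIso_hom (g i) (h i) (x i) fun j l => v ⟨i, j⟩ l)))
    (compIso_hom f (fun i => (g i).comp (h i)) (fun i s => x i s.1 s.2)
      fun i s => v ⟨i, s.1⟩ s.2)
    (permIso_hom _ _ _ _ _ (fun s : (Σ i, Σ j, μ i j) => x s.1 s.2.1 s.2.2) _)
    (compIso_hom (f.comp g) (fun s => h s.1 s.2) (fun s l => x s.1 s.2 l) v)

theorem comp_naturality {ι : Type} [Finite ι] {κ : ι → Type} {a : ι → C} {b : ∀ i, κ i → C} {t : C}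
    (f : Op a t) (g : ∀ i, Op (b i) (a i)) {x y : ∀ i j, GMod (𝔄.autAct (b i j))}
    (φ : ∀ i j, x i j ⟶ y i j) :
    relMap (fun i => relMap (φ i)) ≫ (compIso f g y).hom =
      (compIso f g x).hom ≫ relMap (f := f.comp g) (fun s => φ s.1 s.2) := by
  refine relProd_ext₂ fun v => ?_
  simp only [lin_comp, LinearMap.comp_apply]
  rw [relMap_relTmul, compIso_hom, relMap_relTmul]
  simp only [relMap_relTmul]
  exact compIso_hom f g y _

theorem comp_unit_left {ι : Type} {c : ι → C} {t : C} (f : Op c t)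
    (x : ∀ i, GMod (𝔄.autAct (c i))) :
    (unitIso t (𝔄.relProd f x)).hom ≫ (compIso (Op.id t) (fun _ => f) (fun _ => x)).hom =
      (permIso _ (bij_snd ι) f ((Op.id t).comp fun _ => f) (fun _ => Category.comp_id _) x).hom := by
  refine relProd_ext fun v => ?_
  simp only [lin_comp, LinearMap.comp_apply]
  rw [unitIso_hom, compIso_hom (Op.id t) (fun _ => f) (fun _ => x) (fun _ => v)]
  exact (permIso_hom _ (bij_snd ι) _ _ _ _ _).symm

theorem comp_unit_right {ι : Type} [Finite ι] {c : ι → C} {t : C} (f : Op c t)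
    (x : ∀ i, GMod (𝔄.autAct (c i))) :
    relMap (fun i => (unitIso (c i) (x i)).hom) ≫
        (compIso f (fun i => Op.id (c i)) (fun i _ => x i)).hom =
      (permIso _ (bij_fst ι) f (f.comp fun i => Op.id (c i)) (fun _ => Category.id_comp _) x).hom := by
  refine relProd_ext fun v => ?_
  simp only [lin_comp, LinearMap.comp_apply]
  rw [relMap_relTmul]
  simp only [unitIso_hom]
  rw [compIso_hom f (fun i => Op.id (c i)) (fun i _ => x i) (fun i _ => v i)]
  exact (permIso_hom _ (bij_fst ι) _ _ _ _ _).symm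

theorem comp_equivariance_outer {ι ι' : Type} [Finite ι] [Finite ι'] {κ : ι → Type}
    {a : ι → C} {b : ∀ i, κ i → C} {t : C} (f : Op a t)
    (g : ∀ i, Op (b i) (a i)) (p : ι' → ι) (hp : p.Bijective) (f' : Op (fun i' => a (p i')) t)
    (h : ∀ i', f'.hom i' = f.hom (p i')) (x : ∀ i j, GMod (𝔄.autAct (b i j))) :
    (compIso f g x).hom ≫ (permIso _ (bij_outer κ hp) (f.comp g) (f'.comp fun i' => g (p i'))
        (fun s => congrArg ((g (p s.1)).hom s.2 ≫ ·) (h s.1)) (fun s => x s.1 s.2)).hom =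
      (permIso p hp f f' h (fun i => 𝔄.relProd (g i) (x i))).hom ≫
        (compIso f' (fun i' => g (p i')) (fun i' => x (p i'))).hom := by
  refine relProd_ext₂ fun v => ?_
  simp only [lin_comp, LinearMap.comp_apply]
  rw [compIso_hom, permIso_hom,
    compIso_hom f' (fun i' => g (p i')) (fun i' => x (p i')) (fun i' => v (p i'))]
  exact permIso_hom _ (bij_outer κ hp) _ _ _ _ _

theorem comp_equivariance_inner {ι : Type} [Finite ι] {κ κ' : ι → Type}
    {a : ι → C} {b : ∀ i, κ i → C} {t : C} (f : Op a t)
    (g : ∀ i, Op (b i) (a i)) (p : ∀ i, κ' i → κ i) (hp : ∀ i, (p i).Bijective)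
    (g' : ∀ i, Op (fun j' => b i (p i j')) (a i))
    (h : ∀ i j', (g' i).hom j' = (g i).hom (p i j')) (x : ∀ i j, GMod (𝔄.autAct (b i j))) :
    (compIso f g x).hom ≫ (permIso _ (bij_inner hp) (f.comp g) (f.comp g')
        (fun s => congrArg (· ≫ f.hom s.1) (h s.1 s.2)) (fun s => x s.1 s.2)).hom =
      relMap (fun i => (permIso (p i) (hp i) (g i) (g' i) (h i) (x i)).hom) ≫
        (compIso f g' (fun i j' => x i (p i j'))).hom := by
  refine relProd_ext₂ fun v => ?_
  simp only [lin_comp, LinearMap.comp_apply]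
  rw [compIso_hom, relMap_relTmul]
  simp only [permIso_hom]
  rw [compIso_hom f g' (fun i j' => x i (p i j')) (fun i j' => v i (p i j'))]
  exact permIso_hom _ (bij_inner hp) _ _ _ _ _

variable (𝔄) in
/-- The categorified orbifold theory of an equivariant AQFT: it assigns the categories of
equivariant modules. -/
def gauging : TwoAQFT.{u, v, w} K C where
  cat := 𝔄.gmodCat
  prod f := 𝔄.relFunctor f
  prod_lin f := relFunctor_lin f
  comp f g x := compIso f g x
  comp_nat f g x y φ := comp_naturality f g φ
  unit t x := unitIso t x
  unit_nat t x y φ := hom_ext fun v => by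
    refine (unitIso_hom t y _).trans ?_
    exact ((congrArg (lin (relMap fun _ => φ)) (unitIso_hom t x v)).trans
      (relMap_relTmul _ _)).symm
  perm p hp f f' h x := permIso p hp f f' h x
  perm_nat p hp f f' h x y φ := relProd_ext fun v => by
    refine (congrArg (lin (permIso p hp f f' h y).hom) (relMap_relTmul φ v)).trans ?_
    refine (permIso_hom _ _ _ _ _ _ _).trans ?_
    exact ((congrArg (lin (relMap fun i' => φ (p i'))) (permIso_hom p hp f f' h x v)).trans
      (relMap_relTmul _ _)).symm
  assoc f g h x := comp_assoc f g h x
  unit_left f x := comp_unit_left f x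
  unit_right f x := comp_unit_right f x
  perm_comp p hp q hq f f' f'' h h' x := relProd_ext fun v => by
    refine (congrArg (lin (permIso q hq f' f'' h' fun i' => x (p i')).hom)
      (permIso_hom p hp f f' h x v)).trans ?_
    refine (permIso_hom _ _ _ _ _ _ _).trans ?_
    exact (permIso_hom (fun i'' => p (q i'')) _ _ _ _ x v).symm
  perm_id f x := relProd_ext fun v => permIso_hom _ _ _ _ _ x v
  equivariance_outer f g p hp f' h x := comp_equivariance_outer f g p hp f' h x
  equivariance_inner f g p hp g' h x := comp_equivariance_inner f g p hp g' h x

end GAQFT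

/-! ### Inclusion of AQFTs into 2AQFTs and truncatedness -/

namespace GAQFT

variable {K : Type u} [CommRing K] {C : Type w} [Category.{v} C] [Orthogonality C]
  {G : Type u} [Group G] (𝔄 : GAQFT.{u, v, w} K C G)

/-- The endomorphism of the pointing of the gauging (which is the algebra `𝔄 c`, regarded as an
equivariant module over itself) given by left multiplication with an invariant element: it sends
`1` to `a`. -/
def leftMul (c : C) (a : 𝔄.alg c) (ha : ∀ g, 𝔄.autAct c g a = a) : End (𝔄.gauging.pt c) :=
  let V : ∀ e : Empty, GMod (𝔄.autAct (e.elim : C)) := fun e => e.elim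
  let q : 𝔄.relProd (Op.nil c) V :=
    (𝔄.relProd (Op.nil c) V).act (𝔄.relTmul (Op.nil c) V fun e => e.elim) a
  relDesc (f := Op.nil c) (V := V) (Q := 𝔄.relProd (Op.nil c) V)
    (MultilinearMap.constOfIsEmpty K _ q) (fun _ e => e.elim) (fun g v => by
      have h : (fun e : Empty => (V e).ρ g ((fun e => e.elim : ∀ e : Empty, V e) e)) =
        fun e => e.elim := funext fun e => e.elim
      change (𝔄.relProd (Op.nil c) V).ρ g q = q
      simp only [q]
      rw [GMod.ρ_act, relTmul_ρ, ha, h])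

end GAQFT

namespace AQFT

variable {K : Type u} [CommRing K] {C : Type w} [Category.{v} C] [Orthogonality C]

/-- An AQFT, regarded as an equivariant AQFT for the trivial group. -/
def toGAQFT (A : AQFT.{u, v, w} K C) : GAQFT.{u, v, w} K C PUnit.{u + 1} where
  toAQFT := A
  rep := 1

/-- The inclusion of AQFTs into 2AQFTs, assigning to an object the category of right modules over
its algebra (an equivariant module for the trivial group is just a right module) and to an
operation the relative tensor product. -/
def inclusion (A : AQFT.{u, v, w} K C) : TwoAQFT.{u, v, w} K C := A.toGAQFT.gauging

/-- The algebra map `A c → End (pt c)` given by left multiplication. -/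
def leftMul (A : AQFT.{u, v, w} K C) (c : C) (a : A.F.obj c) : End (A.inclusion.pt c) :=
  A.toGAQFT.leftMul c a (fun _ => rfl)

end AQFT

namespace TwoAQFT

variable {K : Type u} [CommRing K] {C : Type w} [Category.{v} C] [Orthogonality C]

/-- A 1-morphism preserves the pointings. -/
def OneHom.ptIso {S T : TwoAQFT.{u, v, w} K C} (η : OneHom S T) (c : C) :
    T.pt c ≅ (η.app c).obj (S.pt c) :=
  (T.prod (Op.nil c)).mapIso (Pi.isoMk fun e => e.elim) ≪≫ η.sq (Op.nil c) (fun e => e.elim)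

/-- A 1-morphism from the inclusion of the truncation of `S` to `S` is the component at `S` of the
counit of the biadjunction between inclusion and truncation if its adjunct, the composite of
`End (S.pt c) → End ((S.truncation.inclusion).pt c)`, `h ↦ (h · -)`, with the map on
endomorphisms of the pointings induced by `ε`, is the identity for every `c`. -/
def IsCounit (S : TwoAQFT.{u, v, w} K C) (ε : OneHom S.truncation.inclusion S) : Prop :=
  ∀ (c : C) (h : End (S.pt c)),
    (ε.ptIso c).hom ≫ (ε.app c).map (S.truncation.leftMul c h) ≫ (ε.ptIso c).inv = h

/-- A 2AQFT is truncated if the counit from the inclusion of its truncation to itself is an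
equivalence. -/
def Truncated (S : TwoAQFT.{u, v, w} K C) : Prop :=
  ∃ ε : OneHom S.truncation.inclusion S, S.IsCounit ε ∧ ε.IsEquiv

end TwoAQFT

/-! ### CCR algebras -/

section CCR

variable (K : Type) [CommRing K] [Algebra ℂ K] (h : K)

/-- The canonical commutation relations `x ⊗ y - y ⊗ x = i h σ(x, y) 1`. -/
inductive CCRRel {E : Type} [AddCommGroup E] [Module ℝ E] (σ : E → E → ℝ) :
    TensorAlgebra K (K ⊗[ℝ] E) → TensorAlgebra K (K ⊗[ℝ] E) → Prop
  | comm (x y : E) : CCRRel σ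
      (TensorAlgebra.ι K ((1 : K) ⊗ₜ[ℝ] x) * TensorAlgebra.ι K ((1 : K) ⊗ₜ[ℝ] y) -
        TensorAlgebra.ι K ((1 : K) ⊗ₜ[ℝ] y) * TensorAlgebra.ι K ((1 : K) ⊗ₜ[ℝ] x))
      (algebraMap K _ (algebraMap ℂ K (Complex.I * σ x y) * h))

/-- The CCR algebra over `K` of a real vector space `E` with a form `σ` and deformation parameter
`h`: the quotient of the tensor algebra of the scalar extension `K ⊗ E` by the two-sided ideal
generated by the canonical commutation relations. -/
abbrev CCR {E : Type} [AddCommGroup E] [Module ℝ E] (σ : E → E → ℝ) : Type :=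
  RingQuot (CCRRel K h σ)

namespace CCR

section

variable {E E' E'' : Type} [AddCommGroup E] [Module ℝ E] [AddCommGroup E'] [Module ℝ E']
  [AddCommGroup E''] [Module ℝ E''] (σ : E → E → ℝ) (σ' : E' → E' → ℝ) (σ'' : E'' → E'' → ℝ)

/-- The inclusion of the generators. -/
def gen : K ⊗[ℝ] E →ₗ[K] CCR K h σ :=
  (RingQuot.mkAlgHom K (CCRRel K h σ)).toLinearMap ∘ₗ TensorAlgebra.ι K

theorem gen_comm (x y : E) :
    gen K h σ ((1 : K) ⊗ₜ[ℝ] x) * gen K h σ ((1 : K) ⊗ₜ[ℝ] y) -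
      gen K h σ ((1 : K) ⊗ₜ[ℝ] y) * gen K h σ ((1 : K) ⊗ₜ[ℝ] x) =
    algebraMap K _ (algebraMap ℂ K (Complex.I * σ x y) * h) := by
  have h1 := RingQuot.mkAlgHom_rel K (CCRRel.comm (h := h) (σ := σ) x y)
  rw [map_sub, map_mul, map_mul, AlgHom.commutes] at h1
  exact h1

variable {K h σ} in
theorem hom_ext {A : Type} [Ring A] [Algebra K A] {f g : CCR K h σ →ₐ[K] A}
    (e : ∀ x : E, f (gen K h σ ((1 : K) ⊗ₜ[ℝ] x)) = g (gen K h σ ((1 : K) ⊗ₜ[ℝ] x))) : f = g := by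
  refine RingQuot.ringQuot_ext' K _ _ (TensorAlgebra.hom_ext (LinearMap.ext fun x => ?_))
  change f (gen K h σ x) = g (gen K h σ x)
  induction x with
  | zero => simp
  | tmul k x =>
    have h1 : k ⊗ₜ[ℝ] x = k • ((1 : K) ⊗ₜ[ℝ] x) := by
      rw [TensorProduct.smul_tmul', smul_eq_mul, mul_one]
    rw [h1, map_smul, map_smul, map_smul, e]
  | add x y hx hy => rw [map_add, map_add, map_add, hx, hy]

/-- The algebra map induced by a linear map preserving the forms, given by applying the linear map
to the generators. -/
def map (T : E →ₗ[ℝ] E') (hT : ∀ x y, σ' (T x) (T y) = σ x y) : CCR K h σ →ₐ[K] CCR K h σ' :=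
  RingQuot.liftAlgHom K ⟨TensorAlgebra.lift K (gen K h σ' ∘ₗ T.baseChange K), by
    rintro _ _ ⟨x, y⟩
    simp only [map_sub, map_mul, TensorAlgebra.lift_ι_apply, LinearMap.comp_apply,
      LinearMap.baseChange_tmul, gen_comm, hT, AlgHom.commutes]⟩

theorem map_gen (T : E →ₗ[ℝ] E') (hT : ∀ x y, σ' (T x) (T y) = σ x y) (x : K ⊗[ℝ] E) :
    map K h σ σ' T hT (gen K h σ x) = gen K h σ' (T.baseChange K x) := by
  refine (RingQuot.liftAlgHom_mkAlgHom_apply K _ _ _).trans ?_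
  simp

theorem map_id (T : E →ₗ[ℝ] E) (hT : ∀ x y, σ (T x) (T y) = σ x y) (hT' : ∀ x, T x = x) :
    map K h σ σ T hT = AlgHom.id K _ :=
  hom_ext fun x => by simp [map_gen, hT']

theorem map_comp (T : E →ₗ[ℝ] E') (hT : ∀ x y, σ' (T x) (T y) = σ x y) (S : E' →ₗ[ℝ] E'')
    (hS : ∀ x y, σ'' (S x) (S y) = σ' x y) (R : E →ₗ[ℝ] E'')
    (hR : ∀ x y, σ'' (R x) (R y) = σ x y) (e : ∀ x, S (T x) = R x) :
    (map K h σ' σ'' S hS).comp (map K h σ σ' T hT) = map K h σ σ'' R hR :=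
  hom_ext fun x => by simp [map_gen, e]

/-- Elements induced from subspaces on which the form pairs to zero commute. -/
theorem map_commute (T : E →ₗ[ℝ] E'') (hT : ∀ x y, σ'' (T x) (T y) = σ x y) (S : E' →ₗ[ℝ] E'')
    (hS : ∀ x y, σ'' (S x) (S y) = σ' x y) (e : ∀ x y, σ'' (T x) (S y) = 0) (a : CCR K h σ)
    (b : CCR K h σ') : Commute (map K h σ σ'' T hT a) (map K h σ' σ'' S hS b) := by
  have gens : ∀ {F : Type} [AddCommGroup F] [Module ℝ F] (τ : F → F → ℝ) (R : F →ₗ[ℝ] E'')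
      (hR : ∀ x y, σ'' (R x) (R y) = τ x y) (z : CCR K h σ''),
      (∀ x, Commute z (gen K h σ'' ((1 : K) ⊗ₜ[ℝ] R x))) → ∀ c, Commute z (map K h τ σ'' R hR c) := by
    intro F _ _ τ R hR z hz c
    obtain ⟨c, rfl⟩ := RingQuot.mkAlgHom_surjective K _ c
    induction c using TensorAlgebra.induction with
    | algebraMap r => simpa using Algebra.commute_algebraMap_right r z
    | ι x =>
      change Commute z (map K h τ σ'' R hR (gen K h τ x))
      rw [map_gen]
      induction x with
      | zero => simp
      | tmul k x =>
        have h1 : k ⊗ₜ[ℝ] R x = k • ((1 : K) ⊗ₜ[ℝ] R x) := by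
          rw [TensorProduct.smul_tmul', smul_eq_mul, mul_one]
        rw [LinearMap.baseChange_tmul, h1, map_smul]
        exact (hz x).smul_right k
      | add x y hx hy => rw [map_add, map_add]; exact hx.add_right hy
    | mul a b ha hb => rw [map_mul, map_mul]; exact ha.mul_right hb
    | add a b ha hb => rw [map_add, map_add]; exact ha.add_right hb
  refine gens σ' S hS _ (fun y => (gens σ T hT _ (fun x => ?_) a).symm) b
  have h1 := gen_comm K h σ'' (T x) (S y)
  rw [e, Complex.ofReal_zero, mul_zero, map_zero, zero_mul, map_zero, sub_eq_zero] at h1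
  exact h1.symm

end

end CCR

end CCR

/-! ### Intervals of the circle -/

open Manifold ContDiff

/-- The nonempty open intervals of the circle: the nonempty connected open subsets other than the
circle itself, ordered by inclusion. -/
abbrev Disk : Type :=
  {I : TopologicalSpace.Opens Circle // IsConnected (I : Set Circle) ∧ I ≠ ⊤}

/-- Inclusions of intervals are orthogonal if the intervals are disjoint. -/
instance : Orthogonality Disk where
  Orth {I₁ I₂ _} _ _ := Disjoint (I₁.1 : Set Circle) I₂.1
  orth_symm h := Disjoint.symm h
  orth_comp h g₁ g₂ _ := Set.disjoint_of_subset (leOfHom g₁) (leOfHom g₂) h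

/-- The smooth real functions on the circle with (compact) support contained in `I`. -/
def testFn (I : Disk) : Submodule ℝ (Circle → ℝ) where
  carrier := {φ | ContMDiff (𝓡 1) 𝓘(ℝ, ℝ) ∞ φ ∧ tsupport φ ⊆ I.1}
  add_mem' h h' := ⟨h.1.add h'.1, (tsupport_add _ _).trans (Set.union_subset h.2 h'.2)⟩
  zero_mem' := ⟨contMDiff_const, by simp⟩
  smul_mem' r φ h := ⟨contMDiff_const.mul h.1, (tsupport_smul_subset_right (fun _ => r) φ).trans h.2⟩

/-- The integral `∫ φ dψ` over the circle, in the coordinate `θ ↦ exp(iθ)`. -/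
def circleForm (φ ψ : Circle → ℝ) : ℝ :=
  ∫ θ in (0 : ℝ)..2 * Real.pi, φ (Circle.exp θ) * deriv (fun s => ψ (Circle.exp s)) θ

theorem circleForm_eq_zero {φ ψ : Circle → ℝ} {I J : Set Circle} (h : Disjoint I J)
    (hφ : tsupport φ ⊆ I) (hψ : tsupport ψ ⊆ J) : circleForm φ ψ = 0 := by
  have h1 : ∀ θ : ℝ, φ (Circle.exp θ) * deriv (fun s => ψ (Circle.exp s)) θ = 0 := by
    intro θ
    by_cases hθ : Circle.exp θ ∈ tsupport φ
    · have h2 : Circle.exp θ ∉ tsupport ψ := fun h3 => Set.disjoint_left.1 h (hφ hθ) (hψ h3)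
      have h3 : (fun s => ψ (Circle.exp s)) =ᶠ[nhds θ] fun _ => 0 :=
        Circle.exp.continuous.continuousAt.eventually (notMem_tsupport_iff_eventuallyEq.1 h2)
      rw [h3.deriv_eq, deriv_const, mul_zero]
    · rw [image_eq_zero_of_notMem_tsupport hθ, zero_mul]
  simp [circleForm, h1]

theorem circleForm_smul_units (u : ℤˣ) (φ ψ : Circle → ℝ) :
    circleForm (u • φ) (u • ψ) = circleForm φ ψ := by
  rcases Int.units_eq_one_or u with rfl | rfl
  · simp
  · simp [circleForm, Units.smul_def, deriv.fun_neg]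

/-- Extension by zero along an inclusion of intervals. -/
def testFnMap {I J : Disk} (f : I ⟶ J) : testFn I →ₗ[ℝ] testFn J :=
  Submodule.inclusion (p := testFn I) (p' := testFn J) fun _ h =>
    And.intro h.1 (h.2.trans (leOfHom f))

/-- The action of `±1` on test functions. -/
def testFnSign (u : ℤˣ) (I : Disk) : testFn I →ₗ[ℝ] testFn I := DistribSMul.toLinearMap ℝ _ u

/-- The form `∫_I φ dψ` on the test functions of an interval `I`. As `φ` vanishes outside of `I`,
the integral may be taken over the whole circle. -/
def intervalForm (I : Disk) (φ ψ : testFn I) : ℝ := circleForm φ.1 ψ.1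

section ChiralBoson

variable (K : Type) [CommRing K] [Algebra ℂ K] (h : K)

/-- The CCR algebra of an interval. -/
abbrev ccrAlg (I : Disk) : Type := CCR K h (intervalForm I)

/-- The sign automorphism, acting by `φ ↦ ±φ` on generators. -/
def ccrSign (u : ℤˣ) (I : Disk) : ccrAlg K h I →ₐ[K] ccrAlg K h I :=
  CCR.map K h (intervalForm I) (intervalForm I) (testFnSign u I) fun φ ψ => circleForm_smul_units u φ.1 ψ.1

theorem ccrSign_one (I : Disk) : ccrSign K h 1 I = AlgHom.id K _ :=
  CCR.map_id K h _ _ _ fun φ => one_smul _ φ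

theorem ccrSign_mul (u u' : ℤˣ) (I : Disk) :
    (ccrSign K h u I).comp (ccrSign K h u' I) = ccrSign K h (u * u') I :=
  CCR.map_comp K h _ _ _ _ _ _ _ _ _ fun φ => (mul_smul u u' φ).symm

/-- The pushforward of observables along an inclusion of intervals. -/
def ccrMap {I J : Disk} (f : I ⟶ J) : ccrAlg K h I →ₐ[K] ccrAlg K h J :=
  CCR.map K h (intervalForm I) (intervalForm J) (testFnMap f) fun _ _ => rfl

theorem ccrMap_id (I : Disk) : ccrMap K h (𝟙 I) = AlgHom.id K _ :=
  CCR.map_id K h _ (testFnMap (𝟙 I)) (fun _ _ => rfl) fun _ => rfl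

theorem ccrMap_comp {I J L : Disk} (f : I ⟶ J) (g : J ⟶ L) :
    (ccrMap K h g).comp (ccrMap K h f) = ccrMap K h (f ≫ g) :=
  CCR.map_comp K h (intervalForm I) (intervalForm J) (intervalForm L) (testFnMap f)
    (fun _ _ => rfl) (testFnMap g) (fun _ _ => rfl) (testFnMap (f ≫ g)) (fun _ _ => rfl)
    fun _ => rfl

theorem ccrMap_sign {I J : Disk} (f : I ⟶ J) (u : ℤˣ) :
    (ccrMap K h f).comp (ccrSign K h u I) = (ccrSign K h u J).comp (ccrMap K h f) := by
  have h1 : ∀ φ ψ : testFn I, intervalForm J ((testFnSign u J ∘ₗ testFnMap f) φ)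
      ((testFnSign u J ∘ₗ testFnMap f) ψ) = intervalForm I φ ψ :=
    fun φ ψ => circleForm_smul_units u φ.1 ψ.1
  exact (CCR.map_comp K h _ _ _ _ _ _ _ (testFnSign u J ∘ₗ testFnMap f) h1 fun _ => rfl).trans
    (CCR.map_comp K h _ _ _ _ _ _ _ (testFnSign u J ∘ₗ testFnMap f) h1 fun _ => rfl).symm

/-- The functor assigning to an interval its CCR algebra. -/
def ccrFunctor : Disk ⥤ AlgCat.{0} K where
  obj I := AlgCat.of K (ccrAlg K h I)
  map f := AlgCat.ofHom (ccrMap K h f)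
  map_id I := AlgCat.hom_ext _ (ccrMap_id K h I)
  map_comp f g := AlgCat.hom_ext _ (ccrMap_comp K h f g).symm

/-- The chiral free boson with deformation parameter `h`, as an AQFT over `K`. -/
def chiralBosonAQFT : AQFT K Disk where
  F := ccrFunctor K h
  commute {I₁ I₂ J} f₁ f₂ hf a₁ a₂ :=
    CCR.map_commute K h (intervalForm I₁) (intervalForm I₂) (intervalForm J) (testFnMap f₁)
      (fun _ _ => rfl) (testFnMap f₂) (fun _ _ => rfl)
      (fun φ ψ => circleForm_eq_zero (I := I₁.1) (J := I₂.1) hf φ.2.2 ψ.2.2) a₁ a₂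

/-- The sign action, as natural transformations. -/
def ccrSignNat (u : ℤˣ) : ccrFunctor K h ⟶ ccrFunctor K h where
  app I := AlgCat.ofHom (ccrSign K h u I)
  naturality _ _ f := AlgCat.hom_ext _ (ccrMap_sign K h f u).symm

theorem ccrSignNat_one : ccrSignNat K h 1 = 𝟙 _ :=
  NatTrans.ext (funext fun I => AlgCat.hom_ext _ (ccrSign_one K h I))

theorem ccrSignNat_comp (u u' : ℤˣ) :
    ccrSignNat K h u' ≫ ccrSignNat K h u = ccrSignNat K h (u * u') :=
  NatTrans.ext (funext fun I => AlgCat.hom_ext _ (ccrSign_mul K h u u' I))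

/-- The `ℤ₂`-action, which is given by `φ ↦ ±φ` on generators. -/
def ccrRep : ℤˣ →* Aut (ccrFunctor K h) where
  toFun u := ⟨ccrSignNat K h u, ccrSignNat K h u⁻¹,
    by rw [ccrSignNat_comp, inv_mul_cancel, ccrSignNat_one],
    by rw [ccrSignNat_comp, mul_inv_cancel, ccrSignNat_one]⟩
  map_one' := Iso.ext (ccrSignNat_one K h)
  map_mul' u u' := Iso.ext (ccrSignNat_comp K h u u').symm

/-- The chiral free boson with its `ℤ₂`-action `φ ↦ ±φ`. -/
def chiralBoson : GAQFT K Disk ℤˣ where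
  toAQFT := chiralBosonAQFT K h
  rep := ccrRep K h

end ChiralBoson

/-! ### Even and odd parts -/

section Parity

variable {K A : Type} [CommRing K] [Ring A] [Algebra K A] (α : ℤˣ →* (A →ₐ[K] A))

/-- The subalgebra of invariants under a `ℤ₂`-action. -/
def evenPart : Subalgebra K A where
  carrier := {a | ∀ u, α u a = a}
  mul_mem' h h' u := by rw [map_mul, h, h']
  add_mem' h h' u := by rw [map_add, h, h']
  algebraMap_mem' r u := AlgHom.commutes _ _

/-- The odd part of an algebra with `ℤ₂`-action. -/
def oddPart : Submodule K A where
  carrier := {a | α (-1) a = -a}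
  add_mem' {a b} h h' := by
    change α (-1) (a + b) = -(a + b)
    rw [map_add, show α (-1) a = -a from h, show α (-1) b = -b from h', neg_add]
  zero_mem' := by simp
  smul_mem' r a h := by
    change α (-1) (r • a) = -(r • a)
    rw [map_smul, show α (-1) a = -a from h, smul_neg]

variable {α}

theorem odd_mul_even {v b : A} (hv : v ∈ oddPart α) (hb : b ∈ evenPart α) : v * b ∈ oddPart α :=
  (map_mul (α (-1)) v b).trans (by rw [show α (-1) v = -v from hv, hb (-1), neg_mul])

theorem even_mul_odd {b v : A} (hb : b ∈ evenPart α) (hv : v ∈ oddPart α) : b * v ∈ oddPart α :=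
  (map_mul (α (-1)) b v).trans (by rw [show α (-1) v = -v from hv, hb (-1), mul_neg])

theorem odd_mul_odd {v w : A} (hv : v ∈ oddPart α) (hw : w ∈ oddPart α) : v * w ∈ evenPart α := by
  intro u
  rcases Int.units_eq_one_or u with rfl | rfl
  · rw [map_one]; rfl
  · rw [map_mul, show α (-1) v = -v from hv, show α (-1) w = -w from hw, neg_mul_neg]

variable (α)

/-- The odd part, as a `K`-module. -/
def Odd : Type := oddPart α

instance : AddCommGroup (Odd α) := inferInstanceAs (AddCommGroup (oddPart α))
instance : Module K (Odd α) := inferInstanceAs (Module K (oddPart α))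

variable {α} in
/-- The right multiplication of odd elements by even ones. -/
def Odd.mulEven (v : Odd α) (b : evenPart α) : Odd α := ⟨v.1 * b.1, odd_mul_even v.2 b.2⟩

variable {α} in
/-- The left multiplication of odd elements by even ones. -/
def Odd.evenMul (b : evenPart α) (v : Odd α) : Odd α := ⟨b.1 * v.1, even_mul_odd b.2 v.2⟩

/-- The relations `v b ⊗ w = v ⊗ b w` for odd `v`, `w` and even `b`. -/
def oddRelations : Submodule K (Odd α ⊗[K] Odd α) :=
  Submodule.span K {x | ∃ (v w : Odd α) (b : evenPart α),
    x = v.mulEven b ⊗ₜ[K] w - v ⊗ₜ[K] w.evenMul b}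

/-- The tensor product `V ⊗_B V` of the odd part `V` with itself over the even part `B`. -/
abbrev OddTensor : Type := (Odd α ⊗[K] Odd α) ⧸ oddRelations α

/-- The multiplication `V × V → B` of odd elements. -/
def oddMulBilin : Odd α →ₗ[K] Odd α →ₗ[K] evenPart α :=
  LinearMap.mk₂ K (fun v w => ⟨v.1 * w.1, odd_mul_odd v.2 w.2⟩)
    (fun _ _ _ => Subtype.ext (add_mul _ _ _)) (fun _ _ _ => Subtype.ext (smul_mul_assoc _ _ _))
    (fun _ _ _ => Subtype.ext (mul_add _ _ _)) (fun _ _ _ => Subtype.ext (mul_smul_comm _ _ _))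

/-- The map `μ : V ⊗_B V → B` induced by the multiplication. -/
def oddMul : OddTensor α →ₗ[K] evenPart α :=
  (oddRelations α).liftQ (TensorProduct.lift (oddMulBilin α)) (by
    refine Submodule.span_le.2 ?_
    rintro _ ⟨v, w, b, rfl⟩
    refine LinearMap.mem_ker.2 ((map_sub _ _ _).trans (sub_eq_zero.2 ?_))
    rw [TensorProduct.lift.tmul, TensorProduct.lift.tmul]
    exact Subtype.ext (mul_assoc v.1 b.1 w.1))

end Parity

/-- The map `μ : V ⊗_B V → B` for the even part `B` and the odd part `V` of the CCR algebra of an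
interval. -/
def chiralBosonMul (K : Type) [CommRing K] [Algebra ℂ K] (h : K) (I : Disk) :
    OddTensor ((chiralBoson K h).autAct I) →ₗ[K] evenPart ((chiralBoson K h).autAct I) :=
  oddMul ((chiralBoson K h).autAct I)

end OrbifoldAQFT

end

/-!
For a theory `𝔄` with an action of a finite group `G`, let `𝔅` be the AQFT of invariants. As the
pointing of the categorified orbifold theory `𝔄^G` at `c` is the regular equivariant module, its
truncation is `𝔅` (`truncIncl_isInvariants`), and truncatedness amounts to whether the categories
of equivariant `𝔄(c)`-modules and of `𝔅(c)`-modules agree by way of invariants and induction.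

**Truncated.** Call an action on an algebra `A` with invariants `B` Galois if there are `xₖ`, `yₖ`
in `A` with `∑ₖ g(xₖ) yₖ = δ_{g,1}`. For a Galois action, equivariant modules satisfy Galois
descent: every `v` in an equivariant module `V` is `∑ₖ (∑_g g(v xₖ)) yₖ`, hence `V` is generated
by its invariants, and if the order of `G` is invertible, averaging shows that taking invariants
is an equivalence from equivariant `A`-modules to `B`-modules (`invFunctor_full`,
`invFunctor_faithful`, `invFunctor_essSurj`). Invariants are compatible with the factorization
products (`invSqHom_injective`, `invSqHom_surjective`), so that they form a pseudo-transformation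
`𝔄^G → ι(𝔅)` whose components are equivalences. Such a pseudo-transformation has a quasi-inverse
(`OneHom.inverse`), and this quasi-inverse is the counit, which proves `gauging_truncated`.

For the chiral free boson with `G = ℤ₂`, a Galois system exists as soon as `1` is a sum of
products `∑ᵢ vᵢ wᵢ` of odd elements, and then `V ⊗_B V → B` is bijective as well, with inverse
`b ↦ ∑ᵢ b vᵢ ⊗ wᵢ`. The commutation relation `φψ - ψφ = iħ∫φ dψ` is such a sum, up to the factor on
its right hand side, which is invertible if `ħ` is and `φ`, `ψ` are chosen with `∫φ dψ ≠ 0`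
(`exists_intervalForm_ne_zero`).

**Non-truncated.** In `ι(𝔅)` the pointing is a free module of rank one, so that a morphism
vanishes if it vanishes on the pointing; if `𝔄^G` is truncated, it inherits this property
(`eq_zero_of_truncated`). If `ħ` is not invertible in `K`, the algebra `𝔄(I)` has a character to
`K / ħ` that sends all generators to zero. Twisted by the sign representation, this character is a
non-zero morphism of equivariant modules that vanishes on all invariants, as these are the odd
elements (`not_truncated_of_character`). If `ħ = 0`, the same character vanishes on `V V` and not
on `1`, so that `V ⊗_B V → B` is not surjective.
-/

noncomputable section

open CategoryTheory CategoryTheory.Limits TensorProduct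

universe u v w

namespace OrbifoldAQFT

/-! ### Equivalences of 2AQFTs -/

namespace TwoAQFT

variable {K : Type u} [CommRing K] {C : Type w} [Category.{v} C] [Orthogonality C]
  {S T : TwoAQFT.{u, v, w} K C}

/-- A modification whose components are invertible has an inverse modification. -/
theorem OneHom.Isomorphic.of_isIso {η θ : OneHom S T} (Γ : TwoHom η θ)
    [∀ c, IsIso (Γ.app c)] : η.Isomorphic θ := by
  refine ⟨Γ, ⟨fun c => inv (Γ.app c), fun {ι _ c t} f x => ?_⟩,
    fun c => ⟨IsIso.hom_inv_id _, IsIso.inv_hom_id _⟩⟩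
  have h1 := Γ.sq f x
  have h2 := T.map_comp' f (fun i => (inv (Γ.app (c i))).app (x i))
    (fun i => (Γ.app (c i)).app (x i))
  simp only [← NatTrans.comp_app, IsIso.inv_hom_id] at h2
  have h3 := h2.symm.trans (T.map_id' f _)
  rw [← cancel_mono ((Γ.app t).app ((S.prod f).obj x)), Category.assoc, Category.assoc, ← h1,
    reassoc_of% h3, ← NatTrans.comp_app, IsIso.inv_hom_id, NatTrans.id_app, Category.comp_id]

section Inverse

variable (η : OneHom S T) [∀ c, (η.app c).IsEquivalence]

/-- The counit of the equivalence of categories underlying `η` at an object. -/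
def OneHom.invCounit (c : C) (y : T.cat c) : (η.app c).obj ((η.app c).inv.obj y) ≅ y :=
  (η.app c).asEquivalence.counitIso.app y

theorem OneHom.invCounit_nat (c : C) {y z : T.cat c} (φ : y ⟶ z) :
    (η.app c).map ((η.app c).inv.map φ) ≫ (η.invCounit c z).hom = (η.invCounit c y).hom ≫ φ :=
  (η.app c).asEquivalence.counitIso.hom.naturality φ

/-- Morphisms to an object in the image of the inverse functor may be compared after applying `η`
and the counit. All coherence identities for the quasi-inverse are verified in this way. -/
theorem OneHom.inv_hom_ext {c : C} {x : S.cat c} {y : T.cat c}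
    {φ ψ : x ⟶ (η.app c).inv.obj y}
    (h : (η.app c).map φ ≫ (η.invCounit c y).hom = (η.app c).map ψ ≫ (η.invCounit c y).hom) :
    φ = ψ :=
  (η.app c).map_injective ((cancel_mono _).1 h)

variable {ι : Type} [Finite ι] {c : ι → C} {t : C}

/-- The compatibility of the quasi-inverse with the factorization products, the mate of that
of `η`. -/
def OneHom.invSq (f : Op c t) (x : ∀ i, T.cat (c i)) :
    (S.prod f).obj (fun i => (η.app (c i)).inv.obj (x i)) ≅
      (η.app t).inv.obj ((T.prod f).obj x) :=
  (η.app t).preimageIso ((η.sq f fun i => (η.app (c i)).inv.obj (x i)).symm ≪≫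
    (T.prod f).mapIso (Pi.isoMk fun i => η.invCounit (c i) (x i)) ≪≫
      (η.invCounit t ((T.prod f).obj x)).symm)

/-- The defining property of `invSq`: it is the mate of the structure isomorphism of `η`. -/
theorem OneHom.invSq_spec (f : Op c t) (x : ∀ i, T.cat (c i)) :
    (η.sq f fun i => (η.app (c i)).inv.obj (x i)).hom ≫ (η.app t).map (η.invSq f x).hom ≫
      (η.invCounit t ((T.prod f).obj x)).hom =
        (T.prod f).map fun i => (η.invCounit (c i) (x i)).hom := by
  simp only [invSq, Functor.preimageIso_hom, Functor.map_preimage, Iso.trans_hom, Iso.symm_hom,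
    Category.assoc, Iso.inv_hom_id, Category.comp_id, Iso.hom_inv_id_assoc]
  rfl

/-- The quasi-inverse of a 1-morphism whose components are equivalences of categories. -/
def OneHom.inverse : OneHom T S where
  app c := (η.app c).inv
  app_lin c := by
    obtain ⟨_, _, _⟩ := η.app_lin c
    have h1 : ((η.app c).asEquivalence.functor).Additive := ‹(η.app c).Additive›
    have h2 : ((η.app c).asEquivalence.functor).Linear K := ‹(η.app c).Linear K›
    exact ⟨inferInstanceAs ((η.app c).asEquivalence.inverse).Additive,
      inferInstanceAs (((η.app c).asEquivalence.inverse).Linear K), inferInstance⟩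
  sq f x := η.invSq f x
  sq_nat {ι _ c t} f x y φ := by
    refine η.inv_hom_ext ?_
    have h1 := η.sq_nat f fun i => (η.app (c i)).inv.map (φ i)
    rw [← cancel_epi (η.sq f _).hom, Functor.map_comp, Functor.map_comp, Category.assoc,
      Category.assoc, ← reassoc_of% h1, η.invSq_spec, η.invCounit_nat,
      reassoc_of% (η.invSq_spec f x), ← map_comp', ← map_comp']
    simp only [invCounit_nat]
  sq_comp {ι _ κ _ a b t} f g x := by
    refine η.inv_hom_ext ?_
    have h1 := η.sq_nat f fun i => (η.invSq (g i) (x i)).hom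
    have h2 := η.sq_comp f g fun i j => (η.app (b i j)).inv.obj (x i j)
    have h3 := T.comp_nat f g fun i j => (η.invCounit (b i j) (x i j)).hom
    have h4 := fun i => η.invSq_spec (g i) (x i)
    have h5 := η.invSq_spec f fun i => (T.prod (g i)).obj (x i)
    have h6 := η.invSq_spec (f.comp g) fun s => x s.1 s.2
    have h7 := T.map_comp' f (fun i => (η.sq (g i) fun j => (η.app (b i j)).inv.obj (x i j)).hom)
      (fun i => (η.app (a i)).map (η.invSq (g i) (x i)).hom ≫ (η.invCounit (a i) _).hom)
    have h8 := T.map_comp' f (fun i => (η.app (a i)).map (η.invSq (g i) (x i)).hom)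
      (fun i => (η.invCounit (a i) _).hom)
    simp only [h4] at h7
    have h9 : IsIso ((T.prod f).map fun i =>
        (η.sq (g i) fun j => (η.app (b i j)).inv.obj (x i j)).hom) :=
      inferInstanceAs (IsIso ((T.prod f).mapIso (Pi.isoMk fun i =>
        η.sq (g i) fun j => (η.app (b i j)).inv.obj (x i j))).hom)
    rw [← cancel_epi (η.sq f _).hom, ← cancel_epi ((T.prod f).map fun i =>
        (η.sq (g i) fun j => (η.app (b i j)).inv.obj (x i j)).hom)]
    simp only [Functor.map_comp, Category.assoc]
    rw [η.invCounit_nat, ← reassoc_of% h1, reassoc_of% h5, reassoc_of% h2, h6, ← h3, h7, h8]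
    simp only [Category.assoc]
  sq_unit t x := by
    refine η.inv_hom_ext ?_
    have h1 := η.sq_unit t ((η.app t).inv.obj x)
    rw [Functor.map_comp, Category.assoc, ← h1, Category.assoc, η.invSq_spec, η.invCounit_nat]
    exact (T.unit_nat t (η.invCounit t x).hom).symm
  sq_perm {ι ι' _ _ c t} p hp f f' h x := by
    refine η.inv_hom_ext ?_
    have h1 := η.sq_perm p hp f f' h fun i => (η.app (c i)).inv.obj (x i)
    have h2 := T.perm_nat p hp f f' h fun i => (η.invCounit (c i) (x i)).hom
    have h3 := η.invSq_spec f' fun i' => x (p i')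
    rw [← cancel_epi (η.sq f _).hom]
    simp only [Functor.map_comp, Category.assoc]
    rw [η.invCounit_nat, reassoc_of% (η.invSq_spec f x), reassoc_of% h1, h3, h2]

/-- A diagram chase in an arbitrary category, applied in `invUnitTwoHom`. -/
theorem OneHom.invUnitTwoHom_aux {D : Type*} [Category D] {X₀ X₁ X₂ X₃ X₄ X₅ : D}
    {A B : X₀ ⟶ X₃} {q : X₀ ⟶ X₁} {u : X₁ ⟶ X₂} {k : X₂ ⟶ X₃} {m : X₂ ⟶ X₄}
    {s : X₃ ⟶ X₅} {k' : X₄ ⟶ X₅}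
    (h1 : q ≫ u ≫ k = B) (h2 : A = B) (h3 : m ≫ k' = k ≫ s) :
    A ≫ s = q ≫ (u ≫ m) ≫ k' := by
  rw [h2, ← h1, Category.assoc, Category.assoc, Category.assoc, h3]

/-- The unit of the equivalence of categories underlying `η`, as a modification. -/
def OneHom.invUnitTwoHom : TwoHom (η.comp η.inverse) (OneHom.id S) where
  app c := (η.app c).asEquivalence.unitIso.inv
  sq {ι _ c t} f x := by
    have h0 : ∀ c (x : S.cat c), (η.app c).map ((η.app c).asEquivalence.unitIso.inv.app x) =
        (η.invCounit c ((η.app c).obj x)).hom :=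
      fun c x => ((η.app c).asEquivalence.counit_app_functor x).symm
    have h1 := η.sq_nat f fun i => (η.app (c i)).asEquivalence.unitIso.inv.app (x i)
    have h2 := η.invSq_spec f fun i => (η.app (c i)).obj (x i)
    have h3 : (T.prod f).map (fun i =>
        (η.app (c i)).map ((η.app (c i)).asEquivalence.unitIso.inv.app (x i))) =
          (T.prod f).map fun i => (η.invCounit (c i) ((η.app (c i)).obj (x i))).hom :=
      congrArg (T.prod f).map (funext fun i => h0 (c i) (x i))
    refine (η.app t).map_injective ?_
    refine (congrArg (η.app t).map (Category.comp_id _)).trans ?_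
    rw [← cancel_epi (η.sq f _).hom]
    refine h1.symm.trans ?_
    refine Eq.trans ?_ (congrArg (_ ≫ ·) (((η.app t).map_comp _ _).trans
      (congrArg₂ (· ≫ ·) ((η.app t).map_comp _ _) (h0 t _))).symm)
    exact invUnitTwoHom_aux h2 h3 (η.invCounit_nat t (η.sq f x).hom)

/-- The counit of the equivalence of categories underlying `η`, as a modification. -/
def OneHom.invCounitTwoHom : TwoHom (η.inverse.comp η) (OneHom.id T) where
  app c := (η.app c).asEquivalence.counitIso.hom
  sq f x := (Category.comp_id _).trans
    ((η.invSq_spec f x).symm.trans (Category.assoc _ _ _).symm)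

theorem OneHom.comp_inverse_isomorphic : (η.comp η.inverse).Isomorphic (OneHom.id S) :=
  have : ∀ c, IsIso (η.invUnitTwoHom.app c) :=
    fun c => inferInstanceAs (IsIso (η.app c).asEquivalence.unitIso.inv)
  .of_isIso η.invUnitTwoHom

theorem OneHom.inverse_comp_isomorphic : (η.inverse.comp η).Isomorphic (OneHom.id T) :=
  have : ∀ c, IsIso (η.invCounitTwoHom.app c) :=
    fun c => inferInstanceAs (IsIso (η.app c).asEquivalence.counitIso.hom)
  .of_isIso η.invCounitTwoHom

end Inverse

end TwoAQFT

/-! ### Endomorphisms of the pointing of a categorified orbifold theory -/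

namespace GMod

variable {K A G : Type u} [CommRing K] [Ring A] [Algebra K A] [Group G] {α : G →* (A →ₐ[K] A)}
  {V W : GMod α}

theorem lin_inv_hom (p : V ≅ W) (v : V) : lin p.inv (lin p.hom v) = v :=
  LinearMap.congr_fun (congrArg lin p.hom_inv_id) v

variable (α) in
/-- The algebra, as an equivariant right module over itself. -/
def regular : GMod α where
  carrier := A
  act := LinearMap.mul K A
  act_one := mul_one
  act_mul v a b := (mul_assoc v a b).symm
  ρ :=
  { toFun := fun g => (α g).toLinearMap
    map_one' := by rw [map_one]; rfl
    map_mul' := fun g h => by rw [map_mul]; rfl }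
  ρ_act g v a := map_mul (α g) v a

end GMod

namespace GAQFT

open GMod

variable {K : Type u} [CommRing K] {C : Type w} [Category.{v} C] [Orthogonality C]
  {G : Type u} [Group G] (𝔄 : GAQFT.{u, v, w} K C G)

/-- The empty tuple of equivariant modules. -/
def nilMod (e : Empty) : GMod (𝔄.autAct (e.elim : C)) := e.elim

/-- The pointing of the categorified orbifold theory, as an equivariant module. -/
def ptMod (c : C) : GMod (𝔄.autAct c) := 𝔄.relProd (Op.nil c) 𝔄.nilMod

/-- The generator `1` of the pointing. -/
def ptGen (c : C) : 𝔄.ptMod c := 𝔄.relTmul (Op.nil c) 𝔄.nilMod fun e => e.elim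

variable {𝔄}

theorem relTmul_nil (c : C) (v : ∀ e, 𝔄.nilMod e) :
    𝔄.relTmul (Op.nil c) 𝔄.nilMod v = 𝔄.ptGen c :=
  congrArg (𝔄.relTmul (Op.nil c) 𝔄.nilMod) (funext fun e => e.elim)

theorem ptMod_ext {c : C} {Q : GMod (𝔄.autAct c)} {φ ψ : 𝔄.ptMod c ⟶ Q}
    (h : lin φ (𝔄.ptGen c) = lin ψ (𝔄.ptGen c)) : φ = ψ :=
  relProd_ext fun v => (congrArg (lin φ) (relTmul_nil c v)).trans
    (h.trans (congrArg (lin ψ) (relTmul_nil c v)).symm)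

theorem ptGen_ρ (c : C) (g : G) : (𝔄.ptMod c).ρ g (𝔄.ptGen c) = 𝔄.ptGen c :=
  (𝔄.relTmul_ρ (Op.nil c) _ g _).trans (relTmul_nil c _)

/-- An invariant element of an equivariant module, as a morphism from the pointing. -/
def ptDesc {c : C} {Q : GMod (𝔄.autAct c)} (q : Q) (hq : ∀ g, Q.ρ g q = q) : 𝔄.ptMod c ⟶ Q :=
  relDesc (𝔄 := 𝔄) (f := Op.nil c) (V := 𝔄.nilMod) (MultilinearMap.constOfIsEmpty K _ q)
    (fun _ e => e.elim) (fun g _ => hq g)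

theorem ptDesc_ptGen {c : C} {Q : GMod (𝔄.autAct c)} (q : Q) (hq : ∀ g, Q.ρ g q = q) :
    lin (ptDesc q hq) (𝔄.ptGen c) = q :=
  relDesc_relTmul (𝔄 := 𝔄) (f := Op.nil c) (V := 𝔄.nilMod) (MultilinearMap.constOfIsEmpty K _ q)
    (fun _ e => e.elim) (fun g _ => hq g) _

/-- The pointing is free on its generator, as it maps to the regular module by `1 ↦ 1`. -/
theorem ptGen_act_injective (c : C) : Function.Injective ((𝔄.ptMod c).act (𝔄.ptGen c)) := by
  let one : regular (𝔄.autAct c) := (1 : 𝔄.alg c)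
  have h1 : ∀ g, (regular (𝔄.autAct c)).ρ g one = one := fun g => map_one (𝔄.autAct c g)
  have h2 : ∀ a, lin (ptDesc one h1) ((𝔄.ptMod c).act (𝔄.ptGen c) a) =
      (regular (𝔄.autAct c)).act one a := fun a => by
    rw [lin_act, ptDesc_ptGen]
  intro a b hab
  have h3 := (h2 a).symm.trans ((congrArg _ hab).trans (h2 b))
  exact (one_mul a).symm.trans (h3.trans (one_mul b))

theorem ptGen_act_surjective (c : C) : Function.Surjective ((𝔄.ptMod c).act (𝔄.ptGen c)) := by
  have h1 : LinearMap.range ((𝔄.ptMod c).act (𝔄.ptGen c)) = ⊤ :=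
    relProd_span (V := 𝔄.nilMod) fun v b =>
      ⟨b, congrArg (fun z => (𝔄.ptMod c).act z b) (relTmul_nil c v).symm⟩
  exact LinearMap.range_eq_top.1 h1

variable (𝔄)

/-- The element of `𝔄 c` corresponding to an endomorphism of the pointing, its value at `1`. -/
def endElem (c : C) (h : 𝔄.ptMod c ⟶ 𝔄.ptMod c) : 𝔄.alg c :=
  (ptGen_act_surjective c (lin h (𝔄.ptGen c))).choose

theorem act_endElem (c : C) (h : 𝔄.ptMod c ⟶ 𝔄.ptMod c) :
    (𝔄.ptMod c).act (𝔄.ptGen c) (𝔄.endElem c h) = lin h (𝔄.ptGen c) :=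
  (ptGen_act_surjective c (lin h (𝔄.ptGen c))).choose_spec

variable {𝔄} in
theorem endElem_eq {c : C} {h : 𝔄.ptMod c ⟶ 𝔄.ptMod c} {a : 𝔄.alg c}
    (e : lin h (𝔄.ptGen c) = (𝔄.ptMod c).act (𝔄.ptGen c) a) : 𝔄.endElem c h = a :=
  ptGen_act_injective c ((𝔄.act_endElem c h).trans e)

theorem endElem_comp (c : C) (x y : 𝔄.ptMod c ⟶ 𝔄.ptMod c) :
    𝔄.endElem c (y ≫ x) = 𝔄.endElem c x * 𝔄.endElem c y :=
  endElem_eq (by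
    rw [lin_comp, LinearMap.comp_apply, ← act_endElem, lin_act, ← act_endElem, act_mul])

theorem endElem_add (c : C) (x y : 𝔄.ptMod c ⟶ 𝔄.ptMod c) :
    𝔄.endElem c (x + y) = 𝔄.endElem c x + 𝔄.endElem c y :=
  endElem_eq (by rw [map_add, act_endElem, act_endElem, lin_add, LinearMap.add_apply])

theorem endElem_smul (c : C) (r : K) (x : 𝔄.ptMod c ⟶ 𝔄.ptMod c) :
    𝔄.endElem c (r • x) = r • 𝔄.endElem c x :=
  endElem_eq (by rw [map_smul, act_endElem, lin_smul, LinearMap.smul_apply])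

theorem endElem_id (c : C) : 𝔄.endElem c (𝟙 _) = 1 :=
  endElem_eq (act_one _ _).symm

theorem endElem_injective (c : C) : Function.Injective (𝔄.endElem c) := fun x y h =>
  ptMod_ext (by rw [← act_endElem, ← act_endElem, h])

/-- The elements given by endomorphisms of the pointing are invariant, as its generator is. -/
theorem autAct_endElem (c : C) (x : 𝔄.ptMod c ⟶ 𝔄.ptMod c) (g : G) :
    𝔄.autAct c g (𝔄.endElem c x) = 𝔄.endElem c x := by
  refine ptGen_act_injective c ?_
  have h1 := congrArg ((𝔄.ptMod c).ρ g) (𝔄.act_endElem c x)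
  rw [ρ_act, ptGen_ρ, ← lin_ρ, ptGen_ρ] at h1
  rw [h1, act_endElem]

theorem exists_endElem_eq (c : C) (a : 𝔄.alg c) (ha : ∀ g, 𝔄.autAct c g a = a) :
    ∃ x, 𝔄.endElem c x = a :=
  ⟨ptDesc ((𝔄.ptMod c).act (𝔄.ptGen c) a) fun g => by rw [ρ_act, ha, ptGen_ρ],
    endElem_eq (ptDesc_ptGen _ _)⟩

/-- The algebra map from the truncation of the categorified orbifold theory to the underlying
AQFT. It identifies the truncation with the invariants. -/
def truncHom (c : C) : 𝔄.gauging.truncation.F.obj c →ₐ[K] 𝔄.alg c where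
  toFun := 𝔄.endElem c
  map_one' := 𝔄.endElem_id c
  map_mul' x y := 𝔄.endElem_comp c x y
  map_zero' := (congrArg (𝔄.endElem c) (zero_smul K (𝟙 (𝔄.ptMod c))).symm).trans
    ((𝔄.endElem_smul c 0 (𝟙 _)).trans (zero_smul K _))
  map_add' x y := 𝔄.endElem_add c x y
  commutes' r := (𝔄.endElem_smul c r (𝟙 _)).trans (by
    rw [endElem_id, Algebra.algebraMap_eq_smul_one])

theorem truncHom_injective (c : C) : Function.Injective (𝔄.truncHom c) := 𝔄.endElem_injective c

theorem truncHom_invariant (c : C) (x : 𝔄.gauging.truncation.F.obj c) (g : G) :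
    𝔄.autAct c g (𝔄.truncHom c x) = 𝔄.truncHom c x := 𝔄.autAct_endElem c x g

theorem exists_truncHom_eq (c : C) (a : 𝔄.alg c) (ha : ∀ g, 𝔄.autAct c g a = a) :
    ∃ x, 𝔄.truncHom c x = a := 𝔄.exists_endElem_eq c a ha

/-- The isomorphism comparing a factorization product of pointings with the pointing. -/
def ptModIso {ι : Type} [Finite ι] {a : ι → C} {t : C} (f : Op a t) :
    𝔄.relProd f (fun i => 𝔄.ptMod (a i)) ≅ 𝔄.ptMod t :=
  𝔄.gauging.ptIso f

/-- Products of pointings are identified with the pointing by sending the product of the generators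
to the generator. -/
theorem ptModIso_hom_relTmul {ι : Type} [Finite ι] {a : ι → C} {t : C} (f : Op a t) :
    lin (𝔄.ptModIso f).hom (𝔄.relTmul f (fun i => 𝔄.ptMod (a i)) fun i => 𝔄.ptGen (a i)) =
      𝔄.ptGen t := by
  have h1 := compIso_hom f (fun i => Op.nil (a i)) (fun _ => 𝔄.nilMod) fun _ e => e.elim
  let p := permIso (𝔄 := 𝔄) (fun s : (Σ _ : ι, Empty) => s.2) (bij_empty ι) (Op.nil t)
    (f.comp fun i => Op.nil (a i)) (fun s => s.2.elim) 𝔄.nilMod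
  have h2 := permIso_hom (𝔄 := 𝔄) _ (bij_empty ι) (Op.nil t)
    (f.comp fun i => Op.nil (a i)) (fun s => s.2.elim) 𝔄.nilMod fun e => e.elim
  refine (congrArg (lin p.inv) (h1.trans ?_)).trans (lin_inv_hom p (𝔄.ptGen t))
  exact Eq.trans (congrArg _ (funext fun s => s.2.elim)) h2.symm

/-- The identification of the truncation with the invariants is natural: the truncation acts on
endomorphisms along `f` by conjugating with the isomorphism `ptModIso`. -/
theorem truncHom_map {c t : C} (f : c ⟶ t) (x : 𝔄.gauging.truncation.F.obj c) :
    𝔄.truncHom t (𝔄.gauging.truncation.F.map f x) = 𝔄.map f (𝔄.truncHom c x) := by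
  let x' : 𝔄.ptMod c ⟶ 𝔄.ptMod c := x
  let p := 𝔄.ptModIso (Op.single f)
  refine endElem_eq (h := p.inv ≫ relMap (fun _ => x') ≫ p.hom) ?_
  have h1 := 𝔄.ptModIso_hom_relTmul (Op.single f)
  have h2 : lin p.inv (𝔄.ptGen t) = 𝔄.relTmul (Op.single f) (fun _ => 𝔄.ptMod c)
      fun _ => 𝔄.ptGen c := by
    rw [← h1, lin_inv_hom]
  have h3 := 𝔄.relTmul_act (Op.single f) (fun _ => 𝔄.ptMod c) (fun _ => 𝔄.ptGen c) ()
    (𝔄.endElem c x)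
  rw [lin_comp, lin_comp, LinearMap.comp_apply, LinearMap.comp_apply, h2, relMap_relTmul,
    ← h1]
  refine (congrArg (lin p.hom) (Eq.trans (congrArg _ ?_) h3)).trans (lin_act _ _ _)
  funext
  simpa using (𝔄.act_endElem c x').symm

end GAQFT

/-! ### Invariants of equivariant modules over a Galois extension -/

namespace GMod

variable {K A B G : Type u} [CommRing K] [Ring A] [Algebra K A] [Ring B] [Algebra K B] [Group G]

/-- An algebra map identifies its source with the subalgebra of `G`-invariants. -/
structure IsInvariants (α : G →* (A →ₐ[K] A)) (j : B →ₐ[K] A) : Prop where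
  injective : Function.Injective j
  invariant : ∀ g b, α g (j b) = j b
  exists_eq : ∀ a, (∀ g, α g a = a) → ∃ b, j b = a

/-- An algebra is a Galois extension of its invariants: there are Galois coordinates `xₖ`, `yₖ`
with `∑ₖ g(xₖ) yₖ = δ_{g,1}`. -/
def IsGaloisAction (α : G →* (A →ₐ[K] A)) : Prop :=
  ∃ (n : ℕ) (x y : Fin n → A), ∑ k, x k * y k = 1 ∧ ∀ g ≠ 1, ∑ k, α g (x k) * y k = 0

variable {α : G →* (A →ₐ[K] A)} {j : B →ₐ[K] A} {β : PUnit.{u + 1} →* (B →ₐ[K] B)}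

/-- The invariant elements of an equivariant module. -/
def invariants (V : GMod α) : Submodule K V where
  carrier := {v | ∀ g, V.ρ g v = v}
  add_mem' h h' g := by rw [map_add, h, h']
  zero_mem' g := map_zero _
  smul_mem' r v h g := by rw [map_smul, h]

theorem act_mem_invariants (hj : IsInvariants α j) {V : GMod α} {v : V} (hv : v ∈ V.invariants)
    (b : B) : V.act v (j b) ∈ V.invariants := fun g => by
  rw [ρ_act, hv g, hj.invariant]

variable (β) in
/-- The invariants of an equivariant module, as a module over the invariant subalgebra. -/
def invMod (hj : IsInvariants α j) (V : GMod α) : GMod β where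
  carrier := V.invariants
  act := LinearMap.mk₂ K (fun v b => ⟨V.act v.1 (j b), act_mem_invariants hj v.2 b⟩)
    (fun _ _ _ => Subtype.ext (by simp)) (fun _ _ _ => Subtype.ext (by simp))
    (fun _ _ _ => Subtype.ext (by simp)) (fun _ _ _ => Subtype.ext (by simp))
  act_one v := Subtype.ext (by simp [act_one])
  act_mul v a b := Subtype.ext (by simp [act_mul])
  ρ := 1
  ρ_act g v a := by
    obtain rfl : g = 1 := rfl
    rw [map_one β]
    rfl

/-- The inclusion of the invariants. -/
def invIncl (hj : IsInvariants α j) (V : GMod α) : invMod β hj V →ₗ[K] V := V.invariants.subtype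

section

variable (hj : IsInvariants α j) {V W : GMod α}

theorem invIncl_injective : Function.Injective (invIncl (β := β) hj V) := Subtype.val_injective

@[simp] theorem ρ_invIncl (g : G) (v : invMod β hj V) :
    V.ρ g (invIncl hj V v) = invIncl hj V v := v.2 g

@[simp] theorem invIncl_act (v : invMod β hj V) (b : B) :
    invIncl hj V ((invMod β hj V).act v b) = V.act (invIncl hj V v) (j b) := rfl

variable (β)

/-- The functor of invariants. -/
def invFunctor : GMod α ⥤ GMod β where
  obj := invMod β hj
  map {V W} φ := mk' ((lin φ).restrict fun v (hv : ∀ g, V.ρ g v = v) g => by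
      rw [← lin_ρ, hv]) (fun v b => Subtype.ext (lin_act φ v.1 (j b))) (fun _ _ => rfl)

variable {β}

@[simp] theorem invIncl_map (φ : V ⟶ W) (v : invMod β hj V) :
    invIncl hj W (lin ((invFunctor β hj).map φ) v) = lin φ (invIncl hj V v) := rfl

/-- The coinduced module `Hom_B(A, N)` of a module `N` over the invariants `B`, with `A` acting by
left multiplication and `G` by translation on the argument. -/
def coinduced (j : B →ₐ[K] A) (α : G →* (A →ₐ[K] A)) (hj : IsInvariants α j) (N : GMod β) :
    GMod α :=
  let M : Submodule K (A →ₗ[K] N) :=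
    { carrier := {f | ∀ a b, f (a * j b) = N.act (f a) b}
      add_mem' := fun {f f'} h h' a b => by simp [h a b, h' a b]
      zero_mem' := fun a b => by simp
      smul_mem' := fun r f h a b => by simp [h a b] }
  { carrier := M
    act := LinearMap.mk₂ K
      (fun f a => (⟨f.1 ∘ₗ LinearMap.mulLeft K a, fun a' b => by
        simpa [mul_assoc] using f.2 (a * a') b⟩ : M))
      (fun _ _ _ => rfl) (fun _ _ _ => rfl)
      (fun f a b => Subtype.ext (LinearMap.ext fun z => by simp [add_mul]))
      (fun r f a => Subtype.ext (LinearMap.ext fun z => by simp))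
    act_one := fun f => Subtype.ext (LinearMap.ext fun z => by simp)
    act_mul := fun f a b => Subtype.ext (LinearMap.ext fun z => by simp)
    ρ :=
    { toFun := fun g =>
      { toFun := fun f => ⟨f.1 ∘ₗ (α g⁻¹).toLinearMap, fun a b => by
          simpa [hj.invariant] using f.2 (α g⁻¹ a) b⟩
        map_add' := fun _ _ => rfl
        map_smul' := fun _ _ => rfl }
      map_one' := LinearMap.ext fun f => Subtype.ext (LinearMap.ext fun z => by simp)
      map_mul' := fun g h => LinearMap.ext fun f => Subtype.ext (LinearMap.ext fun z => by simp) }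
    ρ_act := fun g f a => Subtype.ext (LinearMap.ext fun z => by
      have h1 : α g⁻¹ (α g a) = a := by
        rw [← AlgHom.mul_apply, ← map_mul, inv_mul_cancel, map_one, AlgHom.one_apply]
      simp [h1]) }

end

variable [Fintype G] [Invertible (Fintype.card G : K)]

/-- The averaging projection onto the invariants. -/
def avg (hj : IsInvariants α j) (V : GMod α) : V →ₗ[K] invMod β hj V :=
  LinearMap.codRestrict V.invariants (⅟(Fintype.card G : K) • ∑ g, V.ρ g) fun v g => by
    simp only [LinearMap.smul_apply, map_smul, LinearMap.sum_apply, map_sum]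
    congr 1
    refine Fintype.sum_equiv (Equiv.mulLeft g) _ _ fun h => ?_
    simp

section

variable (hj : IsInvariants α j) {V W : GMod α}

theorem invIncl_avg (v : V) :
    invIncl (β := β) hj V (avg hj V v) = ⅟(Fintype.card G : K) • ∑ g, V.ρ g v :=
  show (⅟(Fintype.card G : K) • ∑ g, V.ρ g) v = _ by simp

theorem avg_invIncl (w : invMod β hj V) : avg hj V (invIncl hj V w) = w := by
  refine invIncl_injective hj ?_
  rw [invIncl_avg]
  simp [← Nat.cast_smul_eq_nsmul K, smul_smul]

include hj in
theorem exists_condExp (a : A) : ∃ b, j b = ⅟(Fintype.card G : K) • ∑ g, α g a := by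
  refine hj.exists_eq _ fun g => ?_
  have h1 := (avg (β := 1) hj (regular α) a).2 g
  rwa [show (avg (β := 1) hj (regular α) a).1 = _ from invIncl_avg (β := 1) hj _] at h1

/-- The conditional expectation onto the invariant subalgebra, the average over the group. -/
def condExp : A →ₗ[K] B where
  toFun a := (exists_condExp hj a).choose
  map_add' a b := hj.injective (by
    rw [map_add, (exists_condExp hj a).choose_spec, (exists_condExp hj b).choose_spec,
      (exists_condExp hj (a + b)).choose_spec]
    simp [Finset.sum_add_distrib])
  map_smul' r a := hj.injective (by
    rw [map_smul, (exists_condExp hj a).choose_spec, (exists_condExp hj (r • a)).choose_spec]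
    simp [← Finset.smul_sum, smul_comm r])

theorem map_condExp (a : A) : j (condExp hj a) = ⅟(Fintype.card G : K) • ∑ g, α g a :=
  (exists_condExp hj a).choose_spec

theorem condExp_mul (b : B) (a : A) : condExp hj (j b * a) = b * condExp hj a :=
  hj.injective (by simp [map_condExp, hj.invariant, Finset.mul_sum])

theorem condExp_mul_map (a : A) (b : B) : condExp hj (a * j b) = condExp hj a * b :=
  hj.injective (by simp [map_condExp, hj.invariant, Finset.sum_mul])

theorem condExp_smul (g : G) (a : A) : condExp hj (α g a) = condExp hj a := by
  refine hj.injective ?_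
  rw [map_condExp, map_condExp]
  congr 1
  refine Fintype.sum_equiv (Equiv.mulRight g) _ _ fun h => ?_
  simp

theorem condExp_map (b : B) : condExp hj (j b) = b :=
  hj.injective (by simp [map_condExp, hj.invariant, ← Nat.cast_smul_eq_nsmul K, smul_smul])

theorem avg_act (w : invMod β hj V) (a : A) :
    avg hj V (V.act (invIncl hj V w) a) = (invMod β hj V).act w (condExp hj a) :=
  invIncl_injective hj (by simp [invIncl_avg, map_condExp, ρ_act])

variable (β) in
/-- The reconstruction of `v` from Galois coordinates: in `∑ₖ (∑_g g(v xₖ)) yₖ` the summands for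
`g ≠ 1` cancel. The factor by the group order compensates for the normalization of `avg`. -/
theorem sum_act_avg {n : ℕ} {x y : Fin n → A} (h1 : ∑ k, x k * y k = 1)
    (h2 : ∀ g ≠ 1, ∑ k, α g (x k) * y k = 0) (v : V) :
    ∑ k, V.act (invIncl (β := β) hj V (avg hj V (V.act v ((Fintype.card G : K) • x k)))) (y k) =
      v := by
  have h3 : ∀ k, V.act (invIncl (β := β) hj V (avg hj V
      (V.act v ((Fintype.card G : K) • x k)))) (y k) =
        ∑ g, V.act (V.ρ g v) (α g (x k) * y k) := fun k => by
    rw [invIncl_avg, map_smul]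
    simp only [map_smul, ← Finset.smul_sum, smul_smul, invOf_mul_self, one_smul]
    simp only [ρ_act, map_sum, LinearMap.sum_apply, ← act_mul]
  rw [Finset.sum_congr rfl fun k _ => h3 k, Finset.sum_comm, Finset.sum_eq_single 1]
  · rw [← map_sum, map_one, map_one]
    simp only [AlgHom.one_apply, h1, act_one, Module.End.one_apply]
  · intro g _ hg
    rw [← map_sum, h2 g hg, map_zero]
  · simp

variable (hα : IsGaloisAction α)

include hα

variable (β) in
/-- A Galois extension provides a finite frame, which expresses the elements of every equivariant
module in terms of invariant ones. -/
theorem exists_frame : ∃ (n : ℕ) (x y : Fin n → A), (∀ (V : GMod α) (v : V),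
    ∑ k, V.act (invIncl (β := β) hj V (avg hj V (V.act v (x k)))) (y k) = v) ∧
      ∀ a, ∑ k, j (condExp hj (a * x k)) * y k = a := by
  obtain ⟨n, x, y, h1, h2⟩ := hα
  refine ⟨n, fun k => (Fintype.card G : K) • x k, y,
    fun V v => sum_act_avg β hj h1 h2 v, fun a => ?_⟩
  refine Eq.trans (Finset.sum_congr rfl fun k _ => ?_) (sum_act_avg β hj (V := regular α) h1 h2 a)
  rw [map_condExp, invIncl_avg]
  rfl

variable (β) in
/-- Every equivariant module is spanned by its invariants under the action of the algebra. -/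
theorem span_act_invIncl (V : GMod α) : Submodule.span K
    (Set.range fun s : invMod β hj V × A => V.act (invIncl hj V s.1) s.2) = ⊤ := by
  obtain ⟨n, x, y, h1, -⟩ := exists_frame β hj hα
  refine eq_top_iff.2 fun v _ => ?_
  rw [← h1 V v]
  exact Submodule.sum_mem _ fun k _ => Submodule.subset_span ⟨(_, _), rfl⟩

variable (β) in
theorem lin_ext_invIncl {Q : Type*} [AddCommGroup Q] [Module K Q] {φ ψ : V →ₗ[K] Q}
    (h : ∀ (w : invMod β hj V) a, φ (V.act (invIncl hj V w) a) = ψ (V.act (invIncl hj V w) a)) :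
    φ = ψ :=
  LinearMap.ext_on_range (span_act_invIncl β hj hα V) fun s => h s.1 s.2

theorem invFunctor_faithful : (invFunctor β hj).Faithful where
  map_injective {V W φ ψ} h := Subtype.ext (lin_ext_invIncl β hj hα fun w a => by
    refine (lin_act φ _ _).trans (Eq.trans ?_ (lin_act ψ _ _).symm)
    rw [← invIncl_map, h, invIncl_map])

/-- A map between invariants extends to the modules, by reconstructing their elements from
invariants. -/
theorem exists_map_eq (φ : invMod β hj V ⟶ invMod β hj W) :
    ∃ ψ : V ⟶ W, ∀ w, lin ψ (invIncl hj V w) = invIncl hj W (lin φ w) := by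
  obtain ⟨n, x, y, -, h2⟩ := exists_frame β hj hα
  -- the map `v ↦ ∑ₖ φ(avg(v xₖ)) yₖ`, which is forced by the reconstruction of `v`
  let ψ : V →ₗ[K] W := ∑ k, W.act.flip (y k) ∘ₗ invIncl hj W ∘ₗ lin φ ∘ₗ avg hj V ∘ₗ
    V.act.flip (x k)
  have h3 : ∀ (w : invMod β hj V) a,
      ψ (V.act (invIncl hj V w) a) = W.act (invIncl hj W (lin φ w)) a := by
    intro w a
    have h4 : ∀ k, W.act (invIncl hj W (lin φ (avg hj V
        (V.act (V.act (invIncl hj V w) a) (x k))))) (y k) =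
          W.act (invIncl hj W (lin φ w)) (j (condExp hj (a * x k)) * y k) := fun k => by
      rw [← act_mul, avg_act, lin_act, invIncl_act, act_mul]
    simp only [ψ, LinearMap.sum_apply, LinearMap.comp_apply, LinearMap.flip_apply]
    rw [Finset.sum_congr rfl fun k _ => h4 k, ← map_sum, h2 a]
  refine ⟨mk' ψ (fun v b => ?_) (fun g v => ?_), fun w => ?_⟩
  · refine LinearMap.congr_fun (f := ψ ∘ₗ V.act.flip b) (g := W.act.flip b ∘ₗ ψ)
      (lin_ext_invIncl β hj hα fun w a => ?_) v
    simp only [LinearMap.comp_apply, LinearMap.flip_apply, ← act_mul, h3]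
  · refine LinearMap.congr_fun (f := ψ ∘ₗ V.ρ g) (g := W.ρ g ∘ₗ ψ)
      (lin_ext_invIncl β hj hα fun w a => ?_) v
    simp only [LinearMap.comp_apply, ρ_act, h3, ρ_invIncl]
  · have h4 := h3 w 1
    simp only [act_one] at h4
    exact h4

theorem invFunctor_full : (invFunctor β hj).Full where
  map_surjective {V W} φ := by
    obtain ⟨ψ, h⟩ := exists_map_eq hj hα (β := β) φ
    exact ⟨ψ, hom_ext fun w => invIncl_injective hj (h w)⟩

omit hα

/-- The invariants of the coinduced module are the `B`-linear maps that factor through the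
conditional expectation `A → B`, hence they are determined by their value at `1`. -/
theorem exists_iso_invMod_coinduced (N : GMod β) :
    Nonempty (invMod β hj (coinduced j α hj N) ≅ N) := by
  let F := coinduced j α hj N
  let val : invMod β hj F → A →ₗ[K] N := fun f => (show F.invariants from f).1.1
  let ev : invMod β hj F →ₗ[K] N :=
    { toFun := fun f => val f 1
      map_add' := fun _ _ => rfl
      map_smul' := fun _ _ => rfl }
  have h1 : ∀ (f : invMod β hj F) (g : G) (a : A), val f (α g⁻¹ a) = val f a := fun f g a =>
    LinearMap.congr_fun (congrArg Subtype.val ((show F.invariants from f).2 g)) a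
  have h2 : ∀ (f : invMod β hj F) (a : A) (b : B), val f (a * j b) = N.act (val f a) b :=
    fun f a b => (show F.invariants from f).1.2 a b
  have h3 : ∀ f f' : invMod β hj F, val f = val f' → f = f' :=
    fun f f' h => Subtype.ext (Subtype.ext h)
  have h4 : ∀ (f : invMod β hj F) (a : A), val f a = N.act (ev f) (condExp hj a) := by
    intro f a
    have h5 : val f (j (condExp hj a)) = val f a := by
      have h6 : ∀ g : G, val f (α g a) = val f a := fun g => by
        rw [← h1 f g⁻¹ a, inv_inv]
      rw [map_condExp]
      simp [h6, ← Nat.cast_smul_eq_nsmul K, smul_smul]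
    rw [← h5, ← one_mul (j _), h2]
    rfl
  refine ⟨isoOfBijective (mk' ev (fun f b => ?_) fun g f => ?_) ⟨fun f f' h => ?_, fun n => ?_⟩⟩
  · change val f (j b * 1) = _
    rw [h4, mul_one, condExp_map]
  · obtain rfl : g = 1 := rfl
    rw [map_one, map_one]
    rfl
  · refine h3 _ _ (LinearMap.ext fun a => ?_)
    rw [h4, h4]
    exact congrArg (fun z => N.act z (condExp hj a)) h
  · let f : A →ₗ[K] N := N.act n ∘ₗ condExp hj
    have h5 : ∀ a b, f (a * j b) = N.act (f a) b := fun a b => by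
      simp only [f, LinearMap.comp_apply, condExp_mul_map, act_mul]
    have h6 : ∀ g a, f (α g⁻¹ a) = f a := fun g a => by
      simp only [f, LinearMap.comp_apply, condExp_smul]
    refine ⟨⟨⟨f, h5⟩, fun g => Subtype.ext (LinearMap.ext (h6 g))⟩, ?_⟩
    change N.act n (condExp hj 1) = n
    rw [← map_one j, condExp_map, act_one]

theorem invFunctor_essSurj : (invFunctor β hj).EssSurj where
  mem_essImage N := ⟨coinduced j α hj N, exists_iso_invMod_coinduced hj N⟩

end

end GMod

/-! ### Invariants of factorization products -/

namespace GAQFT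

open GMod

variable {K : Type u} [CommRing K] {C : Type w} [Category.{v} C] [Orthogonality C]
  {G : Type u} [Group G] {𝔄 : GAQFT.{u, v, w} K C G} {𝔅 : GAQFT.{u, v, w} K C PUnit.{u + 1}}
  {j : ∀ c, 𝔅.alg c →ₐ[K] 𝔄.alg c} (hj : ∀ c, IsInvariants (𝔄.autAct c) (j c))
  (hn : ∀ {c t : C} (f : c ⟶ t) b, j t (𝔅.map f b) = 𝔄.map f (j c b))

section

open scoped Classical

variable {ι : Type} {c : ι → C} {t : C} (f : Op c t) (V : ∀ i, GMod (𝔄.autAct (c i)))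

/-- The tuple of the modules of invariants. -/
abbrev invMods (i : ι) : GMod (𝔅.autAct (c i)) := invMod (𝔅.autAct (c i)) (hj (c i)) (V i)

/-- The multilinear map underlying the comparison of products of invariants with the invariants
of a product. -/
def invTmul : MultilinearMap K (fun i => (invMods hj V i : Type u))
    (invMod (𝔅.autAct t) (hj t) (𝔄.relProd f V)) :=
  MultilinearMap.codRestrict
    ((𝔄.relTmul f V).compLinearMap fun i => invIncl (β := 𝔅.autAct (c i)) (hj (c i)) (V i))
    (𝔄.relProd f V).invariants fun v g => by
      simp only [MultilinearMap.compLinearMap_apply, relTmul_ρ, ρ_invIncl]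

theorem invIncl_invTmul (v : ∀ i, invMods hj V i) :
    invIncl (hj t) _ (invTmul hj f V v) = 𝔄.relTmul f V fun i => invIncl (hj (c i)) (V i) (v i) :=
  rfl

variable {f V} in
theorem invIncl_update (v : ∀ i, invMods hj V i) (i : ι) (z : invMods hj V i) :
    (fun k => invIncl (hj (c k)) (V k) (Function.update v i z k)) =
      Function.update (fun k => invIncl (hj (c k)) (V k) (v k)) i (invIncl (hj (c i)) (V i) z) := by
  funext k
  by_cases hk : k = i
  · subst hk; simp
  · simp [hk]

/-- The comparison map from products of invariants to the invariants of a product. -/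
def invSqHom : 𝔅.relProd f (invMods hj V) ⟶ invMod (𝔅.autAct t) (hj t) (𝔄.relProd f V) :=
  relDesc (invTmul hj f V)
    (fun v i b => invIncl_injective (hj t) (by
      rw [invIncl_act, invIncl_invTmul, invIncl_invTmul, invIncl_update, invIncl_act, relTmul_act,
        hn]))
    (fun _ _ => rfl)

theorem invSqHom_relTmul (v : ∀ i, invMods hj V i) :
    lin (invSqHom hj hn f V) (𝔅.relTmul f (invMods hj V) v) = invTmul hj f V v := by
  unfold invSqHom
  exact relDesc_relTmul _ _ _ _

theorem invSqHom_relMk (v : ∀ i, invMods hj V i) (b : 𝔅.alg t) :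
    lin (invSqHom hj hn f V) (𝔅.relMk f (invMods hj V) v b) =
      (invMod (𝔅.autAct t) (hj t) (𝔄.relProd f V)).act (invTmul hj f V v) b := by
  rw [relMk_eq, lin_act, invSqHom_relTmul]

theorem relTmul_act_invIncl [Finite ι] (w : ∀ i, invMods hj V i) (a : ∀ i, 𝔄.alg (c i))
    (b : 𝔄.alg t) :
    𝔄.relMk f V (fun i => (V i).act (invIncl (hj (c i)) (V i) (w i)) (a i)) b =
      (𝔄.relProd f V).act (invIncl (hj t) _ (invTmul hj f V w)) (𝔄.mulAlong f a * b) := by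
  rw [relMk_eq, relTmul_act_all V (fun i => invIncl (hj (c i)) (V i) (w i)) a, ← act_mul,
    invIncl_invTmul]

variable [Fintype G] [Invertible (Fintype.card G : K)] [Finite ι]
  (hα : ∀ c, IsGaloisAction (𝔄.autAct c))

include hα

/-- The invariants of a product are spanned by the averages of its elements. As the factors are
spanned by their invariants, these are products of invariants, acted upon by conditional
expectations. -/
theorem invSqHom_surjective : Function.Surjective (lin (invSqHom hj hn f V)) := by
  let R := LinearMap.range (lin (invSqHom hj hn f V))
  let P := avg (β := 𝔅.autAct t) (hj t) (𝔄.relProd f V)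
  have h1 : R.comap P = ⊤ := by
    refine relProd_span fun v b => ?_
    let Φ := (R.mkQ ∘ₗ P ∘ₗ LinearMap.applyₗ b).compMultilinearMap (𝔄.relMk f V)
    have h2 : Φ = 0 := MultilinearMap.ext_of_span_eq_top
      (fun i => span_act_invIncl (𝔅.autAct (c i)) (hj (c i)) (hα (c i)) (V i)) fun s => by
        refine (Submodule.Quotient.mk_eq_zero R).2 ?_
        refine ⟨𝔅.relMk f (invMods hj V) (fun i => (s i).1)
          (condExp (hj t) (𝔄.mulAlong f (fun i => (s i).2) * b)), ?_⟩
        rw [invSqHom_relMk, ← avg_act, ← relTmul_act_invIncl]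
        rfl
    have h3 : Φ v = 0 := by rw [h2]; rfl
    rw [← relMk_eq]
    exact (Submodule.Quotient.mk_eq_zero R).1 h3
  intro z
  have h2 : invIncl (hj t) _ z ∈ R.comap P := by rw [h1]; trivial
  have h3 : P (invIncl (hj t) _ z) ∈ R := h2
  rwa [show P (invIncl (hj t) _ z) = z from avg_invIncl _ _] at h3

include hn in
/-- There is a multilinear map that sends `(wᵢ aᵢ)ᵢ` and `b`, for invariant `wᵢ`, to the product of the
`wᵢ`, acted upon by the conditional expectation of `(∏ᵢ aᵢ) b`. The `wᵢ aᵢ` span the factors but are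
not linearly independent; the frame shows that the values are linear in each of the factors. -/
theorem exists_invSq_multilinear : ∃ Ψ : MultilinearMap K (fun i => (V i : Type u))
    (𝔄.alg t →ₗ[K] 𝔅.RelTensor f (invMods hj V)), ∀ (w : ∀ i, invMods hj V i) a b,
      Ψ (fun i => (V i).act (invIncl (hj (c i)) (V i) (w i)) (a i)) b =
        𝔅.relMk f (invMods hj V) w (condExp (hj t) (𝔄.mulAlong f a * b)) := by
  let val : (∀ i, invMods hj V i × 𝔄.alg (c i)) →
      (𝔄.alg t →ₗ[K] 𝔅.RelTensor f (invMods hj V)) := fun s =>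
    𝔅.relMk f (invMods hj V) (fun i => (s i).1) ∘ₗ condExp (hj t) ∘ₗ
      LinearMap.mulLeft K (𝔄.mulAlong f fun i => (s i).2)
  obtain ⟨Ψ, hΨ⟩ := exists_multilinear_extension (K := K)
    (fun i (s : invMods hj V i × 𝔄.alg (c i)) => (V i).act (invIncl (hj (c i)) (V i) s.1) s.2)
    (fun i => span_act_invIncl (𝔅.autAct (c i)) (hj (c i)) (hα (c i)) (V i)) val (by
      intro i s
      obtain ⟨n, x, y, -, h2⟩ := exists_frame (𝔅.autAct (c i)) (hj (c i)) (hα (c i))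
      let ws : ∀ k, invMods hj V k := fun k => (s k).1
      let as : ∀ k, 𝔄.alg (c k) := fun k => (s k).2
      let m : Fin n → 𝔄.alg t := fun k => 𝔄.mulAlong f (Function.update as i (y k))
      refine ⟨∑ k, LinearMap.lcomp K _ (condExp (hj t) ∘ₗ LinearMap.mulLeft K (m k)) ∘ₗ
        (𝔅.relMk f (invMods hj V)).toLinearMap ws i ∘ₗ avg (hj (c i)) (V i) ∘ₗ
          (V i).act.flip (x k), fun p => ?_⟩
      obtain ⟨w, a⟩ := p
      have h3 : ∀ (z : invMods hj V i) (b : 𝔄.alg (c i)), val (Function.update s i (z, b)) =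
          𝔅.relMk f (invMods hj V) (Function.update ws i z) ∘ₗ condExp (hj t) ∘ₗ
            LinearMap.mulLeft K (𝔄.mulAlong f (Function.update as i b)) := by
        intro z b
        have h4 : (fun k => (Function.update s i (z, b) k).1) = Function.update ws i z := by
          funext k
          by_cases hk : k = i
          · subst hk; simp
          · simp [hk, ws]
        have h5 : (fun k => (Function.update s i (z, b) k).2) = Function.update as i b := by
          funext k
          by_cases hk : k = i
          · subst hk; simp
          · simp [hk, as]
        simp only [val, h4, h5]
      rw [h3]
      ext e
      have h4 : ∀ k, 𝔅.relMk f (invMods hj V) (Function.update ws i (avg (hj (c i)) (V i)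
          ((V i).act ((V i).act (invIncl (hj (c i)) (V i) w) a) (x k)))) (condExp (hj t) (m k * e)) =
            𝔅.relMk f (invMods hj V) (Function.update ws i w) (condExp (hj t)
              (𝔄.map (f.hom i) (j (c i) (condExp (hj (c i)) (a * x k)) * y k) *
                (𝔄.mulAlong f (Function.update as i 1) * e))) := by
        intro k
        have h5 := 𝔅.relMk_act f (invMods hj V) (Function.update ws i w) i
          (condExp (hj (c i)) (a * x k)) (condExp (hj t) (m k * e))
        rw [Function.update_self, Function.update_idem] at h5
        rw [← act_mul, avg_act, h5, ← condExp_mul, hn, map_mul (𝔄.map (f.hom i))]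
        simp only [m]
        rw [mulAlong_update, mul_assoc, mul_assoc]
      simp only [LinearMap.sum_apply, LinearMap.comp_apply, LinearMap.lcomp_apply,
        LinearMap.flip_apply, MultilinearMap.toLinearMap_apply, LinearMap.mulLeft_apply]
      rw [Finset.sum_congr rfl fun k _ => h4 k, ← map_sum, ← map_sum, ← Finset.sum_mul, ← map_sum,
        h2, ← mul_assoc, ← mulAlong_update])
  refine ⟨Ψ, fun w a b => ?_⟩
  exact LinearMap.congr_fun (hΨ fun i => (w i, a i)) b

/-- The multilinear map of `exists_invSq_multilinear` is balanced and induces a retraction of the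
comparison map. -/
theorem invSqHom_injective : Function.Injective (lin (invSqHom hj hn f V)) := by
  obtain ⟨Ψ, hΨ⟩ := exists_invSq_multilinear hj hn f V hα
  have h1 : ∀ v (i : ι) a b, Ψ (Function.update v i ((V i).act (v i) a)) b =
      Ψ v (𝔄.map (f.hom i) a * b) := by
    intro v i a b
    -- both sides are multilinear in `v`, so that it suffices to compare them on the `wᵢ aᵢ`
    let M : MultilinearMap K (fun i => (V i : Type u))
        (𝔄.alg t →ₗ[K] 𝔅.RelTensor f (invMods hj V)) :=
      Ψ.compLinearMap (Function.update (fun k => LinearMap.id) i ((V i).act.flip a))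
    have hM : ∀ y, M y = Ψ (Function.update y i ((V i).act (y i) a)) := by
      intro y
      refine congrArg Ψ (funext fun k => ?_)
      by_cases hk : k = i
      · subst hk; simp
      · simp [hk]
    have h3 : M = (LinearMap.lcomp K _
        (LinearMap.mulLeft K (𝔄.map (f.hom i) a))).compMultilinearMap Ψ :=
      MultilinearMap.ext_of_span_eq_top
        (fun i => span_act_invIncl (𝔅.autAct (c i)) (hj (c i)) (hα (c i)) (V i)) fun s => by
          have h4 : Function.update (fun k => (V k).act (invIncl (hj (c k)) (V k) (s k).1) (s k).2) i
              ((V i).act ((V i).act (invIncl (hj (c i)) (V i) (s i).1) (s i).2) a) =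
                fun k => (V k).act (invIncl (hj (c k)) (V k) (s k).1)
                  (Function.update (fun k => (s k).2) i ((s i).2 * a) k) := by
            funext k
            by_cases hk : k = i
            · subst hk; simp [act_mul]
            · simp [hk]
          ext e
          rw [hM, h4, hΨ, mulAlong_update_mul, LinearMap.compMultilinearMap_apply,
            LinearMap.lcomp_apply, hΨ, LinearMap.mulLeft_apply, mul_assoc]
    rw [← hM, h3]
    rfl
  let r : 𝔄.relProd f V →ₗ[K] 𝔅.relProd f (invMods hj V) := 𝔄.relLift f V Ψ h1
  have h2 : r ∘ₗ invIncl (hj t) _ ∘ₗ lin (invSqHom hj hn f V) = LinearMap.id := by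
    refine relProd_lin_ext fun w b => ?_
    have h3 := hΨ w 1 (j t b)
    simp only [Pi.one_apply, act_one, map_one, one_mul, condExp_map] at h3
    rw [LinearMap.comp_apply, LinearMap.comp_apply, lin_act, invSqHom_relTmul, invIncl_act,
      invIncl_invTmul, ← relMk_eq, ← relMk_eq]
    exact (relLift_relMk Ψ h1 _ _).trans h3
  exact Function.LeftInverse.injective (g := r ∘ₗ invIncl (hj t) _) fun z =>
    LinearMap.congr_fun h2 z

end

end GAQFT

/-! ### The 1-morphism of invariants -/

namespace GAQFT

open GMod

variable {K : Type u} [CommRing K] {C : Type w} [Category.{v} C] [Orthogonality C]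
  {G : Type u} [Group G] {𝔄 : GAQFT.{u, v, w} K C G} {𝔅 : GAQFT.{u, v, w} K C PUnit.{u + 1}}
  {j : ∀ c, 𝔅.alg c →ₐ[K] 𝔄.alg c} (hj : ∀ c, IsInvariants (𝔄.autAct c) (j c))
  (hn : ∀ {c t : C} (f : c ⟶ t) b, j t (𝔅.map f b) = 𝔄.map f (j c b))

/-- The functor of invariants for the algebra assigned to an object. -/
abbrev invFun (c : C) : GMod (𝔄.autAct c) ⥤ GMod (𝔅.autAct c) := invFunctor (𝔅.autAct c) (hj c)

theorem invSq_nat {ι : Type} {c : ι → C} {t : C} (f : Op c t) {x y : ∀ i, GMod (𝔄.autAct (c i))}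
    (φ : ∀ i, x i ⟶ y i) :
    relMap (fun i => (invFun hj (c i)).map (φ i)) ≫ invSqHom hj hn f y =
      invSqHom hj hn f x ≫ (invFun hj t).map (relMap φ) := by
  refine relProd_ext fun v => invIncl_injective (hj t) ?_
  have h1 := relMap_relTmul (f := f) (fun i => (invFun (𝔅 := 𝔅) hj (c i)).map (φ i)) v
  have h2 := invSqHom_relTmul hj hn f y fun i => lin ((invFun (𝔅 := 𝔅) hj (c i)).map (φ i)) (v i)
  have h3 := relMap_relTmul (f := f) φ fun i => invIncl (hj (c i)) (x i) (v i)
  refine (congrArg (invIncl (hj t) _) ((congrArg (lin (invSqHom hj hn f y)) h1).trans h2)).trans ?_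
  exact ((congrArg (fun z => lin (relMap (f := f) φ) (invIncl (hj t) _ z))
    (invSqHom_relTmul hj hn f x v)).trans h3).symm

theorem invSq_comp {ι : Type} [Finite ι] {κ : ι → Type} {a : ι → C}
    {b : ∀ i, κ i → C} {t : C} (f : Op a t) (g : ∀ i, Op (b i) (a i))
    (x : ∀ i j, GMod (𝔄.autAct (b i j))) :
    relMap (fun i => invSqHom hj hn (g i) (x i)) ≫
        invSqHom hj hn f (fun i => 𝔄.relProd (g i) (x i)) ≫ (invFun hj t).map (compIso f g x).hom =
      (compIso f g (fun i j => (invFun hj (b i j)).obj (x i j))).hom ≫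
        invSqHom hj hn (f.comp g) (fun s => x s.1 s.2) := by
  refine relProd_ext₂ fun v => invIncl_injective (hj t) ?_
  have h1 := compIso_hom f g (fun i j => (invFun (𝔅 := 𝔅) hj (b i j)).obj (x i j)) v
  have h2 := invSqHom_relTmul hj hn (f.comp g) (fun s => x s.1 s.2) (fun s => v s.1 s.2)
  have h3 := compIso_hom f g x fun i j => invIncl (hj (b i j)) (x i j) (v i j)
  have h4 := invSqHom_relTmul hj hn f (fun i => 𝔄.relProd (g i) (x i)) fun i =>
    invTmul hj (g i) (x i) (v i)
  have h5 := relMap_relTmul (f := f) (fun i => invSqHom hj hn (g i) (x i)) fun i =>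
    𝔅.relTmul (g i) (invMods hj (x i)) (v i)
  simp only [invSqHom_relTmul] at h5
  refine (congrArg (fun z => lin (compIso f g x).hom (invIncl (hj t) _ z))
    ((congrArg (lin (invSqHom hj hn f _)) h5).trans h4)).trans ?_
  refine Eq.trans h3 ?_
  exact (congrArg (invIncl (hj t) _) ((congrArg (lin (invSqHom hj hn _ _)) h1).trans h2)).symm

theorem invSq_unit (t : C) (x : GMod (𝔄.autAct t)) :
    (unitIso t ((invFun hj t).obj x)).hom ≫ invSqHom hj hn (Op.id t) (fun _ => x) =
      (invFun hj t).map (unitIso t x).hom := by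
  refine hom_ext fun v => invIncl_injective (hj t) ?_
  have h1 := unitIso_hom t ((invFun (𝔅 := 𝔅) hj t).obj x) v
  have h2 := invSqHom_relTmul hj hn (Op.id t) (fun _ => x) fun _ => v
  refine (congrArg (invIncl (hj t) _)
    ((congrArg (lin (invSqHom hj hn (Op.id t) _)) h1).trans h2)).trans ?_
  exact (unitIso_hom t x (invIncl (hj t) x v)).symm

theorem invSq_perm {ι ι' : Type} {c : ι → C} {t : C} (p : ι' → ι)
    (hp : p.Bijective) (f : Op c t) (f' : Op (fun i' => c (p i')) t)
    (h : ∀ i', f'.hom i' = f.hom (p i')) (x : ∀ i, GMod (𝔄.autAct (c i))) :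
    invSqHom hj hn f x ≫ (invFun hj t).map (permIso p hp f f' h x).hom =
      (permIso p hp f f' h (fun i => (invFun hj (c i)).obj (x i))).hom ≫
        invSqHom hj hn f' (fun i' => x (p i')) := by
  refine relProd_ext fun v => invIncl_injective (hj t) ?_
  have h1 := permIso_hom p hp f f' h (fun i => (invFun (𝔅 := 𝔅) hj (c i)).obj (x i)) v
  have h2 := invSqHom_relTmul hj hn f' (fun i' => x (p i')) fun i' => v (p i')
  have h3 := permIso_hom p hp f f' h x fun i => invIncl (hj (c i)) (x i) (v i)
  refine (congrArg (fun z => lin (permIso p hp f f' h x).hom (invIncl (hj t) _ z))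
    (invSqHom_relTmul hj hn f x v)).trans (Eq.trans h3 ?_)
  exact (congrArg (invIncl (hj t) _) ((congrArg (lin (invSqHom hj hn _ _)) h1).trans h2)).symm

variable [Fintype G] [Invertible (Fintype.card G : K)] (hα : ∀ c, IsGaloisAction (𝔄.autAct c))

include hα in
theorem invFun_isEquivalence (c : C) : (invFun (𝔅 := 𝔅) hj c).IsEquivalence where
  faithful := invFunctor_faithful (hj c) (hα c)
  full := invFunctor_full (hj c) (hα c)
  essSurj := invFunctor_essSurj (hj c)

include hα in
theorem invFun_lin (c : C) :
    IsLinCocont (D := 𝔄.gmodCat c) (E := 𝔅.gmodCat c) (invFun hj c) where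
  additive := ⟨rfl⟩
  linear := ⟨fun _ _ => rfl⟩
  cocont :=
    have := invFun_isEquivalence (𝔅 := 𝔅) hj hα c
    inferInstanceAs (PreservesColimitsOfSize.{u, u} (invFun (𝔅 := 𝔅) hj c))

/-- Taking invariants, as a 1-morphism between categorified orbifold theories. -/
def invOneHom : TwoAQFT.OneHom 𝔄.gauging 𝔅.gauging where
  app c := invFun hj c
  app_lin c := invFun_lin hj hα c
  sq f x := isoOfBijective (invSqHom hj hn f x)
    ⟨invSqHom_injective hj hn f x hα, invSqHom_surjective hj hn f x hα⟩
  sq_nat f _ _ φ := invSq_nat hj hn f φ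
  sq_comp f g x := invSq_comp hj hn f g x
  sq_unit t x := invSq_unit hj hn t x
  sq_perm p hp f f' h x := invSq_perm hj hn p hp f f' h x

end GAQFT

/-! ### Galois actions give truncated theories -/

namespace TwoAQFT

variable {K : Type u} [CommRing K] {C : Type w} [Category.{v} C] [Orthogonality C]
  {S T : TwoAQFT.{u, v, w} K C} (η : OneHom S T) [∀ c, (η.app c).IsEquivalence]

/-- A diagram chase in arbitrary categories, applied in `ptIso_inverse`. -/
theorem OneHom.ptIso_inverse_aux {D E : Type*} [Category D] [Category E] {F : D ⥤ E} {X Y Z : D}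
    {P A B : E} {a : P ⟶ A} {s : A ⟶ F.obj X} {m : X ⟶ Y} {n : Y ⟶ Z} {k : F.obj Z ⟶ P} {b : A ⟶ B}
    {s' : B ⟶ F.obj Y} (h1 : b ≫ s' = s ≫ F.map m) (h2 : 𝟙 P = (a ≫ b) ≫ s' ≫ F.map n ≫ k) :
    (a ≫ s) ≫ F.map (m ≫ n) ≫ k = 𝟙 P := by
  rw [h2, Functor.map_comp, Category.assoc, Category.assoc, Category.assoc, ← reassoc_of% h1]

/-- The quasi-inverse preserves the pointings by the mate of the isomorphism for `η`. -/
theorem OneHom.ptIso_inverse (c : C) :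
    (η.ptIso c).hom ≫ (η.app c).map (η.inverse.ptIso c).hom ≫ (η.invCounit c (T.pt c)).hom =
      𝟙 _ := by
  let x : ∀ e : Empty, S.cat (e.elim : C) := fun e => e.elim
  let y : ∀ e : Empty, T.cat (e.elim : C) := fun e => e.elim
  let e₁ : ∀ e : Empty, y e ⟶ (η.app (e.elim : C)).obj (x e) := fun e => e.elim
  let e₂ : ∀ e : Empty, x e ⟶ (η.app (e.elim : C)).inv.obj (y e) := fun e => e.elim
  have h1 := η.sq_nat (Op.nil c) e₂
  have h2 := η.invSq_spec (Op.nil c) y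
  have h3 := T.map_comp' (Op.nil c) e₁ fun e => (η.app (e.elim : C)).map (e₂ e)
  have h4 := T.map_comp' (Op.nil c) (fun e => e₁ e ≫ (η.app (e.elim : C)).map (e₂ e))
    fun e => (η.invCounit (e.elim : C) (y e)).hom
  have h5 : (fun e => (e₁ e ≫ (η.app (e.elim : C)).map (e₂ e)) ≫
      (η.invCounit (e.elim : C) (y e)).hom) = fun e => 𝟙 (y e) := funext fun e => e.elim
  rw [h5, T.map_id', h3, ← h2] at h4
  have h6 : (η.ptIso c).hom = (T.prod (Op.nil c)).map e₁ ≫ (η.sq (Op.nil c) x).hom :=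
    congrArg (fun z => (T.prod (Op.nil c)).map z ≫ (η.sq (Op.nil c) x).hom)
      (funext fun e => e.elim)
  have h7 : (η.inverse.ptIso c).hom = (S.prod (Op.nil c)).map e₂ ≫ (η.invSq (Op.nil c) y).hom :=
    congrArg (fun z => (S.prod (Op.nil c)).map z ≫ (η.invSq (Op.nil c) y).hom)
      (funext fun e => e.elim)
  exact (congrArg₂ (fun p q => p ≫ (η.app c).map q ≫ (η.invCounit c (T.pt c)).hom) h6 h7).trans
    (ptIso_inverse_aux h1 h4)

/-- If `η` intertwines endomorphisms `h` and `m` of the pointings, then so does its quasi-inverse. -/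
theorem OneHom.inverse_ptIso_conj (c : C) (h : S.pt c ⟶ S.pt c) (m : T.pt c ⟶ T.pt c)
    (e : (η.ptIso c).hom ≫ (η.app c).map h = m ≫ (η.ptIso c).hom) :
    (η.inverse.ptIso c).hom ≫ (η.inverse.app c).map m ≫ (η.inverse.ptIso c).inv = h := by
  let q : S.pt c ≅ (η.app c).inv.obj (T.pt c) := η.inverse.ptIso c
  have h1 : (η.app c).map q.hom ≫ (η.invCounit c (T.pt c)).hom = (η.ptIso c).inv := by
    rw [← Category.comp_id (η.ptIso c).inv, Iso.eq_inv_comp]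
    exact η.ptIso_inverse c
  change q.hom ≫ (η.app c).inv.map m ≫ q.inv = h
  rw [← Category.assoc, Iso.comp_inv_eq]
  refine η.inv_hom_ext ?_
  rw [Functor.map_comp, Functor.map_comp, Category.assoc, Category.assoc, h1, η.invCounit_nat,
    reassoc_of% h1, Iso.inv_comp_eq, reassoc_of% e, Iso.hom_inv_id, Category.comp_id]

end TwoAQFT

namespace GAQFT

open GMod

variable {K : Type u} [CommRing K] {C : Type w} [Category.{v} C] [Orthogonality C]
  {G : Type u} [Group G] (𝔄 : GAQFT.{u, v, w} K C G)

/-- The truncation of the categorified orbifold theory, as an equivariant AQFT for the trivial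
group. -/
def trunc : GAQFT.{u, v, w} K C PUnit.{u + 1} := 𝔄.gauging.truncation.toGAQFT

/-- The inclusion of the truncation into the underlying AQFT. -/
def truncIncl (c : C) : 𝔄.trunc.alg c →ₐ[K] 𝔄.alg c := 𝔄.truncHom c

theorem truncIncl_isInvariants (c : C) : IsInvariants (𝔄.autAct c) (𝔄.truncIncl c) where
  injective := 𝔄.truncHom_injective c
  invariant g x := 𝔄.truncHom_invariant c x g
  exists_eq a ha := 𝔄.exists_truncHom_eq c a ha

theorem truncIncl_map {c t : C} (f : c ⟶ t) (x : 𝔄.trunc.alg c) :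
    𝔄.truncIncl t (𝔄.trunc.map f x) = 𝔄.map f (𝔄.truncIncl c x) := 𝔄.truncHom_map f x

variable [Fintype G] [Invertible (Fintype.card G : K)] (hα : ∀ c, IsGaloisAction (𝔄.autAct c))

/-- The 1-morphism of invariants from the categorified orbifold theory to the inclusion of its
truncation. It is a quasi-inverse of the counit. -/
def orbifoldInv : TwoAQFT.OneHom 𝔄.gauging 𝔄.gauging.truncation.inclusion :=
  invOneHom (𝔅 := 𝔄.trunc) 𝔄.truncIncl_isInvariants 𝔄.truncIncl_map hα

/-- The 1-morphism of invariants sends an endomorphism of the pointing to the left multiplication by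
it, which is the condition that characterizes the counit. -/
theorem orbifoldInv_ptIso (c : C) (h : 𝔄.ptMod c ⟶ 𝔄.ptMod c) :
    ((𝔄.orbifoldInv hα).ptIso c).hom ≫ ((𝔄.orbifoldInv hα).app c).map h =
      𝔄.gauging.truncation.leftMul c h ≫ ((𝔄.orbifoldInv hα).ptIso c).hom := by
  let hj := 𝔄.truncIncl_isInvariants
  let p : 𝔄.trunc.ptMod c ⟶ (invFun hj c).obj (𝔄.ptMod c) := ((𝔄.orbifoldInv hα).ptIso c).hom
  let m : 𝔄.trunc.ptMod c ⟶ 𝔄.trunc.ptMod c := 𝔄.gauging.truncation.leftMul c h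
  have h1 : invIncl (hj c) _ (lin p (𝔄.trunc.ptGen c)) = 𝔄.ptGen c := by
    let x : ∀ e : Empty, GMod (𝔄.autAct (e.elim : C)) := fun e => e.elim
    let e₁ : ∀ e : Empty, 𝔄.trunc.nilMod e ⟶ invMods hj x e := fun e => e.elim
    have h2 := invSqHom_relTmul hj 𝔄.truncIncl_map (Op.nil c) x fun e => e.elim
    have h3 : lin (relMap (f := Op.nil c) e₁) (𝔄.trunc.ptGen c) =
        𝔄.trunc.relTmul (Op.nil c) (invMods hj x) fun e => e.elim :=
      (relMap_relTmul e₁ _).trans (congrArg _ (funext fun e => e.elim))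
    have h4 : p = relMap (f := Op.nil c) e₁ ≫ invSqHom hj 𝔄.truncIncl_map (Op.nil c) x :=
      congrArg (fun z => relMap (f := Op.nil c) z ≫ invSqHom hj 𝔄.truncIncl_map (Op.nil c) x)
        (funext fun e => e.elim)
    rw [h4]
    refine (congrArg (invIncl (hj c) _) ((congrArg (lin (invSqHom hj 𝔄.truncIncl_map _ x))
      h3).trans h2)).trans ?_
    exact congrArg (𝔄.relTmul (Op.nil c) x) (funext fun e => e.elim)
  have h2 : lin m (𝔄.trunc.ptGen c) = (𝔄.trunc.ptMod c).act (𝔄.trunc.ptGen c) h :=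
    ptDesc_ptGen _ fun g => by
      obtain rfl : g = 1 := rfl
      rw [map_one]
      rfl
  have h3 : p ≫ (invFun hj c).map h = m ≫ p := ptMod_ext (invIncl_injective (hj c) (by
    refine (congrArg (lin h) h1).trans (Eq.trans (𝔄.act_endElem c h).symm ?_)
    refine Eq.trans (congrArg (fun z => (𝔄.ptMod c).act z (𝔄.endElem c h)) h1.symm) ?_
    exact congrArg (invIncl (hj c) _) ((congrArg (lin p) h2).trans (lin_act p _ _)).symm))
  exact h3

include hα in
/-- If the group acts on all algebras by Galois actions and its order is invertible, then the
categorified orbifold theory is truncated. -/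
theorem gauging_truncated : 𝔄.gauging.Truncated :=
  have : ∀ c, ((𝔄.orbifoldInv hα).app c).IsEquivalence := fun c =>
    invFun_isEquivalence (𝔅 := 𝔄.trunc) 𝔄.truncIncl_isInvariants hα c
  ⟨(𝔄.orbifoldInv hα).inverse,
    fun c h => (𝔄.orbifoldInv hα).inverse_ptIso_conj c h _ (𝔄.orbifoldInv_ptIso hα c h),
    𝔄.orbifoldInv hα, (𝔄.orbifoldInv hα).inverse_comp_isomorphic,
    (𝔄.orbifoldInv hα).comp_inverse_isomorphic⟩

end GAQFT

/-! ### A criterion for non-truncatedness -/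

namespace TwoAQFT

variable {K : Type u} [CommRing K] {C : Type w} [Category.{v} C] [Orthogonality C]
  {S T : TwoAQFT.{u, v, w} K C}

/-- The components of an equivalence of 2AQFTs are equivalences of categories. -/
theorem OneHom.IsEquiv.isEquivalence_app {η : OneHom S T} (h : η.IsEquiv) (c : C) :
    (η.app c).IsEquivalence := by
  obtain ⟨θ, ⟨Γ, Δ, h1⟩, Γ', Δ', h2⟩ := h
  let e : S.cat c ≌ T.cat c := CategoryTheory.Equivalence.mk (η.app c) (θ.app c)
    ⟨Δ.app c, Γ.app c, (h1 c).2, (h1 c).1⟩ ⟨Γ'.app c, Δ'.app c, (h2 c).1, (h2 c).2⟩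
  exact e.isEquivalence_functor

/-- An equivalence of 2AQFTs carries a separating pointing to a separating pointing. -/
theorem OneHom.IsEquiv.pt_separates {η : OneHom S T} (h : η.IsEquiv) (c : C)
    (hS : ∀ {X Y : S.cat c} (φ : X ⟶ Y), (∀ g : S.pt c ⟶ X, g ≫ φ = 0) → φ = 0)
    {X Y : T.cat c} (φ : X ⟶ Y) (hφ : ∀ g : T.pt c ⟶ X, g ≫ φ = 0) : φ = 0 := by
  have := h.isEquivalence_app c
  obtain ⟨_, _, _⟩ := η.app_lin c
  let i := (η.app c).objObjPreimageIso X
  let i' := (η.app c).objObjPreimageIso Y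
  let φ' := (η.app c).preimage (i.hom ≫ φ ≫ i'.inv)
  have h1 : (η.app c).map φ' = i.hom ≫ φ ≫ i'.inv := (η.app c).map_preimage _
  have h2 : φ' = 0 := hS φ' fun g => (η.app c).map_injective (by
    have h3 := hφ ((η.ptIso c).hom ≫ (η.app c).map g ≫ i.hom)
    rw [Category.assoc, Preadditive.IsIso.comp_left_eq_zero, Category.assoc] at h3
    rw [Functor.map_comp, h1, reassoc_of% h3, zero_comp, Functor.map_zero])
  rw [h2, Functor.map_zero, eq_comm, Preadditive.IsIso.comp_left_eq_zero,
    Preadditive.IsIso.comp_right_eq_zero] at h1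
  exact h1

end TwoAQFT

namespace GMod

variable {K A G : Type u} [CommRing K] [Ring A] [Algebra K A] [Group G] {α : G →* (A →ₐ[K] A)}

/-- The twist of an equivariant module by a character of the group. -/
def twist (V : GMod α) (σ : G →* K) : GMod α where
  carrier := V
  act := V.act
  act_one := V.act_one
  act_mul := V.act_mul
  ρ :=
  { toFun := fun g => σ g • V.ρ g
    map_one' := by rw [map_one, map_one, one_smul]
    map_mul' := fun g h => by rw [map_mul, map_mul, smul_mul_smul_comm] }
  ρ_act g v a := by simp [ρ_act]

/-- An invariant character of an algebra, as an equivariant module. -/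
def ofCharacter (R : Type u) [CommRing R] [Algebra K R] (χ : A →ₐ[K] R)
    (hχ : ∀ g a, χ (α g a) = χ a) : GMod α where
  carrier := R
  act := LinearMap.lcomp K R χ.toLinearMap ∘ₗ LinearMap.mul K R
  act_one v := by simp
  act_mul v a b := by simp [mul_assoc]
  ρ := 1
  ρ_act g v a := by simp [hχ]

end GMod

namespace GAQFT

open GMod

/-- The pointing of a truncated categorified orbifold theory is a separator: this holds for the
free module of rank one over the endomorphism algebra, to which it corresponds. -/
theorem eq_zero_of_truncated {K : Type u} [CommRing K] {C : Type w} [Category.{v} C]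
    [Orthogonality C] {G : Type u} [Group G] {𝔄 : GAQFT.{u, v, w} K C G}
    (h : 𝔄.gauging.Truncated) {c : C} {X Y : GMod (𝔄.autAct c)} (φ : X ⟶ Y)
    (hφ : ∀ x, (∀ g, X.ρ g x = x) → lin φ x = 0) : φ = 0 := by
  obtain ⟨ε, -, hε⟩ := h
  refine hε.pt_separates c (fun {M N} ψ hψ => ?_) φ fun g => ?_
  · have h1 : ∀ {M N : GMod (𝔄.trunc.autAct c)} (ψ : M ⟶ N),
        (∀ g : 𝔄.trunc.ptMod c ⟶ M, g ≫ ψ = 0) → ψ = 0 := by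
      intro M N ψ hψ
      refine hom_ext fun m => ?_
      have h2 : ∀ g, M.ρ g m = m := fun g => by
        obtain rfl : g = 1 := rfl
        rw [map_one]
        rfl
      have h3 := LinearMap.congr_fun (congrArg lin (hψ (ptDesc m h2))) (𝔄.trunc.ptGen c)
      rwa [lin_comp, LinearMap.comp_apply, ptDesc_ptGen] at h3
    exact h1 ψ hψ
  · let g' : 𝔄.ptMod c ⟶ X := g
    refine ptMod_ext (φ := g' ≫ φ) (ψ := 0) ?_
    rw [lin_comp, LinearMap.comp_apply]
    exact hφ _ fun k => by rw [← lin_ρ, ptGen_ρ]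

variable {K : Type} [CommRing K] {C : Type w} [Category.{v} C] [Orthogonality C]
  {𝔄 : GAQFT.{0, v, w} K C ℤˣ}

/-- If some algebra of a theory with `ℤ₂`-action has a character that vanishes on its odd part, then
the categorified orbifold theory is not truncated: the character is a non-zero morphism from the
sign-twisted regular module that vanishes on the invariants, which are the odd elements. -/
theorem not_truncated_of_character (c : C) {R : Type} [CommRing R] [Algebra K R] [Nontrivial R]
    (χ : 𝔄.alg c →ₐ[K] R) (hχ : ∀ g a, χ (𝔄.autAct c g a) = χ a)
    (hodd : ∀ a ∈ oddPart (𝔄.autAct c), χ a = 0) : ¬ 𝔄.gauging.Truncated := by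
  intro h
  let σ : ℤˣ →* K := (Int.castRingHom K : ℤ →* K).comp (Units.coeHom ℤ)
  have hm : ∀ v a : 𝔄.alg c, χ (v * a) = χ v * χ a := map_mul χ
  have hρ : ∀ g (v : 𝔄.alg c), χ (σ g • 𝔄.autAct c g v) = σ g • χ v := fun g v => by
    rw [map_smul, hχ]
  have ho : ∀ v : 𝔄.alg c, σ (-1) • 𝔄.autAct c (-1) v = v → v ∈ oddPart (𝔄.autAct c) := by
    intro v hv
    have h1 : σ (-1) = -1 := by simp [σ]
    rw [h1, neg_one_smul] at hv
    exact neg_eq_iff_eq_neg.1 hv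
  let φ : (regular (𝔄.autAct c)).twist σ ⟶ (ofCharacter R χ hχ).twist σ :=
    mk' χ.toLinearMap (fun v a => hm v a) fun g v => hρ g v
  have h1 : φ = 0 := eq_zero_of_truncated h φ fun x hx => hodd x (ho x (hx (-1)))
  have h2 : χ 1 = 0 := LinearMap.congr_fun (congrArg lin h1) (1 : 𝔄.alg c)
  rw [map_one] at h2
  exact one_ne_zero h2

end GAQFT

/-! ### Even and odd parts -/

section Parity

variable {K A : Type} [CommRing K] [Ring A] [Algebra K A] {α : ℤˣ →* (A →ₐ[K] A)}

/-- If `1` is a sum of products of odd elements, then the multiplication `V ⊗_B V → B` is bijective: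
for `∑ᵢ vᵢ wᵢ = 1`, its inverse is `b ↦ ∑ᵢ b vᵢ ⊗ wᵢ`. -/
theorem oddMul_bijective {n : ℕ} {v w : Fin n → Odd α} (h : ∑ i, (v i).1 * (w i).1 = 1) :
    Function.Bijective (oddMul α) := by
  have h1 : ∀ t, t = ∑ i, (oddRelations α).mkQ ((v i).evenMul (oddMul α t) ⊗ₜ[K] w i) := by
    intro t
    obtain ⟨t, rfl⟩ := (oddRelations α).mkQ_surjective t
    induction t with
    | zero =>
      have h2 : ∀ i, (v i).evenMul (0 : evenPart α) = 0 := fun i => Subtype.ext (zero_mul _)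
      simp only [map_zero, h2, zero_tmul, Finset.sum_const_zero]
    | tmul x y =>
      have h2 : ∀ i, (oddRelations α).mkQ ((v i).evenMul (oddMul α ((oddRelations α).mkQ (x ⊗ₜ[K] y)))
          ⊗ₜ[K] w i) = (oddRelations α).mkQ (x ⊗ₜ[K]
            ((w i).evenMul ⟨y.1 * (v i).1, odd_mul_odd y.2 (v i).2⟩)) := by
        intro i
        have h3 : (v i).evenMul (oddMul α ((oddRelations α).mkQ (x ⊗ₜ[K] y))) =
            x.mulEven ⟨y.1 * (v i).1, odd_mul_odd y.2 (v i).2⟩ := Subtype.ext (mul_assoc x.1 y.1 _)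
        rw [h3]
        exact (Submodule.Quotient.eq _).2 (Submodule.subset_span ⟨_, _, _, rfl⟩)
      have h4 : ∑ i, (w i).evenMul ⟨y.1 * (v i).1, odd_mul_odd y.2 (v i).2⟩ = y := by
        refine (oddPart α).subtype_injective ((map_sum (oddPart α).subtype _ _).trans ?_)
        change ∑ i, y.1 * (v i).1 * (w i).1 = y.1
        simp only [mul_assoc]
        rw [← Finset.mul_sum, h, mul_one]
      rw [Finset.sum_congr rfl fun i _ => h2 i, ← map_sum, ← tmul_sum, h4]
    | add x y hx hy =>
      have h2 : ∀ i (a b : evenPart α), (v i).evenMul (a + b) = (v i).evenMul a + (v i).evenMul b :=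
        fun i a b => Subtype.ext (add_mul _ _ _)
      simp only [map_add, h2, add_tmul, Finset.sum_add_distrib]
      rw [← hx, ← hy]
  refine ⟨fun s t hst => ?_, fun b => ⟨∑ i, (oddRelations α).mkQ ((v i).evenMul b ⊗ₜ[K] w i), ?_⟩⟩
  · rw [h1 s, h1 t, hst]
  · rw [map_sum]
    refine (evenPart α).toSubmodule.subtype_injective
      ((map_sum (evenPart α).toSubmodule.subtype _ _).trans ?_)
    change ∑ i, b.1 * (v i).1 * (w i).1 = b.1
    simp only [mul_assoc]
    rw [← Finset.mul_sum, h, mul_one]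

/-- If `1 = ∑ᵢ vᵢ wᵢ` is a sum of products of odd elements, then `(½, ½ v)` and `(1, w)` are Galois
coordinates. -/
theorem isGaloisAction_of_odd [Invertible (2 : K)] {n : ℕ} {v w : Fin n → Odd α}
    (h : ∑ i, (v i).1 * (w i).1 = 1) : GMod.IsGaloisAction α := by
  refine ⟨n + 1, Fin.cons (algebraMap K A ⅟2) fun i => (⅟2 : K) • (v i).1,
    Fin.cons 1 fun i => (w i).1, ?_, fun g hg => ?_⟩
  · simp only [Fin.sum_univ_succ, Fin.cons_zero, Fin.cons_succ, smul_mul_assoc, mul_one]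
    rw [← Finset.smul_sum, h, Algebra.smul_def, mul_one, ← map_add, invOf_two_add_invOf_two, map_one]
  · obtain rfl : g = -1 := (Int.units_eq_one_or g).resolve_left hg
    have h1 : ∀ i, α (-1) (v i).1 = -(v i).1 := fun i => (v i).2
    simp only [Fin.sum_univ_succ, Fin.cons_zero, Fin.cons_succ, AlgHom.commutes, map_smul, h1,
      mul_one, smul_neg, neg_mul, Finset.sum_neg_distrib, smul_mul_assoc]
    rw [← Finset.smul_sum, h, Algebra.smul_def, mul_one, add_neg_cancel]

/-- A character that vanishes on odd elements vanishes on their products, but not on `1`. -/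
theorem oddMul_not_surjective {R : Type} [CommRing R] [Algebra K R] [Nontrivial R] (χ : A →ₐ[K] R)
    (h : ∀ a ∈ oddPart α, χ a = 0) : ¬ Function.Surjective (oddMul α) := by
  intro hs
  obtain ⟨t, ht⟩ := hs 1
  have h1 : (χ.toLinearMap ∘ₗ (evenPart α).toSubmodule.subtype) ∘ₗ oddMul α ∘ₗ
      (oddRelations α).mkQ = 0 := by
    refine TensorProduct.ext' fun x y => ?_
    change χ (x.1 * y.1) = 0
    rw [map_mul, h _ x.2, zero_mul]
  obtain ⟨t, rfl⟩ := (oddRelations α).mkQ_surjective t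
  have h2 : χ (oddMul α ((oddRelations α).mkQ t)).1 = 0 := LinearMap.congr_fun h1 t
  rw [ht] at h2
  exact one_ne_zero ((map_one χ).symm.trans h2)

end Parity

/-! ### Characters of the chiral free boson -/

section Character

variable {K : Type} [CommRing K] [Algebra ℂ K] {h : K}

/-- The character of a CCR algebra that vanishes on the generators, with values in an algebra in
which the deformation parameter is zero. -/
def CCR.character {E : Type} [AddCommGroup E] [Module ℝ E] (σ : E → E → ℝ) (R : Type) [CommRing R]
    [Algebra K R] (hR : algebraMap K R h = 0) : CCR K h σ →ₐ[K] R :=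
  RingQuot.liftAlgHom K ⟨TensorAlgebra.lift K 0, by
    rintro _ _ ⟨x, y⟩
    simp [hR]⟩

theorem CCR.character_gen {E : Type} [AddCommGroup E] [Module ℝ E] (σ : E → E → ℝ) (R : Type)
    [CommRing R] [Algebra K R] (hR : algebraMap K R h = 0) (x : K ⊗[ℝ] E) :
    CCR.character σ R hR (CCR.gen K h σ x) = 0 := by
  refine (RingQuot.liftAlgHom_mkAlgHom_apply K _ _ _).trans ?_
  simp

variable (I : Disk)

theorem ccrSign_gen (u : ℤˣ) (x : K ⊗[ℝ] testFn I) :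
    ccrSign K h u I (CCR.gen K h (intervalForm I) x) =
      CCR.gen K h (intervalForm I) ((testFnSign u I).baseChange K x) :=
  CCR.map_gen K h _ _ _ _ x

variable (R : Type) [CommRing R] [Algebra K R] (hR : algebraMap K R h = 0)

theorem character_autAct (g : ℤˣ) (a : (chiralBoson K h).alg I) :
    CCR.character (intervalForm I) R hR ((chiralBoson K h).autAct I g a) =
      CCR.character (intervalForm I) R hR a := by
  have h1 : (CCR.character (intervalForm I) R hR).comp (ccrSign K h g I) =
      CCR.character (intervalForm I) R hR := CCR.hom_ext fun x => by
    rw [AlgHom.comp_apply, ccrSign_gen, CCR.character_gen, CCR.character_gen]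
  exact AlgHom.congr_fun h1 a

theorem character_odd (a : (chiralBoson K h).alg I)
    (ha : a ∈ oddPart ((chiralBoson K h).autAct I)) :
    CCR.character (intervalForm I) R hR a = 0 := by
  have h1 : (chiralBoson K h).autAct I (-1) a = -a := ha
  have h2 := character_autAct I R hR (-1) a
  rw [h1] at h2
  have h3 : ∀ (χ : ccrAlg K h I →ₐ[K] R) (b : ccrAlg K h I), χ (-b) = χ b → χ b = 0 := by
    intro χ b hb
    rw [map_neg, neg_eq_iff_add_eq_zero] at hb
    have h4 : (algebraMap K R (algebraMap ℂ K 2⁻¹)) * (2 * χ b) = χ b := by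
      rw [← mul_assoc, ← map_ofNat (algebraMap K R) 2, ← map_ofNat (algebraMap ℂ K) 2, ← map_mul,
        ← map_mul, inv_mul_cancel₀ two_ne_zero, map_one, map_one, one_mul]
    rw [← h4, two_mul, hb, mul_zero]
  exact h3 _ a h2

/-- The theory is not truncated if the deformation parameter is not invertible: the quotient by the
deformation parameter admits the character that vanishes on the generators. -/
theorem chiralBoson_not_truncated (hh : ¬ IsUnit h) : ¬ (chiralBoson K h).gauging.Truncated := by
  have : Nontrivial (K ⧸ Ideal.span {h}) :=
    Ideal.Quotient.nontrivial_iff.2 fun e => hh (Ideal.span_singleton_eq_top.1 e)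
  have hR : algebraMap K (K ⧸ Ideal.span {h}) h = 0 :=
    Ideal.Quotient.eq_zero_iff_mem.2 (Ideal.mem_span_singleton_self h)
  have hI : IsConnected (Circle.exp '' Set.Ioo 0 1) :=
    (isConnected_Ioo one_pos).image _ Circle.exp.continuous.continuousOn
  let I : Disk := ⟨⟨Circle.exp '' Set.Ioo 0 1, isLocalHomeomorph_circleExp.isOpenMap _ isOpen_Ioo⟩,
    hI, fun e => by
      obtain ⟨t, ht, h1⟩ : Circle.exp 1 ∈ Circle.exp '' Set.Ioo 0 1 :=
        (SetLike.ext_iff.1 e _).2 trivial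
      have h2 : t = 1 := Circle.exp_injOn_Icc (a := 0) (b := 1)
        (by linarith [Real.pi_gt_three]) ⟨ht.1.le, ht.2.le⟩ ⟨zero_le_one, le_rfl⟩ h1
      exact ht.2.ne h2⟩
  exact GAQFT.not_truncated_of_character I (CCR.character (intervalForm I) _ hR)
    (character_autAct I _ hR) (character_odd I _ hR)

/-- The multiplication `V ⊗_B V → B` is not surjective if the deformation parameter is zero. -/
theorem chiralBosonMul_not_surjective : ¬ Function.Surjective (chiralBosonMul ℂ 0 I) :=
  oddMul_not_surjective _ (character_odd I ℂ (map_zero _))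

end Character

/-! ### The chiral free boson at an invertible deformation parameter -/

/-- If the form of an interval is not zero, then `1` is a sum of products of two odd elements, by the
canonical commutation relation. -/
theorem chiralBoson_exists_odd {h : ℂ} (hh : h ≠ 0) {I : Disk} {φ ψ : testFn I}
    (hφ : intervalForm I φ ψ ≠ 0) : ∃ v w : Fin 2 → Odd ((chiralBoson ℂ h).autAct I),
      ∑ i, (v i).1 * (w i).1 = 1 := by
  let x : testFn I → Odd ((chiralBoson ℂ h).autAct I) := fun φ =>
    ⟨CCR.gen ℂ h (intervalForm I) (1 ⊗ₜ[ℝ] φ), by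
      have h1 : ccrSign ℂ h (-1) I (CCR.gen ℂ h (intervalForm I) (1 ⊗ₜ[ℝ] φ)) =
          -CCR.gen ℂ h (intervalForm I) (1 ⊗ₜ[ℝ] φ) := by
        have h2 : testFnSign (-1) I φ = -φ := by simp [testFnSign, Units.smul_def]
        rw [ccrSign_gen, LinearMap.baseChange_tmul, h2, tmul_neg, map_neg]
      exact h1⟩
  let r : ℂ := Complex.I * intervalForm I φ ψ * h
  have hr : r ≠ 0 := mul_ne_zero (mul_ne_zero Complex.I_ne_zero (Complex.ofReal_ne_zero.2 hφ)) hh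
  have h1 : (x φ).1 * (x ψ).1 - (x ψ).1 * (x φ).1 = algebraMap ℂ _ r :=
    CCR.gen_comm ℂ h (intervalForm I) φ ψ
  refine ⟨![r⁻¹ • x φ, -(r⁻¹ • x ψ)], ![x ψ, x φ], ?_⟩
  rw [Fin.sum_univ_two]
  change (r⁻¹ • (x φ).1) * (x ψ).1 + (-(r⁻¹ • (x ψ).1)) * (x φ).1 = 1
  rw [neg_mul, smul_mul_assoc, smul_mul_assoc, ← sub_eq_add_neg, ← smul_sub, h1,
    Algebra.smul_def, ← map_mul, inv_mul_cancel₀ hr, map_one]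

/-! ### Test functions with non-vanishing pairing -/

open Manifold ContDiff

/-- A smooth function on the plane restricts to a test function on an interval if the restriction
vanishes away from a closed ball that meets the circle inside of the interval. -/
theorem restrict_mem_testFn {I : Disk} {p : Circle} {r : ℝ}
    (hr : ∀ z : Circle, dist z p ≤ r → z ∈ I.1) {F : ℂ → ℝ} (hF : ContDiff ℝ ∞ F)
    (hF' : ∀ z : ℂ, F z ≠ 0 → dist z p ≤ r) : (fun z : Circle => F z) ∈ testFn I :=
  have := finrank_real_complex_fact'
  ⟨hF.contMDiff.comp (contMDiff_coe_sphere (E := ℂ)),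
    (closure_minimal (fun z hz => hF' z hz)
      (Metric.isClosed_closedBall (x := p) (ε := r)) :
      tsupport (fun z : Circle => F z) ⊆ Metric.closedBall p r).trans hr⟩

theorem hasDerivAt_circleExp_mul (p : ℂ) (θ : ℝ) :
    HasDerivAt (fun s : ℝ => ((Circle.exp s : ℂ) * p).im) ((Circle.exp θ : ℂ) * p).re θ := by
  have h1 : HasDerivAt (fun s : ℝ => (s : ℂ) * Complex.I) Complex.I θ := by
    simpa using (Complex.ofRealCLM.hasDerivAt (x := θ)).mul_const Complex.I
  have h2 := (h1.cexp.mul_const p)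
  have h3 := Complex.imCLM.hasFDerivAt.comp_hasDerivAt θ h2
  have h4 : (fun s : ℝ => ((Circle.exp s : ℂ) * p).im) =
      Complex.imCLM ∘ fun s : ℝ => Complex.exp (s * Complex.I) * p := by
    ext s
    rw [Circle.coe_exp]
    rfl
  rw [h4]
  refine h3.congr_deriv ?_
  rw [Circle.coe_exp, mul_right_comm]
  exact Complex.mul_I_im _

/-- The form of an interval is not zero: for the coordinates `x = cos(θ - θ₀)` and
`y = sin(θ - θ₀)` around a point of the interval and cutoff functions `b`, `c` with `b = 1` on the
support of `c`, one has `∫ (c x) d(b y) = ∫ c x² dθ > 0`. -/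
theorem exists_intervalForm_ne_zero (I : Disk) : ∃ φ ψ : testFn I, intervalForm I φ ψ ≠ 0 := by
  obtain ⟨p, hp⟩ := I.2.1.nonempty
  obtain ⟨ε, hε, hI⟩ := Metric.isOpen_iff.1 I.1.isOpen p hp
  let b : ContDiffBump (p : ℂ) := ⟨ε / 4, ε / 2, by positivity, by linarith⟩
  let c : ContDiffBump (p : ℂ) := ⟨ε / 8, ε / 4, by positivity, by linarith⟩
  have hr : ∀ z : Circle, dist z p ≤ ε / 2 → z ∈ I.1 := fun z hz =>
    hI (Metric.mem_ball.2 (hz.trans_lt (by linarith)))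
  have hb : ∀ z : ℂ, b z ≠ 0 → dist z p < ε / 2 := fun z hz => by
    by_contra! h
    exact hz (b.zero_of_le_dist h)
  have hc : ∀ z : ℂ, c z ≠ 0 → dist z p < ε / 4 := fun z hz => by
    by_contra! h
    exact hz (c.zero_of_le_dist h)
  let q : ℂ := (starRingEnd ℂ) p
  have hF : ContDiff ℝ ∞ fun z : ℂ => c z * (z * q).re :=
    c.contDiff.mul (Complex.reCLM.contDiff.comp (contDiff_id.mul contDiff_const))
  have hG : ContDiff ℝ ∞ fun z : ℂ => b z * (z * q).im :=
    b.contDiff.mul (Complex.imCLM.contDiff.comp (contDiff_id.mul contDiff_const))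
  refine ⟨⟨_, restrict_mem_testFn hr hF fun z hz =>
      (hc z (left_ne_zero_of_mul hz)).le.trans (by linarith)⟩,
    ⟨_, restrict_mem_testFn hr hG fun z hz => (hb z (left_ne_zero_of_mul hz)).le⟩, ne_of_gt ?_⟩
  have h1 : ∀ θ : ℝ, c (Circle.exp θ) * ((Circle.exp θ : ℂ) * q).re *
      deriv (fun s => b (Circle.exp s) * ((Circle.exp s : ℂ) * q).im) θ =
        c (Circle.exp θ) * ((Circle.exp θ : ℂ) * q).re ^ 2 := by
    intro θ
    by_cases h : c (Circle.exp θ) = 0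
    · rw [h, zero_mul, zero_mul, zero_mul]
    · have h2 : b =ᶠ[nhds (Circle.exp θ : ℂ)] 1 := b.eventuallyEq_one_of_mem_ball (hc _ h)
      have h3 : (fun s => b (Circle.exp s) * ((Circle.exp s : ℂ) * q).im) =ᶠ[nhds θ]
          fun s => ((Circle.exp s : ℂ) * q).im := by
        have h4 : Continuous fun s : ℝ => (Circle.exp s : ℂ) :=
          continuous_subtype_val.comp Circle.exp.continuous
        filter_upwards [h4.continuousAt.eventually h2] with s hs
        rw [hs, Pi.one_apply, one_mul]
      rw [h3.deriv_eq, (hasDerivAt_circleExp_mul q θ).deriv]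
      ring
  change 0 < ∫ θ in (0 : ℝ)..2 * Real.pi, c (Circle.exp θ) * ((Circle.exp θ : ℂ) * q).re *
      deriv (fun s => b (Circle.exp s) * ((Circle.exp s : ℂ) * q).im) θ
  simp only [h1]
  obtain ⟨θ, hθ, hpθ⟩ : ∃ θ ∈ Set.Ico 0 (2 * Real.pi), Circle.exp p.1.arg = Circle.exp θ :=
    Circle.periodic_exp.exists_mem_Ico₀ Real.two_pi_pos _
  rw [Circle.exp_arg] at hpθ
  refine intervalIntegral.integral_pos Real.two_pi_pos ?_ (fun θ _ => ?_)
    ⟨θ, Set.Ico_subset_Icc_self hθ, ?_⟩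
  · have h4 : Continuous fun s : ℝ => (Circle.exp s : ℂ) :=
      continuous_subtype_val.comp Circle.exp.continuous
    exact ((c.continuous.comp h4).mul
      ((Complex.continuous_re.comp (h4.mul continuous_const)).pow 2)).continuousOn
  · exact mul_nonneg c.nonneg (sq_nonneg _)
  · have h4 : (p : ℂ) * q = 1 := by
      rw [Complex.mul_conj, Circle.normSq_coe, Complex.ofReal_one]
    rw [← hpθ, h4, Complex.one_re, one_pow, mul_one]
    exact c.pos_of_mem_ball (Metric.mem_ball_self c.rOut_pos)

end OrbifoldAQFT

end

theorem mainTheorem9 :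
    (∀ ħ : ℝ, ħ ≠ 0 →
      (∀ I : OrbifoldAQFT.Disk, Function.Bijective (OrbifoldAQFT.chiralBosonMul ℂ (ħ : ℂ) I)) ∧
      (OrbifoldAQFT.chiralBoson ℂ (ħ : ℂ)).gauging.Truncated) ∧
    ((∀ I : OrbifoldAQFT.Disk, ¬ Function.Surjective (OrbifoldAQFT.chiralBosonMul ℂ 0 I)) ∧
      ¬ (OrbifoldAQFT.chiralBoson ℂ 0).gauging.Truncated) ∧
    (¬ (OrbifoldAQFT.chiralBoson (PowerSeries ℂ) PowerSeries.X).gauging.Truncated ∧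
      ¬ (OrbifoldAQFT.chiralBoson (Polynomial ℂ) Polynomial.X).gauging.Truncated) := by
  refine ⟨fun ħ hħ => ?_,
    ⟨OrbifoldAQFT.chiralBosonMul_not_surjective,
      OrbifoldAQFT.chiralBoson_not_truncated not_isUnit_zero⟩,
    OrbifoldAQFT.chiralBoson_not_truncated PowerSeries.X_prime.not_isUnit,
    OrbifoldAQFT.chiralBoson_not_truncated Polynomial.not_isUnit_X⟩
  have h1 : ∀ I : OrbifoldAQFT.Disk, ∃ v w : Fin 2 → OrbifoldAQFT.Odd
      ((OrbifoldAQFT.chiralBoson ℂ (ħ : ℂ)).autAct I), ∑ i, (v i).1 * (w i).1 = 1 := fun I => by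
    obtain ⟨φ, ψ, h⟩ := OrbifoldAQFT.exists_intervalForm_ne_zero I
    exact OrbifoldAQFT.chiralBoson_exists_odd (Complex.ofReal_ne_zero.2 hħ) h
  have : Invertible (Fintype.card ℤˣ : ℂ) := invertibleOfNonzero (by simp)
  have : Invertible (2 : ℂ) := invertibleOfNonzero two_ne_zero
  refine ⟨fun I => ?_, OrbifoldAQFT.GAQFT.gauging_truncated _ fun I => ?_⟩
  · obtain ⟨v, w, h⟩ := h1 I
    exact OrbifoldAQFT.oddMul_bijective h
  · obtain ⟨v, w, h⟩ := h1 I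
    exact OrbifoldAQFT.isGaloisAction_of_odd h
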